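/- **Setting.** There are $M$ clients; client $i$ has a data distribution $\mathcal D_i$ and a loss $f_i(x,y;\xi)$, differentiable in $(x,y)\in\mathbb R^{d_1}\times\mathbb R^{d_2}$. Let $f_i(x,y)=\mathbb E_{\xi\sim\mathcal D_i}[f_i(x,y;\xi)]$, $f=\frac1M\sum_{i=1}^M f_i$ and $\Phi(x)=\max_{y\in\mathbb R^{d_2}}f(x,y)$. Assume, for constants $0<\mu\le l$, $\sigma>0$, $\sigma_G\ge 0$: 1. each $f_i$ is differentiable and $\|\nabla f_i(x_1,y_1)-\nabla f_i(x_2,y_2)\|\le l(\|x_1-x_2\|+\|y_1-y_2\|)$; 2. $\mathbb E_\xi[\nabla f_i(x,y;\xi)]=\nabla f_i(x,y)$ and $\mathbb E_\xi\|\nabla f_i(x,y;\xi)-\nabla f_i(x,y)\|^2\le\sigma^2$ for all $i,x,y$; 3. $\|\nabla f_i(x,y)-\nabla f(x,y)\|^2\le\sigma_G^2$ for all $i,x,y$; 4. $\Phi$ is bounded below; 5. for every $x$ the maximum of $f(x,\cdot)$ is attained, and $\|\nabla_yf(x,y)\|^2\ge2\mu\,(\Phi(x)-f(x,y))$ for all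 $x,y$. Put $\kappa=l/\mu$. **Algorithm (FESS-GDA)** with $m$ participating clients ($1\le m\le M$), smoothing parameter $p\ge0$, positive step sizes $\eta_{x,l},\eta_{y,l},\eta_{x,g},\eta_{y,g}$, $\beta\in(0,1)$, $K\ge1$ local updates and $T\ge1$ rounds, started at $(x_0,y_0,z_0)$. In round $t$ the server draws a uniformly random set $S_t$ of $m$ clients, independently of the past. Each $i\in S_t$ sets $(x^1_{t,i},y^1_{t,i})=(x_t,y_t)$ and, for $k=1,\dots,K$, draws a fresh independent sample $\xi^k_{t,i}\sim\mathcal D_i$ and puts $x^{k+1}_{t,i}=x^k_{t,i}-\eta_{x,l}\nabla_xf_i(x^k_{t,i},y^k_{t,i};\xi^k_{t,i})$, $y^{k+1}_{t,i}=y^k_{t,i}+\eta_{y,l}\nabla_yf_i(x^k_{t,i},y^k_{t,i};\xi^k_{t,i})$. Then $$x_{t+1}=x_t+\eta_{x,g}\Big(\tfrac1m\sum_{i\in S_t}x^{K+1}_{t,i}-x_t\Big)-\eta_{x,l}\eta_{x,g}Kp(x_t-z_t),$$ $$y_{t+1}=y_t+\eta_{y,g}\Big(\tfrac1m\sum_{i\in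 S_t}y^{K+1}_{t,i}-y_t\Big),\qquad z_{t+1}=z_t+\beta(x_{t+1}-z_t).$$ **Two-stage use.** Run FESS-GDA with $p=2l$ on $f$ from $(x_0,y_0,z_0)$; let $(\tilde x,\tilde y)$ be one of its iterates $(x_t,y_t)$, $0\le t\le T-1$, with $t$ chosen uniformly at random. Then run FESS-GDA with $p=0$, and parameters of its own, from $(\tilde x,\tilde y)$ on $\min_x\max_y\{f(x,y)+l\|x-\tilde x\|^2\}$ (that is, with the losses $f_i(x,y;\xi)+l\|x-\tilde x\|^2$), and output its last $x$-iterate $\hat x$. The per-client sample complexity is the number of data samples that any one client uses, and the communication complexity is the number of rounds, both over the two stages. Let $\hat f(x,y,z)=f(x,y)+l\|x-z\|^2$, let $\Delta_0=V_0-\min_x\Phi(x)$ with $V_0=\hat f(x_0,y_0,z_0)-2\min_x\hat f(x,y_0,z_0)+2\min_x\max_y\hat f(x,y,z_0)$, and let $\Delta>0$. **Claim.** There are a constant $C_1>0$ depending only on $l,\sigma,\Delta$ and a constant $C_2>0$ depending only on $l,\sigma,\sigma_G,\Delta$ such that for all $\mu\in(0,l]$, $1\le m\le M$ and $\epsilon>0$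 with $m\epsilon^2\le\kappa$ there are parameters for the two stages, depending only on $l,\mu,\sigma,\sigma_G,\Delta,m,M,\epsilon$, such that for every problem as above (of any dimensions) and every initial point with $\Delta_0\le\Delta$, the function $\Phi$ is differentiable and the output is an $\epsilon$-stationary point of $\Phi$ in expectation, $$\mathbb E\|\nabla\Phi(\hat x)\|\le\epsilon,$$ and moreover: * if $m=M$ or $\sigma_G=0$, the per-client sample complexity is at most $C_1\big(\kappa^2m^{-1}\epsilon^{-4}+\kappa^5m^{-1}\epsilon^{-2}\log\kappa\big)$ and the communication complexity is at most $C_1\big(\kappa\epsilon^{-2}+\kappa\log\kappa\big)$; * if $m<M$ and $\sigma_G>0$, the per-client sample complexity and the communication complexity are both at most $C_2\big(\kappa^2m^{-1}\epsilon^{-4}+\kappa^5m^{-1}\epsilon^{-2}\log\kappa\big)$. -/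

import Mathlib

open MeasureTheory ProbabilityTheory

universe u

noncomputable section

namespace FedMinimax

/-- Euclidean space of dimension `d`. -/
abbrev E (d : ℕ) : Type := EuclideanSpace ℝ (Fin d)

/-- The product of the two decision spaces, with its Euclidean norm. -/
abbrev W (d₁ d₂ : ℕ) : Type := WithLp 2 (E d₁ × E d₂)

section Objective

variable {d₁ d₂ : ℕ}

/-- The full gradient of a function of two vector variables. -/
def grad (g : E d₁ → E d₂ → ℝ) (x : E d₁) (y : E d₂) : W d₁ d₂ :=
  gradient (fun w : W d₁ d₂ => g w.fst w.snd) (WithLp.toLp 2 (x, y))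

/-- The `x`-block of the gradient. -/
def gradX (g : E d₁ → E d₂ → ℝ) (x : E d₁) (y : E d₂) : E d₁ := (grad g x y).fst

/-- The `y`-block of the gradient. -/
def gradY (g : E d₁ → E d₂ → ℝ) (x : E d₁) (y : E d₂) : E d₂ := (grad g x y).snd

/-- The primal function `Φ(x) = max_y g(x, y)`. -/
def primal (g : E d₁ → E d₂ → ℝ) (x : E d₁) : ℝ := ⨆ y, g x y

/-- The smoothed function `g(x, y) + (p / 2) ‖x - z‖²`. -/
def smoothed (p : ℝ) (g : E d₁ → E d₂ → ℝ) (z : E d₁) (x : E d₁) (y : E d₂) : ℝ :=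
  g x y + p / 2 * ‖x - z‖ ^ 2

/-- The potential `V(x, y, z) = ĝ(x, y, z) - 2 min_x' ĝ(x', y, z) + 2 min_x' max_y' ĝ(x', y', z)`,
where `ĝ` is the smoothed function. -/
def potential (p : ℝ) (g : E d₁ → E d₂ → ℝ) (x : E d₁) (y : E d₂) (z : E d₁) : ℝ :=
  smoothed p g z x y - 2 * (⨅ x', smoothed p g z x' y) + 2 * (⨅ x', primal (smoothed p g z) x')

/-- The initial gap `Δ = V(x₀, y₀, z₀) - min_x Φ(x)`. -/
def gap (p : ℝ) (g : E d₁ → E d₂ → ℝ) (x₀ : E d₁) (y₀ : E d₂) (z₀ : E d₁) : ℝ :=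
  potential p g x₀ y₀ z₀ - ⨅ x, primal g x

variable {M : ℕ} {Ξ : Fin M → Type u} [∀ i, MeasurableSpace (Ξ i)]

/-- The local objective `f_i(x, y) = 𝔼_{ξ ∼ D_i} loss_i(x, y; ξ)` of client `i`. -/
def clientObj (D : ∀ i, Measure (Ξ i)) (loss : ∀ i, E d₁ → E d₂ → Ξ i → ℝ) (i : Fin M)
    (x : E d₁) (y : E d₂) : ℝ :=
  ∫ ξ, loss i x y ξ ∂(D i)

/-- The global objective `f(x, y) = (1 / M) ∑ i, f_i(x, y)`. -/
def obj (D : ∀ i, Measure (Ξ i)) (loss : ∀ i, E d₁ → E d₂ → Ξ i → ℝ)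
    (x : E d₁) (y : E d₂) : ℝ :=
  (M : ℝ)⁻¹ * ∑ i, clientObj D loss i x y

/-- The standing assumptions of the nonconvex-PL setting, with smoothness constant `l`,
PL constant `μ`, noise level `σ` and heterogeneity level `σG`. -/
structure NCPL (l μ σ σG : ℝ) (D : ∀ i, Measure (Ξ i))
    (loss : ∀ i, E d₁ → E d₂ → Ξ i → ℝ) : Prop where
  /-- the sample losses are measurable, integrable and differentiable -/
  loss_measurable : ∀ i, Measurable fun q : (E d₁ × E d₂) × Ξ i => loss i q.1.1 q.1.2 q.2
  loss_integrable : ∀ i x y, Integrable (fun ξ => loss i x y ξ) (D i)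
  loss_differentiable : ∀ i ξ, Differentiable ℝ fun w : W d₁ d₂ => loss i w.fst w.snd ξ
  /-- every local objective is differentiable, with Lipschitz gradient -/
  client_differentiable : ∀ i, Differentiable ℝ fun w : W d₁ d₂ => clientObj D loss i w.fst w.snd
  client_smooth : ∀ i x₁ y₁ x₂ y₂,
    ‖grad (clientObj D loss i) x₁ y₁ - grad (clientObj D loss i) x₂ y₂‖
      ≤ l * (‖x₁ - x₂‖ + ‖y₁ - y₂‖)
  /-- the stochastic gradients are unbiased, with bounded variance -/
  sgrad_integrable : ∀ i x y,
    Integrable (fun ξ => grad (fun x' y' => loss i x' y' ξ) x y) (D i)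
  sgrad_unbiased : ∀ i x y,
    ∫ ξ, grad (fun x' y' => loss i x' y' ξ) x y ∂(D i) = grad (clientObj D loss i) x y
  sgrad_sq_integrable : ∀ i x y, Integrable (fun ξ =>
    ‖grad (fun x' y' => loss i x' y' ξ) x y - grad (clientObj D loss i) x y‖ ^ 2) (D i)
  sgrad_variance : ∀ i x y,
    ∫ ξ, ‖grad (fun x' y' => loss i x' y' ξ) x y - grad (clientObj D loss i) x y‖ ^ 2 ∂(D i)
      ≤ σ ^ 2
  /-- bounded heterogeneity across clients -/
  heterogeneity : ∀ i x y,
    ‖grad (clientObj D loss i) x y - grad (obj D loss) x y‖ ^ 2 ≤ σG ^ 2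
  /-- the primal function is bounded below -/
  primal_bddBelow : BddBelow (Set.range (primal (obj D loss)))
  /-- for every `x` the maximum over `y` is attained -/
  max_attained : ∀ x, ∃ y, ∀ y', obj D loss x y' ≤ obj D loss x y
  /-- the PL condition in `y` -/
  pl : ∀ x y,
    2 * μ * (primal (obj D loss) x - obj D loss x y) ≤ ‖gradY (obj D loss) x y‖ ^ 2

/-- The losses of the regularized problem `min_x max_y f(x, y) + l ‖x - c‖²`. -/
def proxLoss (l : ℝ) (loss : ∀ i, E d₁ → E d₂ → Ξ i → ℝ) (c : E d₁) :
    ∀ i, E d₁ → E d₂ → Ξ i → ℝ :=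
  fun i x y ξ => loss i x y ξ + l * ‖x - c‖ ^ 2

end Objective

section Algorithm

/-- The tunable parameters of FESS-GDA: local and global step sizes, the smoothing weight `β`,
the number `K` of local updates per round and the number `T` of communication rounds. -/
structure Params where
  ηxl : ℝ
  ηyl : ℝ
  ηxg : ℝ
  ηyg : ℝ
  β : ℝ
  K : ℕ
  T : ℕ

/-- Admissible parameters. -/
structure Params.Valid (a : Params) : Prop where
  ηxl_pos : 0 < a.ηxl
  ηyl_pos : 0 < a.ηyl
  ηxg_pos : 0 < a.ηxg
  ηyg_pos : 0 < a.ηyg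
  β_mem : a.β ∈ Set.Ioo (0 : ℝ) 1
  K_pos : 0 < a.K
  T_pos : 0 < a.T

variable {d₁ d₂ M : ℕ} {Ξ : Fin M → Type u}

/-- The state of a client during its local updates, with the number of data points it has used. -/
structure LocalState (d₁ d₂ : ℕ) where
  x : E d₁
  y : E d₂
  samples : ℕ

/-- One local descent-ascent step on the data point with loss `g`. Here `Y` is the whole space, so
the projection onto `Y` is the identity. -/
def localStep (a : Params) (g : E d₁ → E d₂ → ℝ) (s : LocalState d₁ d₂) : LocalState d₁ d₂ where
  x := s.x - a.ηxl • gradX g s.x s.y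
  y := s.y + a.ηyl • gradY g s.x s.y
  samples := s.samples + 1

/-- The local state after `k` local steps on the data points `ξ 0, …, ξ (k - 1)`. -/
def localRun {Ω : Type u} (a : Params) (loss : E d₁ → E d₂ → Ω → ℝ) (ξ : ℕ → Ω)
    (x : E d₁) (y : E d₂) : ℕ → LocalState d₁ d₂
  | 0 => ⟨x, y, 0⟩
  | k + 1 => localStep a (fun x' y' => loss x' y' (ξ k)) (localRun a loss ξ x y k)

/-- The state of the server, with the number of communication rounds performed so far and the
number of data points used so far by each client. -/
structure ServerState (d₁ d₂ M : ℕ) where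
  x : E d₁
  y : E d₂
  z : E d₁
  rounds : ℕ
  samples : Fin M → ℕ

/-- The randomness of one round: the set of participating clients and, for each client, a stream of
data points (of which a participating client uses the first `K`, and any other client none). -/
abbrev RoundDraw (Ξ : Fin M → Type u) : Type u := Finset (Fin M) × (∀ i, ℕ → Ξ i)

/-- One communication round of FESS-GDA with `m` participating clients. -/
def round (p : ℝ) (m : ℕ) (a : Params) (loss : ∀ i, E d₁ → E d₂ → Ξ i → ℝ)
    (ω : RoundDraw Ξ) (s : ServerState d₁ d₂ M) : ServerState d₁ d₂ M :=
  let loc : Fin M → LocalState d₁ d₂ := fun i => localRun a (loss i) (ω.2 i) s.x s.y a.K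
  let x' : E d₁ := s.x + a.ηxg • ((m : ℝ)⁻¹ • (∑ i ∈ ω.1, (loc i).x) - s.x)
    - (a.ηxl * a.ηxg * a.K * p) • (s.x - s.z)
  { x := x'
    y := s.y + a.ηyg • ((m : ℝ)⁻¹ • (∑ i ∈ ω.1, (loc i).y) - s.y)
    z := s.z + a.β • (x' - s.z)
    rounds := s.rounds + 1
    samples := fun i => s.samples i + if i ∈ ω.1 then (loc i).samples else 0 }

/-- The server state after `t` rounds of FESS-GDA started at `(x₀, y₀, z₀)`. -/
def run (p : ℝ) (m : ℕ) (a : Params) (loss : ∀ i, E d₁ → E d₂ → Ξ i → ℝ)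
    (x₀ : E d₁) (y₀ : E d₂) (z₀ : E d₁) (ω : ℕ → RoundDraw Ξ) : ℕ → ServerState d₁ d₂ M
  | 0 => ⟨x₀, y₀, z₀, 0, fun _ => 0⟩
  | t + 1 => round p m a loss (ω t) (run p m a loss x₀ y₀ z₀ ω t)

/-- The law of the randomness of a run: the rounds are independent, and in each round the set of
participating clients is uniform among the sets of `m` clients, and independent of the data points,
which are independent samples from the local distributions. -/
def drawLaw [∀ i, MeasurableSpace (Ξ i)] (m : ℕ) (D : ∀ i, Measure (Ξ i))
    [∀ i, IsProbabilityMeasure (D i)] : Measure (ℕ → RoundDraw Ξ) :=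
  Measure.infinitePi fun _ : ℕ =>
    (uniformOn {S : Finset (Fin M) | S.card = m}).prod
      (Measure.pi fun i => Measure.infinitePi fun _ : ℕ => D i)

/-- The randomness of the two-stage method: the index of the iterate that the first stage returns,
and the randomness of the two runs. -/
abbrev TwoStageDraw (Ξ : Fin M → Type u) (T : ℕ) : Type u :=
  Fin T × (ℕ → RoundDraw Ξ) × (ℕ → RoundDraw Ξ)

/-- The law of the randomness of the two-stage method: the index is uniform, and everything is
independent. -/
def twoStageLaw [∀ i, MeasurableSpace (Ξ i)] (m T : ℕ) (D : ∀ i, Measure (Ξ i))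
    [∀ i, IsProbabilityMeasure (D i)] : Measure (TwoStageDraw Ξ T) :=
  (uniformOn (Set.univ : Set (Fin T))).prod ((drawLaw m D).prod (drawLaw m D))

/-- First stage: a run of FESS-GDA with `p = 2l` on the original problem. -/
def stageOne (l : ℝ) (m : ℕ) (a : Params) (loss : ∀ i, E d₁ → E d₂ → Ξ i → ℝ)
    (x₀ : E d₁) (y₀ : E d₂) (z₀ : E d₁) (ω : TwoStageDraw Ξ a.T) (t : ℕ) : ServerState d₁ d₂ M :=
  run (2 * l) m a loss x₀ y₀ z₀ ω.2.1 t

/-- Second stage: a run of FESS-GDA with `p = 0` on the regularized problem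
`min_x max_y f(x, y) + l ‖x - x̃‖²`, started at a uniformly random iterate `(x̃, ỹ)` of the
first stage. -/
def stageTwo (l : ℝ) (m : ℕ) (a b : Params) (loss : ∀ i, E d₁ → E d₂ → Ξ i → ℝ)
    (x₀ : E d₁) (y₀ : E d₂) (z₀ : E d₁) (ω : TwoStageDraw Ξ a.T) : ServerState d₁ d₂ M :=
  let w := stageOne l m a loss x₀ y₀ z₀ ω ω.1
  run 0 m b (proxLoss l loss w.x) w.x w.y w.x ω.2.2 b.T

/-- The output of the two-stage method. -/
def output (l : ℝ) (m : ℕ) (a b : Params) (loss : ∀ i, E d₁ → E d₂ → Ξ i → ℝ)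
    (x₀ : E d₁) (y₀ : E d₂) (z₀ : E d₁) (ω : TwoStageDraw Ξ a.T) : E d₁ :=
  (stageTwo l m a b loss x₀ y₀ z₀ ω).x

/-- The number of communication rounds of the two-stage method. -/
def commCost (l : ℝ) (m : ℕ) (a b : Params) (loss : ∀ i, E d₁ → E d₂ → Ξ i → ℝ)
    (x₀ : E d₁) (y₀ : E d₂) (z₀ : E d₁) (ω : TwoStageDraw Ξ a.T) : ℕ :=
  (stageOne l m a loss x₀ y₀ z₀ ω a.T).rounds + (stageTwo l m a b loss x₀ y₀ z₀ ω).rounds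

/-- The number of data points that client `i` uses in the two-stage method. -/
def sampleCost (l : ℝ) (m : ℕ) (a b : Params) (loss : ∀ i, E d₁ → E d₂ → Ξ i → ℝ)
    (x₀ : E d₁) (y₀ : E d₂) (z₀ : E d₁) (ω : TwoStageDraw Ξ a.T) (i : Fin M) : ℕ :=
  (stageOne l m a loss x₀ y₀ z₀ ω a.T).samples i + (stageTwo l m a b loss x₀ y₀ z₀ ω).samples i

end Algorithm

end FedMinimax

end

/-! A round is one descent-ascent step on the global objective, with effective step sizes `A` in x
and `A / 4` in y, along the true gradient plus an error. The error has three sources: sampling noise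
(centered, variance at most σ²/(mK)), partial participation (centered, variance at most σ_G²/m,
absent if m = M or σ_G = 0) and client drift, the only bias. Only products of a local and a global
step size enter `A`, so the local one can be taken so small that the drift is negligible for any K.
The method then behaves like stochastic gradient descent-ascent with gradient variance N of order
σ²/(mK), plus σ_G²/m under partial participation (`roundErr_bounds`, `exists_round_error`).

For the first stage, write reg = f + l‖x − z‖², dual = min_x reg and envelope = min_x max_y reg. As
f is l-weakly convex in x, reg is l-strongly convex there, so its minimizer is Lipschitz in y and z.
The PL inequality in y, used at that minimizer, gives envelope − dual ≤ ‖∇dual‖²/(2μ) without any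
minimax theorem. The potential reg − 2 dual + 2 envelope decreases along descent in x and ascent in
y, and moving the center at a rate β proportional to Aμ costs only a fraction of this gain
(`lyapunov_center_step`, `step_bound`). Telescoping bounds the average residual by a multiple of
Δ/(AT) + lAN (`sum_residual_le`).

In the second stage the center is frozen at the returned point x̃. The potential minus the envelope
is bounded by squared gradients over 2l and 2μ, hence contracts by 1 − Aμ/4 per round to a noise
floor of order κAN (`lyapunov_last_le`). Its initial value is at most 9κ²/l times the first-stage
residual, so order κ log κ rounds suffice when A is of order 1/l.

Finally, ‖∇Φ‖ at the proximal point of x̃ is 2l times the distance from x̃ to that point, whose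
square is controlled by κ times the residual, and ∇Φ is Lipschitz with a constant of order lκ
(`norm_gradient_primal_le`). So the residual must be of order ε²/κ, and the second-stage potential
of order ε²/(lκ³).

These targets fix the counts. Without participation error, A is of order 1/l and the variance is
reduced by local steps: T₁ ~ κ/ε², K₁ ~ κ/(mε²), T₂ ~ κ log κ, K₂ ~ κ⁴/(mε²). With it, local steps
do not reduce the σ_G²/m term, so K = 1 and `A` is shrunk instead. -/

noncomputable section
set_option linter.unusedSectionVars false
namespace FedMinimax

/-! ### Weakly convex functions with a quadratic upper bound, and their proximal points. -/

/-- `φ` has the gradient map `g`, in the sense of quadratic bounds with the curvature constants `l`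
from below and `C` from above. -/
structure QuadBounds {d : ℕ} (φ : E d → ℝ) (g : E d → E d) (l C : ℝ) : Prop where
  lower : ∀ x₁ x₂, φ x₁ + inner ℝ (g x₁) (x₂ - x₁) - l / 2 * ‖x₂ - x₁‖ ^ 2 ≤ φ x₂
  upper : ∀ x₁ x₂, φ x₂ ≤ φ x₁ + inner ℝ (g x₁) (x₂ - x₁) + C / 2 * ‖x₂ - x₁‖ ^ 2

/-- A global minimizer of `φ`, if there is one. -/
def argmin {d : ℕ} (φ : E d → ℝ) : E d :=
  open Classical in if h : ∃ x, ∀ x', φ x ≤ φ x' then h.choose else 0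

/-- The proximal function `φ(x) + l ‖x - c‖²`. -/
def proxFun {d : ℕ} (l : ℝ) (φ : E d → ℝ) (c x : E d) : ℝ := φ x + l * ‖x - c‖ ^ 2

/-- The proximal point of `φ` at `c`. -/
def prox {d : ℕ} (l : ℝ) (φ : E d → ℝ) (c : E d) : E d := argmin (proxFun l φ c)

namespace QuadBounds

variable {d : ℕ} {φ : E d → ℝ} {g : E d → E d} {l C : ℝ}

/-- The two bounds squeeze the first-order remainder to O(‖x' − x‖²). Differentiability is thus a
conclusion, which is how it is obtained for the primal function. -/
theorem hasGradientAt (h : QuadBounds φ g l C) (x : E d) : HasGradientAt φ (g x) x := by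
  rw [hasGradientAt_iff_isLittleO]
  have hO : (fun x' => φ x' - φ x - inner ℝ (g x) (x' - x)) =O[nhds x]
      fun x' => ‖x' - x‖ ^ 2 := by
    refine Asymptotics.IsBigO.of_bound (|l / 2| + |C / 2|) (Filter.Eventually.of_forall fun x' => ?_)
    have h1 := h.lower x x'
    have h2 := h.upper x x'
    have h0 : (0 : ℝ) ≤ ‖x' - x‖ ^ 2 := by positivity
    rw [Real.norm_eq_abs, Real.norm_eq_abs, abs_of_nonneg h0, abs_le]
    have e1 := mul_le_mul_of_nonneg_right (le_abs_self (l / 2)) h0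
    have e2 := mul_le_mul_of_nonneg_right (le_abs_self (C / 2)) h0
    have e3 := mul_nonneg (abs_nonneg (l / 2)) h0
    have e4 := mul_nonneg (abs_nonneg (C / 2)) h0
    constructor <;> nlinarith
  refine hO.trans_isLittleO ?_
  have : (fun x' => ‖x' - x‖ ^ 2) =o[nhds x] fun x' => ‖x' - x‖ := by
    have h1 : Filter.Tendsto (fun x' => ‖x' - x‖) (nhds x) (nhds 0) := by
      have : Continuous fun x' : E d => ‖x' - x‖ := by fun_prop
      simpa using this.tendsto x
    have := (Asymptotics.isLittleO_pow_id (𝕜 := ℝ) (one_lt_two)).comp_tendsto h1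
    simpa [Function.comp_def] using this
  exact this.of_norm_right

theorem continuous (h : QuadBounds φ g l C) : Continuous φ :=
  continuous_iff_continuousAt.2 fun x => (h.hasGradientAt x).continuousAt

theorem gradient_eq (h : QuadBounds φ g l C) (x : E d) : gradient φ x = g x :=
  (h.hasGradientAt x).gradient

/-- Three bounds are added: the lower one from `x₁` to `x₂ + w`, the upper ones from `x₂` to `x₂ +
w` and from `x₁` to `x₂`. With `w` of length r = ‖x₁ − x₂‖ along the difference of gradients, the
linear terms leave r‖g x₁ − g x₂‖ and the quadratic ones at most (2l + C)r². -/
theorem gradient_sub_le (h : QuadBounds φ g l C) (hl : 0 ≤ l) (hlC : l ≤ C) (x₁ x₂ : E d) :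
    ‖g x₁ - g x₂‖ ≤ 3 * C * ‖x₁ - x₂‖ := by
  have hC : 0 ≤ C := hl.trans hlC
  by_cases hg : g x₁ - g x₂ = 0
  · rw [hg, norm_zero]; positivity
  have hn : 0 < ‖g x₁ - g x₂‖ := norm_pos_iff.2 hg
  set r := ‖x₁ - x₂‖ with hr
  by_cases hr0 : r = 0
  · have : x₁ = x₂ := by rwa [hr, norm_eq_zero, sub_eq_zero] at hr0
    exact absurd (by rw [this, sub_self]) hg
  have hrp : 0 < r := lt_of_le_of_ne (norm_nonneg _) (Ne.symm hr0)
  set w : E d := (r / ‖g x₁ - g x₂‖) • (g x₁ - g x₂) with hw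
  have hwn : ‖w‖ = r := by
    rw [hw, norm_smul, Real.norm_of_nonneg (by positivity)]; field_simp
  have h1 := h.lower x₁ (x₂ + w)
  have h2 := h.upper x₂ (x₂ + w)
  have h3 := h.upper x₁ x₂
  have e2 : x₂ + w - x₂ = w := by abel
  have e1 : x₂ + w - x₁ = w + (x₂ - x₁) := by abel
  have n1 : ‖x₂ + w - x₁‖ ≤ 2 * r := by
    rw [e1]; refine (norm_add_le _ _).trans ?_
    rw [hwn, norm_sub_rev]; linarith
  have n1' : ‖x₂ + w - x₁‖ ^ 2 ≤ 4 * r ^ 2 := by nlinarith [norm_nonneg (x₂ + w - x₁)]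
  have n3 : ‖x₂ - x₁‖ = r := by rw [norm_sub_rev]
  rw [e2, hwn] at h2
  rw [n3] at h3
  have h4 := h.lower x₂ x₁
  have h3' := h.lower x₁ x₂
  have i1 : inner ℝ (g x₁) (x₂ + w - x₁) = inner ℝ (g x₁) w + inner ℝ (g x₁) (x₂ - x₁) := by
    rw [e1, inner_add_right]
  have i2 : inner ℝ (g x₁) w - inner ℝ (g x₂) w = r * ‖g x₁ - g x₂‖ := by
    rw [← inner_sub_left, hw, inner_smul_right, real_inner_self_eq_norm_sq]; field_simp
  have hmul := mul_le_mul_of_nonneg_left n1' (by positivity : 0 ≤ l / 2)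
  have hlr := mul_le_mul_of_nonneg_right hlC (sq_nonneg r)
  have key : r * ‖g x₁ - g x₂‖ ≤ r * (3 * C * r) := by nlinarith
  exact le_of_mul_le_mul_left key hrp

/-- The curvature 2l of the penalty outweighs the curvature −l of `φ`, which leaves strong convexity
with modulus l. All properties of the proximal point rest on this. -/
theorem proxFun_lower (h : QuadBounds φ g l C) (c x₁ x₂ : E d) :
    proxFun l φ c x₁ + inner ℝ (g x₁ + (2 * l) • (x₁ - c)) (x₂ - x₁) + l / 2 * ‖x₂ - x₁‖ ^ 2
      ≤ proxFun l φ c x₂ := by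
  have h1 := h.lower x₁ x₂
  have e : x₂ - c = (x₁ - c) + (x₂ - x₁) := by abel
  have : ‖x₂ - c‖ ^ 2 = ‖x₁ - c‖ ^ 2 + 2 * inner ℝ (x₁ - c) (x₂ - x₁) + ‖x₂ - x₁‖ ^ 2 := by
    rw [e, norm_add_sq_real]
  simp only [proxFun, this, inner_add_left, inner_smul_left, conj_trivial]
  linarith

theorem proxFun_upper (h : QuadBounds φ g l C) (c x₁ x₂ : E d) :
    proxFun l φ c x₂ ≤ proxFun l φ c x₁ + inner ℝ (g x₁ + (2 * l) • (x₁ - c)) (x₂ - x₁)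
      + (C / 2 + l) * ‖x₂ - x₁‖ ^ 2 := by
  have h1 := h.upper x₁ x₂
  have e : x₂ - c = (x₁ - c) + (x₂ - x₁) := by abel
  have : ‖x₂ - c‖ ^ 2 = ‖x₁ - c‖ ^ 2 + 2 * inner ℝ (x₁ - c) (x₂ - x₁) + ‖x₂ - x₁‖ ^ 2 := by
    rw [e, norm_add_sq_real]
  simp only [proxFun, this, inner_add_left, inner_smul_left, conj_trivial]
  linarith

theorem continuous_proxFun (h : QuadBounds φ g l C) (c : E d) : Continuous (proxFun l φ c) := by
  have := h.continuous
  unfold proxFun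
  fun_prop

theorem exists_min (h : QuadBounds φ g l C) (hl : 0 < l) (c : E d) :
    ∃ x, ∀ x', proxFun l φ c x ≤ proxFun l φ c x' := by
  refine (h.continuous_proxFun c).exists_forall_le ?_
  have hb : ∀ x, proxFun l φ c c - ‖g c‖ * ‖x - c‖ + l / 2 * ‖x - c‖ ^ 2 ≤ proxFun l φ c x := by
    intro x
    have h1 := h.proxFun_lower c c x
    have h2 := neg_le_of_abs_le (abs_real_inner_le_norm (g c) (x - c))
    rw [sub_self, smul_zero, add_zero] at h1
    linarith
  refine Filter.tendsto_atTop_mono hb ?_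
  have h1 : Filter.Tendsto (fun x : E d => ‖x - c‖) (Filter.cocompact (E d)) Filter.atTop := by
    have := (tendsto_norm_cocompact_atTop (E := E d)).comp
      ((Homeomorph.subRight c).isClosedEmbedding.tendsto_cocompact)
    simpa [Function.comp_def] using this
  have h2 : Filter.Tendsto (fun t : ℝ => proxFun l φ c c - ‖g c‖ * t + l / 2 * t ^ 2)
      Filter.atTop Filter.atTop := by
    have : Filter.Tendsto (fun t : ℝ => t * (l / 2 * t - ‖g c‖)) Filter.atTop Filter.atTop := by
      refine Filter.tendsto_id.atTop_mul_atTop₀ ?_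
      exact Filter.tendsto_atTop_add_const_right _ _
        (Filter.tendsto_id.const_mul_atTop (by positivity))
    refine (Filter.tendsto_atTop_add_const_left _ (proxFun l φ c c) this).congr fun t => ?_
    ring
  exact h2.comp h1

theorem prox_le (h : QuadBounds φ g l C) (hl : 0 < l) (c x : E d) :
    proxFun l φ c (prox l φ c) ≤ proxFun l φ c x := by
  have := h.exists_min hl c
  unfold prox argmin
  rw [dif_pos this]
  exact this.choose_spec x

theorem prox_gradient (h : QuadBounds φ g l C) (hl : 0 < l) (hC : 0 ≤ C) (c : E d) :
    g (prox l φ c) + (2 * l) • (prox l φ c - c) = 0 := by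
  set x := prox l φ c
  set w := g x + (2 * l) • (x - c) with hw
  by_contra hne
  have hn : 0 < ‖w‖ ^ 2 := by have := norm_pos_iff.2 hne; positivity
  have hD : 0 < C / 2 + l := by positivity
  -- At this step length the quadratic term of the upper bound eats half of the linear decrease, so
  -- a nonzero gradient would contradict minimality.
  set s : ℝ := 1 / (2 * (C / 2 + l)) with hs
  have hsp : 0 < s := by positivity
  have h1 := h.prox_le hl c (x - s • w)
  have h2 := h.proxFun_upper c x (x - s • w)
  have e : x - s • w - x = -(s • w) := by abel
  rw [← hw, e, inner_neg_right, inner_smul_right, real_inner_self_eq_norm_sq, norm_neg, norm_smul,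
    Real.norm_of_nonneg hsp.le, mul_pow] at h2
  have h3 : (C / 2 + l) * (s ^ 2 * ‖w‖ ^ 2) = s / 2 * ‖w‖ ^ 2 := by
    rw [hs]; field_simp
  have : 0 < s * ‖w‖ ^ 2 := by positivity
  change proxFun l φ c x ≤ _ at h1
  linarith

theorem dist_prox_sq_le (h : QuadBounds φ g l C) (hl : 0 < l) (hC : 0 ≤ C) (c x : E d) :
    l / 2 * ‖x - prox l φ c‖ ^ 2 ≤ proxFun l φ c x - proxFun l φ c (prox l φ c) := by
  have h1 := h.proxFun_lower c (prox l φ c) x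
  rw [h.prox_gradient hl hC c, inner_zero_left] at h1
  linarith

/-- Strong convexity implies the PL inequality: minimize the lower bound over the displacement. -/
theorem gap_le (h : QuadBounds φ g l C) (hl : 0 < l) (c x : E d) :
    proxFun l φ c x - proxFun l φ c (prox l φ c) ≤ ‖g x + (2 * l) • (x - c)‖ ^ 2 / (2 * l) := by
  set w := g x + (2 * l) • (x - c) with hw
  have h1 := h.proxFun_lower c x (prox l φ c)
  rw [← hw] at h1
  set r := prox l φ c - x
  have h2 := neg_le_of_abs_le (abs_real_inner_le_norm w r)
  have h3 : 0 ≤ (‖w‖ - l * ‖r‖) ^ 2 := sq_nonneg _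
  rw [le_div_iff₀ (by positivity)]
  nlinarith

/-- Strong convexity is used at `x` and, through quadratic growth, at the minimizer; the sum reads l
r² ≤ ‖w‖ r. -/
theorem dist_prox_le (h : QuadBounds φ g l C) (hl : 0 < l) (hC : 0 ≤ C) (c x : E d) :
    l * ‖x - prox l φ c‖ ≤ ‖g x + (2 * l) • (x - c)‖ := by
  set w := g x + (2 * l) • (x - c) with hw
  have h1 := h.proxFun_lower c x (prox l φ c)
  rw [← hw] at h1
  have h2 := h.dist_prox_sq_le hl hC c x
  have h3 := neg_le_of_abs_le (abs_real_inner_le_norm w (prox l φ c - x))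
  rw [norm_sub_rev (prox l φ c) x] at h1 h3
  rcases (norm_nonneg (x - prox l φ c)).eq_or_lt with h0 | h0
  · rw [← h0, mul_zero]; positivity
  · refine le_of_mul_le_mul_right ?_ h0
    nlinarith

/-- At the proximal point of `c`, the gradient of the proximal function centered at `c'` is just
2l(c − c'). -/
theorem prox_sub_le (h : QuadBounds φ g l C) (hl : 0 < l) (hC : 0 ≤ C) (c c' : E d) :
    ‖prox l φ c - prox l φ c'‖ ≤ 2 * ‖c - c'‖ := by
  have h1 := h.dist_prox_le hl hC c' (prox l φ c)
  have h2 := h.prox_gradient hl hC c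
  have e : g (prox l φ c) + (2 * l) • (prox l φ c - c') = (2 * l) • (c - c') := by
    have : (2 * l) • (prox l φ c - c') = (2 * l) • (prox l φ c - c) + (2 * l) • (c - c') := by
      rw [← smul_add]; congr 1; abel
    rw [this, ← add_assoc, h2, zero_add]
  rw [e, norm_smul, Real.norm_of_nonneg (by positivity)] at h1
  refine le_of_mul_le_mul_left (h1.trans_eq ?_) hl
  ring

theorem iInf_proxFun (h : QuadBounds φ g l C) (hl : 0 < l) (c : E d) :
    ⨅ x, proxFun l φ c x = proxFun l φ c (prox l φ c) :=
  le_antisymm (ciInf_le ⟨_, Set.forall_mem_range.2 (h.prox_le hl c)⟩ _)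
    (le_ciInf (h.prox_le hl c))

end QuadBounds

/-! ### First-order expansion with a quadratic remainder, from a Lipschitz gradient. -/

theorem abs_sub_sub_deriv_le {φ φ' : ℝ → ℝ} {A : ℝ} (hφ : ∀ t, HasDerivAt φ (φ' t) t)
    (hA : ∀ t, 0 ≤ t → t ≤ 1 → |φ' t - φ' 0| ≤ A * t) : |φ 1 - φ 0 - φ' 0| ≤ A / 2 := by
  -- The sign `s` treats both halves of the absolute value; each is the monotonicity of A t²/2 +
  -- s(φ'(0) t − φ(t)) on [0, 1].
  have key : ∀ s : ℝ, (s = 1 ∨ s = -1) → s * (φ 1 - φ 0 - φ' 0) ≤ A / 2 := by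
    intro s hs
    have hd : ∀ t, HasDerivAt (fun t => A * t ^ 2 / 2 + s * (φ' 0 * t - φ t))
        (A * t + s * (φ' 0 - φ' t)) t := by
      intro t
      have h1 : HasDerivAt (fun t : ℝ => A * t ^ 2 / 2) (A * t) t := by
        have := ((hasDerivAt_pow 2 t).const_mul A).div_const 2
        refine this.congr_deriv ?_
        simp; ring
      have h2 : HasDerivAt (fun t : ℝ => φ' 0 * t) (φ' 0) t := by
        simpa using (hasDerivAt_id t).const_mul (φ' 0)
      exact h1.add ((h2.sub (hφ t)).const_mul s)
    have hm : MonotoneOn (fun t => A * t ^ 2 / 2 + s * (φ' 0 * t - φ t)) (Set.Icc 0 1) := by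
      refine monotoneOn_of_deriv_nonneg (convex_Icc 0 1)
        (fun t _ => (hd t).continuousAt.continuousWithinAt)
        (fun t _ => (hd t).differentiableAt.differentiableWithinAt) fun t ht => ?_
      rw [interior_Icc] at ht
      rw [(hd t).deriv]
      have := abs_le.1 (hA t ht.1.le ht.2.le)
      rcases hs with rfl | rfl <;> linarith [this.1, this.2]
    have := hm (Set.left_mem_Icc.2 zero_le_one) (Set.right_mem_Icc.2 zero_le_one) zero_le_one
    simp only at this
    linarith
  have h1 := key 1 (Or.inl rfl)
  have h2 := key (-1) (Or.inr rfl)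
  rw [abs_le]
  constructor <;> linarith

theorem abs_sub_sub_inner_gradient_le {F : Type*} [NormedAddCommGroup F] [InnerProductSpace ℝ F]
    [CompleteSpace F] {G : F → ℝ} (hG : Differentiable ℝ G) (w v : F) {A : ℝ}
    (hA : ∀ t : ℝ, 0 ≤ t → t ≤ 1 →
      |inner ℝ (gradient G (w + t • v) - gradient G w) v| ≤ A * t) :
    |G (w + v) - G w - inner ℝ (gradient G w) v| ≤ A / 2 := by
  have hline : ∀ t : ℝ, HasDerivAt (fun t : ℝ => w + t • v) v t := fun t => by
    simpa using ((hasDerivAt_id t).smul_const v).const_add w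
  have hd : ∀ t : ℝ, HasDerivAt (fun t : ℝ => G (w + t • v))
      (inner ℝ (gradient G (w + t • v)) v) t := fun t => by
    simpa [Function.comp_def] using
      (hG (w + t • v)).hasGradientAt.hasFDerivAt.comp_hasDerivAt t (hline t)
  have := abs_sub_sub_deriv_le (A := A) hd fun t ht0 ht1 => by
    rw [← inner_sub_left, zero_smul, add_zero]
    exact hA t ht0 ht1
  simpa using this

section

variable {d₁ d₂ : ℕ}

theorem norm_W_le (w : W d₁ d₂) : ‖w‖ ≤ ‖w.fst‖ + ‖w.snd‖ := by
  have h := WithLp.prod_norm_sq_eq_of_L2 w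
  have h1 := norm_nonneg w.fst
  have h2 := norm_nonneg w.snd
  have : ‖w‖ ^ 2 ≤ (‖w.fst‖ + ‖w.snd‖) ^ 2 := by nlinarith
  exact le_of_sq_le_sq this (by positivity)

theorem norm_fst_le (w : W d₁ d₂) : ‖w.fst‖ ≤ ‖w‖ := by
  have h := WithLp.prod_norm_sq_eq_of_L2 w
  exact le_of_sq_le_sq (by nlinarith [sq_nonneg ‖w.snd‖]) (norm_nonneg _)

theorem norm_snd_le (w : W d₁ d₂) : ‖w.snd‖ ≤ ‖w‖ := by
  have h := WithLp.prod_norm_sq_eq_of_L2 w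
  exact le_of_sq_le_sq (by nlinarith [sq_nonneg ‖w.fst‖]) (norm_nonneg _)

/-- The gradient of `f` exists everywhere and is Lipschitz with constant `l`, in the sum norm on the
domain. -/
structure SmoothGrad (l : ℝ) (f : E d₁ → E d₂ → ℝ) : Prop where
  differentiable : Differentiable ℝ fun w : W d₁ d₂ => f w.fst w.snd
  lipschitz : ∀ x₁ y₁ x₂ y₂, ‖grad f x₁ y₁ - grad f x₂ y₂‖ ≤ l * (‖x₁ - x₂‖ + ‖y₁ - y₂‖)

namespace SmoothGrad

variable {l : ℝ} {f : E d₁ → E d₂ → ℝ}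

theorem gradX_sub_le (h : SmoothGrad l f) (x₁ x₂ : E d₁) (y₁ y₂ : E d₂) :
    ‖gradX f x₁ y₁ - gradX f x₂ y₂‖ ≤ l * (‖x₁ - x₂‖ + ‖y₁ - y₂‖) := by
  have := norm_fst_le (grad f x₁ y₁ - grad f x₂ y₂)
  rw [WithLp.sub_fst] at this
  exact this.trans (h.lipschitz x₁ y₁ x₂ y₂)

theorem gradY_sub_le (h : SmoothGrad l f) (x₁ x₂ : E d₁) (y₁ y₂ : E d₂) :
    ‖gradY f x₁ y₁ - gradY f x₂ y₂‖ ≤ l * (‖x₁ - x₂‖ + ‖y₁ - y₂‖) := by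
  have := norm_snd_le (grad f x₁ y₁ - grad f x₂ y₂)
  rw [WithLp.sub_snd] at this
  exact this.trans (h.lipschitz x₁ y₁ x₂ y₂)

theorem two_point (h : SmoothGrad l f) (hl : 0 ≤ l) (x₁ x₂ : E d₁) (y₁ y₂ : E d₂) :
    |f x₂ y₂ - f x₁ y₁ - (inner ℝ (gradX f x₁ y₁) (x₂ - x₁) + inner ℝ (gradY f x₁ y₁) (y₂ - y₁))|
      ≤ l / 2 * (‖x₂ - x₁‖ + ‖y₂ - y₁‖) ^ 2 := by
  have hvr : ‖(WithLp.toLp 2 (x₂ - x₁, y₂ - y₁) : W d₁ d₂)‖ ≤ ‖x₂ - x₁‖ + ‖y₂ - y₁‖ :=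
    norm_W_le (WithLp.toLp 2 (x₂ - x₁, y₂ - y₁))
  have hr0 : 0 ≤ ‖x₂ - x₁‖ + ‖y₂ - y₁‖ := by positivity
  have key := abs_sub_sub_inner_gradient_le h.differentiable (WithLp.toLp 2 (x₁, y₁))
    (WithLp.toLp 2 (x₂ - x₁, y₂ - y₁)) (A := l * (‖x₂ - x₁‖ + ‖y₂ - y₁‖) ^ 2) fun t ht0 _ => by
      refine (abs_real_inner_le_norm _ _).trans ?_
      have h2 := h.lipschitz (x₁ + t • (x₂ - x₁)) (y₁ + t • (y₂ - y₁)) x₁ y₁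
      rw [add_sub_cancel_left, add_sub_cancel_left, norm_smul, norm_smul,
        Real.norm_of_nonneg ht0, ← mul_add] at h2
      refine (mul_le_mul h2 hvr (norm_nonneg _) (by positivity)).trans_eq ?_
      ring
  rw [WithLp.prod_inner_apply, ← WithLp.toLp_add, Prod.mk_add_mk, add_sub_cancel,
    add_sub_cancel] at key
  exact key.trans_eq (by ring)

theorem quadBoundsX (h : SmoothGrad l f) (hl : 0 ≤ l) (y : E d₂) :
    QuadBounds (fun x => f x y) (fun x => gradX f x y) l l := by
  constructor <;> intro x₁ x₂ <;> have := abs_le.1 (h.two_point hl x₁ x₂ y y) <;>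
    simp only [sub_self, inner_zero_right, norm_zero, add_zero] at this <;>
    linarith [this.1, this.2]

theorem quadBoundsY (h : SmoothGrad l f) (hl : 0 ≤ l) (x : E d₁) :
    QuadBounds (fun y => f x y) (fun y => gradY f x y) l l := by
  constructor <;> intro y₁ y₂ <;> have := abs_le.1 (h.two_point hl x x y₁ y₂) <;>
    simp only [sub_self, inner_zero_right, norm_zero, zero_add] at this <;>
    linarith [this.1, this.2]

end SmoothGrad

/-! ### Primal function, dual function and Moreau envelope under the PL inequality. -/

/-- A smooth function that is bounded above with attained maximum in its second variable, where it
satisfies the Polyak-Lojasiewicz inequality, and whose primal function is bounded below. -/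
structure SmoothPL (l μ : ℝ) (f : E d₁ → E d₂ → ℝ) : Prop extends SmoothGrad l f where
  l_pos : 0 < l
  μ_pos : 0 < μ
  primal_bddBelow : BddBelow (Set.range (primal f))
  max_attained : ∀ x, ∃ y, ∀ y', f x y' ≤ f x y
  pl : ∀ x y, 2 * μ * (primal f x - f x y) ≤ ‖gradY f x y‖ ^ 2

/-- The minimizer over `x` of `f(x, y) + l ‖x - c‖²`. -/
def xmin (l : ℝ) (f : E d₁ → E d₂ → ℝ) (y : E d₂) (c : E d₁) : E d₁ := prox l (fun x => f x y) c

/-- The regularized function `f(x, y) + l ‖x - c‖²`. -/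
def reg (l : ℝ) (f : E d₁ → E d₂ → ℝ) (c x : E d₁) (y : E d₂) : ℝ :=
  proxFun l (fun x => f x y) c x

/-- The `x`-gradient of the regularized function. -/
def regGradX (l : ℝ) (f : E d₁ → E d₂ → ℝ) (c x : E d₁) (y : E d₂) : E d₁ :=
  gradX f x y + (2 * l) • (x - c)

/-- The dual function `min_x (f(x, y) + l ‖x - c‖²)`. -/
def dual (l : ℝ) (f : E d₁ → E d₂ → ℝ) (y : E d₂) (c : E d₁) : ℝ := reg l f c (xmin l f y c) y

/-- The gradient of the dual function. -/
def dualGrad (l : ℝ) (f : E d₁ → E d₂ → ℝ) (y : E d₂) (c : E d₁) : E d₂ :=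
  gradY f (xmin l f y c) y

/-- The Moreau envelope `min_x (Φ(x) + l ‖x - c‖²)` of the primal function. -/
def envelope (l : ℝ) (f : E d₁ → E d₂ → ℝ) (c : E d₁) : ℝ :=
  proxFun l (primal f) c (prox l (primal f) c)

namespace SmoothPL

variable {l μ : ℝ} {f : E d₁ → E d₂ → ℝ}

theorem le_primal (h : SmoothPL l μ f) (x : E d₁) (y : E d₂) : f x y ≤ primal f x := by
  obtain ⟨y₀, hy₀⟩ := h.max_attained x
  exact le_ciSup (f := fun y => f x y) ⟨f x y₀, Set.forall_mem_range.2 hy₀⟩ y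

theorem exists_primal_eq (h : SmoothPL l μ f) (x : E d₁) : ∃ y, primal f x = f x y := by
  obtain ⟨y₀, hy₀⟩ := h.max_attained x
  exact ⟨y₀, le_antisymm (ciSup_le hy₀) (h.le_primal x y₀)⟩

/-- An ascent step of length 1/l gains ‖∇_y f‖²/(2l) and cannot rise above the maximum. -/
theorem gradY_sq_le (h : SmoothPL l μ f) (x : E d₁) (y : E d₂) :
    ‖gradY f x y‖ ^ 2 ≤ 2 * l * (primal f x - f x y) := by
  have hl := h.l_pos
  have h1 := (h.quadBoundsY hl.le x).lower y (y + (1 / l) • gradY f x y)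
  have h2 := h.le_primal x (y + (1 / l) • gradY f x y)
  rw [add_sub_cancel_left, inner_smul_right, real_inner_self_eq_norm_sq, norm_smul,
    Real.norm_of_nonneg (by positivity)] at h1
  have h3 : 1 / l * ‖gradY f x y‖ ^ 2 - l / 2 * (1 / l * ‖gradY f x y‖) ^ 2
      = ‖gradY f x y‖ ^ 2 / (2 * l) := by field_simp; ring
  have h4 : ‖gradY f x y‖ ^ 2 / (2 * l) ≤ primal f x - f x y := by linarith
  rw [div_le_iff₀ (by positivity)] at h4
  linarith

/-- A maximizer of `f(x, ·)`. -/
def ymax (h : SmoothPL l μ f) (x : E d₁) : E d₂ := (h.exists_primal_eq x).choose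

theorem primal_eq (h : SmoothPL l μ f) (x : E d₁) : primal f x = f x (h.ymax x) :=
  (h.exists_primal_eq x).choose_spec

theorem gradY_ymax (h : SmoothPL l μ f) (x : E d₁) : gradY f x (h.ymax x) = 0 := by
  have := h.gradY_sq_le x (h.ymax x)
  rw [← h.primal_eq, sub_self, mul_zero] at this
  exact norm_eq_zero.1 (pow_eq_zero_iff two_ne_zero |>.1 (le_antisymm this (sq_nonneg _)))

/-- A form of Danskin's theorem without concavity or a unique maximizer. From below, f(·, y₁) with
y₁ a maximizer at `x₁` touches the primal function at `x₁`. From above, the PL inequality at (x₂,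
y₁) bounds the gap by ‖∇_y f(x₂, y₁)‖²/(2μ), and this gradient is at most l‖x₂ − x₁‖ because it
vanishes at (x₁, y₁). -/
theorem primal_quadBounds (h : SmoothPL l μ f) :
    QuadBounds (primal f) (fun x => gradX f x (h.ymax x)) l (l + l ^ 2 / μ) := by
  have hl := h.l_pos
  have hμ := h.μ_pos
  constructor <;> intro x₁ x₂
  · rw [h.primal_eq x₁]
    exact ((h.quadBoundsX hl.le _).lower x₁ x₂).trans (h.le_primal _ _)
  · have h1 := (h.quadBoundsX hl.le (h.ymax x₁)).upper x₁ x₂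
    have h2 := h.pl x₂ (h.ymax x₁)
    have h3 := h.gradY_sub_le x₂ x₁ (h.ymax x₁) (h.ymax x₁)
    rw [h.gradY_ymax, sub_zero, sub_self, norm_zero, add_zero] at h3
    have h4 : ‖gradY f x₂ (h.ymax x₁)‖ ^ 2 ≤ l ^ 2 * ‖x₂ - x₁‖ ^ 2 := by
      rw [← mul_pow]; gcongr
    have h5 : primal f x₂ - f x₂ (h.ymax x₁) ≤ l ^ 2 * ‖x₂ - x₁‖ ^ 2 / (2 * μ) := by
      rw [le_div_iff₀ (by positivity)]; linarith
    rw [h.primal_eq x₁]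
    have e : l ^ 2 * ‖x₂ - x₁‖ ^ 2 / (2 * μ) = (l ^ 2 / μ) / 2 * ‖x₂ - x₁‖ ^ 2 := by
      field_simp
    linarith

theorem primal_differentiable (h : SmoothPL l μ f) : Differentiable ℝ (primal f) :=
  fun x => (h.primal_quadBounds.hasGradientAt x).differentiableAt

theorem gradient_primal_sub_le (h : SmoothPL l μ f) (x₁ x₂ : E d₁) :
    ‖gradient (primal f) x₁ - gradient (primal f) x₂‖ ≤ 3 * (l + l ^ 2 / μ) * ‖x₁ - x₂‖ := by
  have hl := h.l_pos
  have hμ := h.μ_pos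
  rw [h.primal_quadBounds.gradient_eq, h.primal_quadBounds.gradient_eq]
  exact h.primal_quadBounds.gradient_sub_le hl.le (by have : 0 ≤ l ^ 2 / μ := by positivity
                                                      linarith) x₁ x₂

theorem regGradX_xmin (h : SmoothPL l μ f) (y : E d₂) (c : E d₁) :
    regGradX l f c (xmin l f y c) y = 0 :=
  (h.quadBoundsX h.l_pos.le y).prox_gradient h.l_pos h.l_pos.le c

theorem dist_xmin_le (h : SmoothPL l μ f) (c x : E d₁) (y : E d₂) :
    l * ‖x - xmin l f y c‖ ≤ ‖regGradX l f c x y‖ :=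
  (h.quadBoundsX h.l_pos.le y).dist_prox_le h.l_pos h.l_pos.le c x

theorem dist_xmin_sq_le (h : SmoothPL l μ f) (c x : E d₁) (y : E d₂) :
    l / 2 * ‖x - xmin l f y c‖ ^ 2 ≤ reg l f c x y - dual l f y c :=
  (h.quadBoundsX h.l_pos.le y).dist_prox_sq_le h.l_pos h.l_pos.le c x

theorem reg_sub_dual_le (h : SmoothPL l μ f) (c x : E d₁) (y : E d₂) :
    reg l f c x y - dual l f y c ≤ ‖regGradX l f c x y‖ ^ 2 / (2 * l) :=
  (h.quadBoundsX h.l_pos.le y).gap_le h.l_pos c x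

theorem dual_le_reg (h : SmoothPL l μ f) (c x : E d₁) (y : E d₂) :
    dual l f y c ≤ reg l f c x y :=
  (h.quadBoundsX h.l_pos.le y).prox_le h.l_pos c x

theorem xmin_sub_le_center (h : SmoothPL l μ f) (y : E d₂) (c c' : E d₁) :
    ‖xmin l f y c - xmin l f y c'‖ ≤ 2 * ‖c - c'‖ :=
  (h.quadBoundsX h.l_pos.le y).prox_sub_le h.l_pos h.l_pos.le c c'

/-- At the minimizer for `y`, the regularized x-gradient for `y'` is a difference of two values of
∇_x f at the same x, hence at most l‖y − y'‖; strong convexity divides by l. -/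
theorem xmin_sub_le (h : SmoothPL l μ f) (y y' : E d₂) (c : E d₁) :
    ‖xmin l f y c - xmin l f y' c‖ ≤ ‖y - y'‖ := by
  have h1 := h.dist_xmin_le c (xmin l f y c) y'
  have h2 := h.regGradX_xmin y c
  have h3 := h.gradX_sub_le (xmin l f y c) (xmin l f y c) y' y
  rw [sub_self, norm_zero, zero_add, norm_sub_rev y' y] at h3
  have e : regGradX l f c (xmin l f y c) y'
      = gradX f (xmin l f y c) y' - gradX f (xmin l f y c) y := by
    rw [← sub_zero (regGradX l f c (xmin l f y c) y'), ← h2]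
    simp only [regGradX]; abel
  rw [e] at h1
  exact le_of_mul_le_mul_left (h1.trans h3) h.l_pos

theorem dualGrad_sub_le (h : SmoothPL l μ f) (y y' : E d₂) (c : E d₁) :
    ‖dualGrad l f y c - dualGrad l f y' c‖ ≤ 2 * l * ‖y - y'‖ := by
  have hl := h.l_pos
  refine (h.gradY_sub_le _ _ _ _).trans ?_
  have := h.xmin_sub_le y y' c
  nlinarith

theorem dualGrad_sub_le_center (h : SmoothPL l μ f) (y : E d₂) (c c' : E d₁) :
    ‖dualGrad l f y c - dualGrad l f y c'‖ ≤ 2 * l * ‖c - c'‖ := by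
  have hl := h.l_pos
  refine (h.gradY_sub_le _ _ _ _).trans ?_
  have := h.xmin_sub_le_center y c c'
  rw [sub_self, norm_zero, add_zero]
  nlinarith

theorem gradY_sub_dualGrad_le (h : SmoothPL l μ f) (c x : E d₁) (y : E d₂) :
    ‖gradY f x y - dualGrad l f y c‖ ≤ ‖regGradX l f c x y‖ := by
  refine (h.gradY_sub_le _ _ _ _).trans ?_
  rw [sub_self, norm_zero, add_zero]
  exact h.dist_xmin_le c x y

/-- Expand in y at x' = `xmin l f y' c`, where the dual value at `y'` is attained: smoothness costs
l/2, and replacing ∇_y f(x', y) by the dual gradient costs another l, since x' is within ‖y' − y‖ of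
the minimizer for `y`. -/
theorem dual_lower (h : SmoothPL l μ f) (y y' : E d₂) (c : E d₁) :
    dual l f y c + inner ℝ (dualGrad l f y c) (y' - y) - 3 / 2 * l * ‖y' - y‖ ^ 2
      ≤ dual l f y' c := by
  have hl := h.l_pos
  set x' := xmin l f y' c with hx'
  have h1 := (h.quadBoundsY hl.le x').lower y y'
  have h2 := h.dual_le_reg c x' y
  have h3 := h.gradY_sub_le x' (xmin l f y c) y y
  rw [sub_self, norm_zero, add_zero] at h3
  have h4 := h.xmin_sub_le y' y c
  have h5 : ‖gradY f x' y - dualGrad l f y c‖ ≤ l * ‖y' - y‖ :=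
    h3.trans (mul_le_mul_of_nonneg_left h4 hl.le)
  have h6 := neg_le_of_abs_le (abs_real_inner_le_norm (gradY f x' y - dualGrad l f y c) (y' - y))
  rw [inner_sub_left] at h6
  have h7 : ‖gradY f x' y - dualGrad l f y c‖ * ‖y' - y‖ ≤ l * ‖y' - y‖ * ‖y' - y‖ := by gcongr
  have e1 : dual l f y' c = f x' y' + l * ‖x' - c‖ ^ 2 := rfl
  have e2 : reg l f c x' y = f x' y + l * ‖x' - c‖ ^ 2 := rfl
  rw [e1]
  rw [e2] at h2
  nlinarith

theorem dual_le_envelope (h : SmoothPL l μ f) (y : E d₂) (c : E d₁) :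
    dual l f y c ≤ envelope l f c := by
  refine (h.dual_le_reg c (prox l (primal f) c) y).trans ?_
  unfold reg envelope proxFun
  linarith [h.le_primal (prox l (primal f) c) y]

/-- The ascent-step argument of `gradY_sq_le`, with the curvature constant 3l of the dual function.
-/
theorem dualGrad_sq_le (h : SmoothPL l μ f) (y : E d₂) (c : E d₁) :
    ‖dualGrad l f y c‖ ^ 2 ≤ 6 * l * (envelope l f c - dual l f y c) := by
  have hl := h.l_pos
  set v := dualGrad l f y c with hv
  have h1 := h.dual_lower y (y + (1 / (3 * l)) • v) c
  have h2 := h.dual_le_envelope (y + (1 / (3 * l)) • v) c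
  rw [add_sub_cancel_left, ← hv, inner_smul_right, real_inner_self_eq_norm_sq, norm_smul,
    Real.norm_of_nonneg (by positivity)] at h1
  have h3 : 1 / (3 * l) * ‖v‖ ^ 2 - 3 / 2 * l * (1 / (3 * l) * ‖v‖) ^ 2
      = ‖v‖ ^ 2 / (6 * l) := by field_simp; ring
  have h4 : ‖v‖ ^ 2 / (6 * l) ≤ envelope l f c - dual l f y c := by linarith
  rw [div_le_iff₀ (by positivity)] at h4
  linarith

/-- The PL inequality of f(x, ·) at x = `xmin l f y c`: the penalties cancel and ∇_y f there is the
dual gradient. Thus the dual function inherits the PL inequality relative to the envelope, and no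
equality of min-max and max-min is needed. -/
theorem primal_xmin_sub_dual_le (h : SmoothPL l μ f) (y : E d₂) (c : E d₁) :
    proxFun l (primal f) c (xmin l f y c) - dual l f y c ≤ ‖dualGrad l f y c‖ ^ 2 / (2 * μ) := by
  have hμ := h.μ_pos
  have h1 := h.pl (xmin l f y c) y
  rw [le_div_iff₀ (by positivity)]
  unfold dual reg proxFun
  change _ ≤ ‖gradY f (xmin l f y c) y‖ ^ 2
  linarith

theorem prox_primal_le (h : SmoothPL l μ f) (c x : E d₁) :
    envelope l f c ≤ proxFun l (primal f) c x :=
  h.primal_quadBounds.prox_le h.l_pos c x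

theorem envelope_sub_dual_le (h : SmoothPL l μ f) (y : E d₂) (c : E d₁) :
    envelope l f c - dual l f y c ≤ ‖dualGrad l f y c‖ ^ 2 / (2 * μ) :=
  (sub_le_sub_right (h.prox_primal_le c _) _).trans (h.primal_xmin_sub_dual_le y c)

theorem xmin_sub_prox_sq_le (h : SmoothPL l μ f) (y : E d₂) (c : E d₁) :
    l / 2 * ‖xmin l f y c - prox l (primal f) c‖ ^ 2 ≤ ‖dualGrad l f y c‖ ^ 2 / (2 * μ) := by
  have hl := h.l_pos
  have hμ := h.μ_pos
  have h1 := h.primal_quadBounds.dist_prox_sq_le hl (by positivity) c (xmin l f y c)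
  have h2 := h.primal_xmin_sub_dual_le y c
  have h3 := h.dual_le_envelope y c
  unfold envelope at h3
  linarith

theorem prox_primal_sub_le (h : SmoothPL l μ f) (c c' : E d₁) :
    ‖prox l (primal f) c - prox l (primal f) c'‖ ≤ 2 * ‖c - c'‖ := by
  have hl := h.l_pos
  have hμ := h.μ_pos
  exact h.primal_quadBounds.prox_sub_le hl (by positivity) c c'

theorem iInf_primal_le_envelope (h : SmoothPL l μ f) (c : E d₁) :
    ⨅ x, primal f x ≤ envelope l f c := by
  refine (ciInf_le h.primal_bddBelow (prox l (primal f) c)).trans ?_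
  have := h.l_pos
  unfold envelope proxFun
  exact le_add_of_nonneg_right (by positivity)

/-- The norm of the primal gradient at a proximal point. -/
theorem gradient_primal_prox (h : SmoothPL l μ f) (c : E d₁) :
    ‖gradient (primal f) (prox l (primal f) c)‖ = 2 * l * ‖c - prox l (primal f) c‖ := by
  have hl := h.l_pos
  have hμ := h.μ_pos
  have := h.primal_quadBounds.prox_gradient hl (by positivity) c
  rw [h.primal_quadBounds.gradient_eq, eq_neg_of_add_eq_zero_left this, norm_neg, norm_smul,
    norm_sub_rev, Real.norm_of_nonneg (by positivity)]

/-- The weight p = 2l turns the penalty p/2 into l, and strong convexity in x makes both infima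
attained. -/
theorem potential_eq (h : SmoothPL l μ f) (x : E d₁) (y : E d₂) (z : E d₁) :
    potential (2 * l) f x y z = reg l f z x y - 2 * dual l f y z + 2 * envelope l f z := by
  have hl := h.l_pos
  have e : ∀ x y, smoothed (2 * l) f z x y = reg l f z x y := fun x y => by
    unfold smoothed reg proxFun; ring
  have e1 : ⨅ x', smoothed (2 * l) f z x' y = dual l f y z := by
    simp only [e]
    exact (h.quadBoundsX hl.le y).iInf_proxFun hl z
  have e2 : primal (smoothed (2 * l) f z) = proxFun l (primal f) z := by
    funext x'
    obtain ⟨y₀, hy₀⟩ := h.exists_primal_eq x'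
    refine le_antisymm (ciSup_le fun y' => ?_) ?_
    · rw [e]; unfold reg proxFun; linarith [h.le_primal x' y']
    · have hb : BddAbove (Set.range fun y' => smoothed (2 * l) f z x' y') :=
        ⟨proxFun l (primal f) z x', Set.forall_mem_range.2 fun y' => by
          rw [e]; unfold reg proxFun; linarith [h.le_primal x' y']⟩
      refine le_trans (le_of_eq ?_) (le_ciSup hb y₀)
      rw [e]; unfold reg proxFun; rw [hy₀]
  unfold potential
  rw [e, e1, e2, h.primal_quadBounds.iInf_proxFun hl z]
  rfl

end SmoothPL

end

/-! ### Deterministic descent of the potential. -/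

section

variable {d₁ d₂ : ℕ}

theorem norm_grad_sq (f : E d₁ → E d₂ → ℝ) (x : E d₁) (y : E d₂) :
    ‖grad f x y‖ ^ 2 = ‖gradX f x y‖ ^ 2 + ‖gradY f x y‖ ^ 2 :=
  WithLp.prod_norm_sq_eq_of_L2 _

theorem norm_add_sq_le_two {F : Type*} [SeminormedAddCommGroup F] (v w : F) :
    ‖v + w‖ ^ 2 ≤ 2 * ‖v‖ ^ 2 + 2 * ‖w‖ ^ 2 := by
  have h := norm_add_le v w
  nlinarith [norm_nonneg (v + w), sq_nonneg (‖v‖ - ‖w‖)]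

theorem norm_sq_le_two_sub {F : Type*} [SeminormedAddCommGroup F] (v w : F) :
    ‖v‖ ^ 2 ≤ 2 * ‖w‖ ^ 2 + 2 * ‖v - w‖ ^ 2 := by
  have := norm_add_sq_le_two w (v - w)
  rwa [add_sub_cancel] at this

theorem inner_le_weighted {F : Type*} [NormedAddCommGroup F] [InnerProductSpace ℝ F] (v w : F)
    {s : ℝ} (hs : 0 < s) : inner ℝ v w ≤ s / 4 * ‖v‖ ^ 2 + ‖w‖ ^ 2 / s := by
  have h := real_inner_le_norm v w
  have h2 : 0 ≤ (s / 2 * ‖v‖ - ‖w‖) ^ 2 / s := by positivity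
  have : (s / 2 * ‖v‖ - ‖w‖) ^ 2 / s = s / 4 * ‖v‖ ^ 2 + ‖w‖ ^ 2 / s - ‖v‖ * ‖w‖ := by
    field_simp; ring
  linarith

/-- The potential of the smoothed method, in terms of the regularized function, the dual function
and the Moreau envelope. -/
def lyapunov (l : ℝ) (f : E d₁ → E d₂ → ℝ) (x : E d₁) (y : E d₂) (z : E d₁) : ℝ :=
  reg l f z x y - 2 * dual l f y z + 2 * envelope l f z

/-- The stationarity measure of the smoothed method. -/
def residual (l μ : ℝ) (f : E d₁ → E d₂ → ℝ) (x : E d₁) (y : E d₂) (z : E d₁) : ℝ :=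
  ‖regGradX l f z x y‖ ^ 2 + ‖dualGrad l f y z‖ ^ 2 + l * μ * ‖x - z‖ ^ 2

/-- The linear form in the gradient error that enters the descent inequality with step size `a`. -/
def errorForm (l a : ℝ) (f : E d₁ → E d₂ → ℝ) (x : E d₁) (y : E d₂) (z : E d₁) : W d₁ d₂ :=
  WithLp.toLp 2 (-(a • regGradX l f z x y),
    (a / 4) • (gradY f x y - (2 : ℝ) • dualGrad l f y z))

namespace SmoothPL

variable {l μ : ℝ} {f : E d₁ → E d₂ → ℝ}

theorem reg_upper (h : SmoothPL l μ f) (c x x' : E d₁) (y y' : E d₂) :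
    reg l f c x' y' ≤ reg l f c x y + inner ℝ (regGradX l f c x y) (x' - x)
      + inner ℝ (gradY f x y) (y' - y) + 2 * l * ‖x' - x‖ ^ 2 + l * ‖y' - y‖ ^ 2 := by
  have hl := h.l_pos
  have h1 := (abs_le.1 (h.two_point hl.le x x' y y')).2
  have e : x' - c = (x - c) + (x' - x) := by abel
  have h2 : ‖x' - c‖ ^ 2 = ‖x - c‖ ^ 2 + 2 * inner ℝ (x - c) (x' - x) + ‖x' - x‖ ^ 2 := by
    rw [e, norm_add_sq_real]
  have h3 : (‖x' - x‖ + ‖y' - y‖) ^ 2 ≤ 2 * ‖x' - x‖ ^ 2 + 2 * ‖y' - y‖ ^ 2 := by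
    nlinarith [sq_nonneg (‖x' - x‖ - ‖y' - y‖)]
  have h4 := mul_le_mul_of_nonneg_left h3 (by positivity : 0 ≤ l / 2)
  simp only [reg, proxFun, regGradX, h2, inner_add_left, inner_smul_left, conj_trivial]
  linarith

/-- Ascent in y raises `reg`. Subtracting `dual` twice turns the slope into `gradY f` − 2
`dualGrad`, which is close to −`dualGrad` when x is close to `xmin`, so that ascent lowers the
combination. The constant 4l is l from `reg` plus twice 3l/2 from `dual`. -/
theorem reg_sub_dual_step (h : SmoothPL l μ f) (c x x' : E d₁) (y y' : E d₂) :
    reg l f c x' y' - 2 * dual l f y' c ≤ reg l f c x y - 2 * dual l f y c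
      + inner ℝ (regGradX l f c x y) (x' - x)
      + inner ℝ (gradY f x y - (2 : ℝ) • dualGrad l f y c) (y' - y)
      + 2 * l * ‖x' - x‖ ^ 2 + 4 * l * ‖y' - y‖ ^ 2 := by
  have h1 := h.reg_upper c x x' y y'
  have h2 := h.dual_lower y y' c
  rw [inner_sub_left, inner_smul_left, conj_trivial]
  linarith

/-- The change of the potential when the center moves from `z` to `z + β (x - z)`. -/
theorem lyapunov_center_step (h : SmoothPL l μ f) (x : E d₁) (y : E d₂) (z : E d₁) {β : ℝ}
    (hβ : 0 < β) (hβ' : β ≤ 1 / 64) :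
    lyapunov l f x y (z + β • (x - z)) ≤ lyapunov l f x y z - l * β * ‖x - z‖ ^ 2
      + 8 * β / μ * ‖dualGrad l f y z‖ ^ 2 := by
  have hl := h.l_pos
  have hμ := h.μ_pos
  set z' := z + β • (x - z) with hz'
  set r := x - z with hr
  set p := prox l (primal f) z with hp
  set w := xmin l f y z' with hw
  have hx : x - z' = (1 - β) • r := by rw [hz', sub_smul, one_smul, hr]; abel
  have hxn : ‖x - z'‖ ^ 2 = (1 - β) ^ 2 * ‖r‖ ^ 2 := by
    rw [hx, norm_smul, mul_pow, Real.norm_eq_abs, sq_abs]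
  have c1 : reg l f z' x y = reg l f z x y + l * ((1 - β) ^ 2 - 1) * ‖r‖ ^ 2 := by
    simp only [reg, proxFun, hxn]; rw [← hr]; ring
  -- Each minimum is tested at the minimizer for the other center: the envelope at `z'` with `p`,
  -- the dual at `z` with `w`. The terms in β² then cancel, and what remains is the inner product of
  -- `w - p` with `r`.
  have c2 : envelope l f z' ≤ envelope l f z + l * ‖p - z'‖ ^ 2 - l * ‖p - z‖ ^ 2 := by
    have := h.prox_primal_le z' p
    unfold envelope at this ⊢
    unfold proxFun at this ⊢
    linarith
  have c3 : dual l f y z ≤ dual l f y z' + l * ‖w - z‖ ^ 2 - l * ‖w - z'‖ ^ 2 := by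
    have := h.dual_le_reg z w y
    unfold dual reg at this ⊢
    unfold proxFun at this ⊢
    linarith
  have ez : ∀ v : E d₁, ‖v - z'‖ ^ 2 = ‖v - z‖ ^ 2 - 2 * (β * inner ℝ (v - z) r)
      + β ^ 2 * ‖r‖ ^ 2 := by
    intro v
    have : v - z' = (v - z) - β • r := by rw [hz']; abel
    rw [this, norm_sub_sq_real, inner_smul_right, norm_smul, mul_pow, Real.norm_eq_abs, sq_abs]
  have c4 : inner ℝ (w - z) r - inner ℝ (p - z) r = inner ℝ (w - p) r := by
    rw [← inner_sub_left]; congr 1; abel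
  set q := xmin l f y z with hq
  have hwq : ‖w - q‖ ≤ 2 * β * ‖r‖ := by
    refine (h.xmin_sub_le_center y z' z).trans_eq ?_
    rw [hz', add_sub_cancel_left, norm_smul, Real.norm_of_nonneg hβ.le]; ring
  -- The path from `p` to `w` goes through `q`: the leg `w - q` is caused by the move of the center
  -- and is O(β‖r‖), the leg `q - p` is a duality error, bounded by the dual gradient in `c6`.
  have c5 : inner ℝ (w - p) r ≤ 2 * β * ‖r‖ ^ 2 + ‖q - p‖ * ‖r‖ := by
    have : w - p = (w - q) + (q - p) := by abel
    rw [this, inner_add_left]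
    have i1 := real_inner_le_norm (w - q) r
    have i2 := real_inner_le_norm (q - p) r
    have i3 := mul_le_mul_of_nonneg_right hwq (norm_nonneg r)
    nlinarith
  have c6 : ‖q - p‖ ^ 2 ≤ ‖dualGrad l f y z‖ ^ 2 / (l * μ) := by
    have := h.xmin_sub_prox_sq_le y z
    rw [le_div_iff₀ (by positivity)] at this ⊢
    linarith
  -- With these weights, multiplication by 4lβ costs lβ‖r‖²/2 and produces the coefficient 8lβ of
  -- `e8`. For β ≤ 1/64 at least half of the decrease 2lβ‖r‖² survives.
  have c7 : ‖q - p‖ * ‖r‖ ≤ ‖r‖ ^ 2 / 8 + 2 * ‖q - p‖ ^ 2 := by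
    nlinarith [sq_nonneg (‖r‖ - 4 * ‖q - p‖)]
  have e8 : 8 * β / μ * ‖dualGrad l f y z‖ ^ 2
      = 8 * l * β * (‖dualGrad l f y z‖ ^ 2 / (l * μ)) := by field_simp
  have m1 := mul_le_mul_of_nonneg_left c6 (by positivity : 0 ≤ 8 * l * β)
  have m2 := mul_le_mul_of_nonneg_left (c5.trans (add_le_add_right c7 _))
    (by positivity : 0 ≤ 4 * l * β)
  have m3 := mul_le_mul_of_nonneg_right hβ' (by positivity : 0 ≤ l * β * ‖r‖ ^ 2)
  rw [ez p] at c2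
  rw [ez w] at c3
  have c4' : 4 * l * β * inner ℝ (w - z) r - 4 * l * β * inner ℝ (p - z) r
      = 4 * l * β * inner ℝ (w - p) r := by rw [← c4]; ring
  have p1 : 0 ≤ l * β * ‖r‖ ^ 2 := by positivity
  unfold lyapunov
  rw [c1, e8]
  linarith

/-- The center moves at the rate β = bμ/64, where b stands for the step size in y: the penalty 8β/μ
of the center move is then b/8 times the squared dual gradient at `y'`, at most b/4 times that at
`y` plus a step term, small against the gain from ascent. -/
theorem lyapunov_step (h : SmoothPL l μ f) (x x' : E d₁) (y y' : E d₂) (z : E d₁) {b : ℝ}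
    (hb : 0 < b) (hbl : b * l ≤ 1) (hμl : μ ≤ l) :
    lyapunov l f x' y' (z + (b * μ / 64) • (x' - z)) ≤ lyapunov l f x y z
      + inner ℝ (regGradX l f z x y) (x' - x)
      + inner ℝ (gradY f x y - (2 : ℝ) • dualGrad l f y z) (y' - y)
      + 5 * l * ‖x' - x‖ ^ 2 + 5 * l * ‖y' - y‖ ^ 2
      + b / 4 * ‖dualGrad l f y z‖ ^ 2 - l * (b * μ / 64) / 2 * ‖x - z‖ ^ 2 := by
  have hl := h.l_pos
  have hμ := h.μ_pos
  have hbμ : b * μ ≤ 1 := (mul_le_mul_of_nonneg_left hμl hb.le).trans hbl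
  have h1 := h.lyapunov_center_step x' y' z (β := b * μ / 64) (by positivity) (by linarith)
  have h2 := h.reg_sub_dual_step z x x' y y'
  have h3 : ‖dualGrad l f y' z‖ ^ 2 ≤ 2 * ‖dualGrad l f y z‖ ^ 2 + 8 * l ^ 2 * ‖y' - y‖ ^ 2 := by
    have := norm_sq_le_two_sub (dualGrad l f y' z) (dualGrad l f y z)
    have h4 := pow_le_pow_left₀ (norm_nonneg _) (h.dualGrad_sub_le y' y z) 2
    nlinarith
  have h5 : ‖x - z‖ ^ 2 ≤ 2 * ‖x' - z‖ ^ 2 + 2 * ‖x' - x‖ ^ 2 := by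
    have := norm_sq_le_two_sub (x - z) (x' - z)
    rwa [sub_sub_sub_cancel_right, norm_sub_rev x x'] at this
  have e : 8 * (b * μ / 64) / μ = b / 8 := by field_simp; norm_num
  rw [e] at h1
  have m1 := mul_le_mul_of_nonneg_left h3 (by positivity : 0 ≤ b / 8)
  have m2 := mul_le_mul_of_nonneg_left h5 (by positivity : 0 ≤ l * (b * μ / 64) / 2)
  have m3 := mul_le_mul_of_nonneg_right hbl (by positivity : 0 ≤ l * ‖y' - y‖ ^ 2)
  have m4 := mul_le_mul_of_nonneg_right hbμ (by positivity : 0 ≤ l * ‖x' - x‖ ^ 2)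
  have p1 : 0 ≤ l * ‖x' - x‖ ^ 2 := by positivity
  have p2 : 0 ≤ l * ‖y' - y‖ ^ 2 := by positivity
  unfold lyapunov at h1 ⊢
  linarith

/-- The descent obtained from a step with step sizes `a` in `x` and `a / 4` in `y` along gradients
with error `e`. -/
theorem step_bound (h : SmoothPL l μ f) (c x : E d₁) (y : E d₂) (e : W d₁ d₂) {a : ℝ}
    (ha : 0 < a) (hal : a * l ≤ 1 / 100) {dx : E d₁} {dy : E d₂}
    (hdx : dx = -(a • (regGradX l f c x y + e.fst)))
    (hdy : dy = (a / 4) • (gradY f x y + e.snd)) :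
    inner ℝ (regGradX l f c x y) dx + inner ℝ (gradY f x y - (2 : ℝ) • dualGrad l f y c) dy
      + 5 * l * ‖dx‖ ^ 2 + 5 * l * ‖dy‖ ^ 2
      ≤ -(3 / 5 * a) * ‖regGradX l f c x y‖ ^ 2 - 19 / 80 * a * ‖dualGrad l f y c‖ ^ 2
        + inner ℝ (errorForm l a f x y c) e + 10 * l * a ^ 2 * ‖e‖ ^ 2 := by
  have hl := h.l_pos
  set u := regGradX l f c x y with hu
  set v := gradY f x y with hv
  set v' := dualGrad l f y c with hv'
  have i1 : inner ℝ (errorForm l a f x y c) e = -(a * inner ℝ u e.fst)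
      + a / 4 * inner ℝ (v - (2 : ℝ) • v') e.snd := by
    rw [WithLp.prod_inner_apply]
    change inner ℝ (-(a • u)) e.fst + inner ℝ ((a / 4) • (v - (2 : ℝ) • v')) e.snd = _
    simp only [inner_neg_left, inner_smul_left, conj_trivial]
  have i2 : inner ℝ u dx = -(a * ‖u‖ ^ 2) - a * inner ℝ u e.fst := by
    rw [hdx, inner_neg_right, inner_smul_right, inner_add_right, real_inner_self_eq_norm_sq]; ring
  -- The identity ⟨v − 2v', v⟩ = ‖v − v'‖² − ‖v'‖² is what the factor 2 in the potential is for. By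
  -- `n1` the first square is at most ‖u‖², and the smaller step a/4 in y keeps it below the gain
  -- a‖u‖² from x.
  have i3 : inner ℝ (v - (2 : ℝ) • v') dy
      = a / 4 * (‖v - v'‖ ^ 2 - ‖v'‖ ^ 2) + a / 4 * inner ℝ (v - (2 : ℝ) • v') e.snd := by
    rw [hdy, inner_smul_right, inner_add_right, norm_sub_sq_real, inner_sub_left (z := v),
      inner_smul_left, conj_trivial, real_inner_self_eq_norm_sq, real_inner_comm v v']; ring
  have n1 : ‖v - v'‖ ^ 2 ≤ ‖u‖ ^ 2 :=
    pow_le_pow_left₀ (norm_nonneg _) (h.gradY_sub_dualGrad_le c x y) 2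
  have n2 : ‖v‖ ^ 2 ≤ 2 * ‖v'‖ ^ 2 + 2 * ‖u‖ ^ 2 := by
    have := norm_sq_le_two_sub v v'; linarith
  have n3 : ‖dx‖ ^ 2 ≤ a ^ 2 * (2 * ‖u‖ ^ 2 + 2 * ‖e.fst‖ ^ 2) := by
    rw [hdx, norm_neg, norm_smul, mul_pow, Real.norm_of_nonneg ha.le]
    exact mul_le_mul_of_nonneg_left (norm_add_sq_le_two _ _) (by positivity)
  have n4 : ‖dy‖ ^ 2 ≤ (a / 4) ^ 2 * (2 * ‖v‖ ^ 2 + 2 * ‖e.snd‖ ^ 2) := by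
    rw [hdy, norm_smul, mul_pow, Real.norm_of_nonneg (by positivity)]
    exact mul_le_mul_of_nonneg_left (norm_add_sq_le_two _ _) (by positivity)
  have n5 : ‖e‖ ^ 2 = ‖e.fst‖ ^ 2 + ‖e.snd‖ ^ 2 := WithLp.prod_norm_sq_eq_of_L2 e
  have m1 := mul_le_mul_of_nonneg_left n3 (by positivity : 0 ≤ 5 * l)
  have m2 := mul_le_mul_of_nonneg_left n4 (by positivity : 0 ≤ 5 * l)
  have m3 := mul_le_mul_of_nonneg_left n2 (by positivity : 0 ≤ 5 * l * ((a / 4) ^ 2 * 2))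
  have m4 := mul_le_mul_of_nonneg_left n1 (by positivity : 0 ≤ a / 4)
  have m5 := mul_le_mul_of_nonneg_right hal (by positivity : 0 ≤ a * ‖u‖ ^ 2)
  have m6 := mul_le_mul_of_nonneg_right hal (by positivity : 0 ≤ a * ‖v'‖ ^ 2)
  have p1 : 0 ≤ l * a ^ 2 * ‖e.snd‖ ^ 2 := by positivity
  have p2 : 0 ≤ a * ‖u‖ ^ 2 := by positivity
  have p3 : 0 ≤ a * ‖v'‖ ^ 2 := by positivity
  rw [i1, i2, i3, n5]
  linarith

/-- The mean of the error contributes only through its size. -/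
theorem errorForm_le (h : SmoothPL l μ f) (c x : E d₁) (y : E d₂) (m : W d₁ d₂) {a : ℝ}
    (ha : 0 < a) :
    inner ℝ (errorForm l a f x y c) m ≤ 1 / 4 * a * ‖regGradX l f c x y‖ ^ 2
      + 1 / 32 * a * ‖dualGrad l f y c‖ ^ 2 + 3 * a * ‖m‖ ^ 2 := by
  set u := regGradX l f c x y with hu
  set v := gradY f x y with hv
  set v' := dualGrad l f y c with hv'
  have i1 : inner ℝ (errorForm l a f x y c) m = a * inner ℝ (-u) m.fst
      + a / 4 * inner ℝ (v - v') m.snd + a / 4 * inner ℝ (-v') m.snd := by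
    rw [WithLp.prod_inner_apply]
    change inner ℝ (-(a • u)) m.fst + inner ℝ ((a / 4) • (v - (2 : ℝ) • v')) m.snd = _
    simp only [inner_neg_left, inner_smul_left, conj_trivial, inner_sub_left]
    ring
  have n1 : ‖v - v'‖ ^ 2 ≤ ‖u‖ ^ 2 :=
    pow_le_pow_left₀ (norm_nonneg _) (h.gradY_sub_dualGrad_le c x y) 2
  have j1 := inner_le_weighted (-u) m.fst (s := 1 / 2) (by norm_num)
  have j2 := inner_le_weighted (v - v') m.snd (s := 2) (by norm_num)
  have j3 := inner_le_weighted (-v') m.snd (s := 1 / 2) (by norm_num)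
  have n5 : ‖m‖ ^ 2 = ‖m.fst‖ ^ 2 + ‖m.snd‖ ^ 2 := WithLp.prod_norm_sq_eq_of_L2 m
  rw [norm_neg] at j1 j3
  have m1 := mul_le_mul_of_nonneg_left j1 ha.le
  have m2 := mul_le_mul_of_nonneg_left j2 (by positivity : 0 ≤ a / 4)
  have m3 := mul_le_mul_of_nonneg_left j3 (by positivity : 0 ≤ a / 4)
  have m4 := mul_le_mul_of_nonneg_left n1 (by positivity : 0 ≤ a / 8)
  have p1 : 0 ≤ a * ‖m.snd‖ ^ 2 := by positivity
  have p2 : 0 ≤ a * ‖m.fst‖ ^ 2 := by positivity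
  rw [i1, n5]
  linarith

/-- The full gradient is controlled by the stationarity measure. -/
theorem norm_grad_sq_le (h : SmoothPL l μ f) (x : E d₁) (y : E d₂) (z : E d₁) :
    ‖grad f x y‖ ^ 2 ≤ 4 * ‖regGradX l f z x y‖ ^ 2 + 2 * ‖dualGrad l f y z‖ ^ 2
      + 8 * l ^ 2 * ‖x - z‖ ^ 2 := by
  have hl := h.l_pos
  have n1 : ‖gradY f x y - dualGrad l f y z‖ ^ 2 ≤ ‖regGradX l f z x y‖ ^ 2 :=
    pow_le_pow_left₀ (norm_nonneg _) (h.gradY_sub_dualGrad_le z x y) 2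
  have n2 := norm_sq_le_two_sub (gradY f x y) (dualGrad l f y z)
  have n3 := norm_sq_le_two_sub (gradX f x y) (regGradX l f z x y)
  have e : gradX f x y - regGradX l f z x y = -((2 * l) • (x - z)) := by
    unfold regGradX; abel
  rw [e, norm_neg, norm_smul, mul_pow, Real.norm_of_nonneg (by positivity)] at n3
  rw [norm_grad_sq]
  nlinarith

/-- The potential is the envelope plus the nonnegative gaps `reg` − `dual` and twice (`envelope` −
`dual`), minus one `envelope` − `dual`; the envelope dominates the infimum of the primal function.
-/
theorem iInf_primal_le_lyapunov (h : SmoothPL l μ f) (x : E d₁) (y : E d₂) (z : E d₁) :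
    ⨅ x, primal f x ≤ lyapunov l f x y z := by
  have h1 := h.iInf_primal_le_envelope z
  have h2 := h.dual_le_envelope y z
  have h3 := h.dual_le_reg z x y
  unfold lyapunov
  linarith

theorem envelope_le_lyapunov (h : SmoothPL l μ f) (x : E d₁) (y : E d₂) (z : E d₁) :
    envelope l f z ≤ lyapunov l f x y z := by
  have h2 := h.dual_le_envelope y z
  have h3 := h.dual_le_reg z x y
  unfold lyapunov
  linarith

/-- A PL inequality for the potential at a fixed center, since the left side is (`reg` − `dual`) +
(`envelope` − `dual`). It is the source of the linear convergence of the second stage. -/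
theorem lyapunov_sub_envelope_le (h : SmoothPL l μ f) (x : E d₁) (y : E d₂) (z : E d₁) :
    lyapunov l f x y z - envelope l f z
      ≤ ‖regGradX l f z x y‖ ^ 2 / (2 * l) + ‖dualGrad l f y z‖ ^ 2 / (2 * μ) := by
  have h2 := h.envelope_sub_dual_le y z
  have h3 := h.reg_sub_dual_le z x y
  unfold lyapunov
  linarith

/-- A small potential for a fixed center means that `x` is close to the proximal point. -/
theorem dist_prox_sq_le_lyapunov (h : SmoothPL l μ f) (hμl : μ ≤ l) (x : E d₁) (y : E d₂)
    (c : E d₁) :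
    l * μ * ‖x - prox l (primal f) c‖ ^ 2 ≤ 12 * l * (lyapunov l f x y c - envelope l f c) := by
  have hl := h.l_pos
  have hμ := h.μ_pos
  have h1 := h.dist_xmin_sq_le c x y
  have h2 := h.xmin_sub_prox_sq_le y c
  have h3 := h.dualGrad_sq_le y c
  have h4 := norm_add_sq_le_two (x - xmin l f y c) (xmin l f y c - prox l (primal f) c)
  rw [sub_add_sub_cancel] at h4
  have h5 : l * μ * ‖xmin l f y c - prox l (primal f) c‖ ^ 2
      ≤ 6 * l * (envelope l f c - dual l f y c) := by
    rw [le_div_iff₀ (by positivity)] at h2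
    linarith
  have h6 := mul_le_mul_of_nonneg_left h1 (by positivity : 0 ≤ 4 * μ)
  have h8 := h.dual_le_reg c x y
  have h7 : μ * (reg l f c x y - dual l f y c) ≤ l * (reg l f c x y - dual l f y c) :=
    mul_le_mul_of_nonneg_right hμl (by linarith)
  have h9 := mul_le_mul_of_nonneg_left h4 (by positivity : 0 ≤ l * μ)
  have h10 := mul_nonneg hl.le (sub_nonneg.2 h8)
  unfold lyapunov
  linarith

/-- Recentering at `x`: the distance of `x` to its proximal point. -/
theorem dist_prox_self_sq_le (h : SmoothPL l μ f) (hμl : μ ≤ l) (x : E d₁) (y : E d₂)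
    (z : E d₁) :
    l * μ * ‖x - prox l (primal f) x‖ ^ 2 ≤ 12 * residual l μ f x y z := by
  have hl := h.l_pos
  have hμ := h.μ_pos
  set q := xmin l f y z
  set p := prox l (primal f) z
  have h1 := pow_le_pow_left₀ (by positivity) (h.dist_xmin_le z x y) 2
  have h2 := h.xmin_sub_prox_sq_le y z
  have h3 := pow_le_pow_left₀ (norm_nonneg _) (h.prox_primal_sub_le z x) 2
  -- Three legs, one for each term of the residual: `x - q` is controlled by the regularized
  -- x-gradient, `q - p` by the dual gradient, and the last leg by ‖x − z‖, as proximal points are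
  -- 2-Lipschitz in the center.
  have e1 : x - prox l (primal f) x = ((x - q) + (q - p)) + (p - prox l (primal f) x) := by abel
  have n1 := norm_add_sq_le_two ((x - q) + (q - p)) (p - prox l (primal f) x)
  have n2 := norm_add_sq_le_two (x - q) (q - p)
  rw [← e1] at n1
  have h5 : l * μ * ‖q - p‖ ^ 2 ≤ ‖dualGrad l f y z‖ ^ 2 := by
    rw [le_div_iff₀ (by positivity)] at h2
    linarith
  have h6 : l * μ * ‖x - q‖ ^ 2 ≤ ‖regGradX l f z x y‖ ^ 2 := by
    refine le_trans ?_ h1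
    rw [mul_pow]
    refine mul_le_mul_of_nonneg_right ?_ (sq_nonneg _)
    nlinarith
  have m1 := mul_le_mul_of_nonneg_left n1 (by positivity : 0 ≤ l * μ)
  have m2 := mul_le_mul_of_nonneg_left n2 (by positivity : 0 ≤ l * μ)
  rw [mul_pow, norm_sub_rev z x] at h3
  have m3 := mul_le_mul_of_nonneg_left h3 (by positivity : 0 ≤ l * μ)
  have p1 : 0 ≤ l * μ * ‖x - z‖ ^ 2 := by positivity
  unfold residual
  linarith [sq_nonneg ‖regGradX l f z x y‖, sq_nonneg ‖dualGrad l f y z‖]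

/-- Recentering at `x`: the initial potential of the second stage. -/
theorem lyapunov_self_le (h : SmoothPL l μ f) (hμl : μ ≤ l) (x : E d₁) (y : E d₂)
    (z : E d₁) :
    l * μ ^ 2 * (lyapunov l f x y x - envelope l f x) ≤ 9 * l ^ 2 * residual l μ f x y z := by
  have hl := h.l_pos
  have hμ := h.μ_pos
  have h0 := h.lyapunov_sub_envelope_le x y x
  -- Moving the center from `z` to `x` changes each of the two gradients by at most 2l‖x − z‖.
  have h1 := norm_sq_le_two_sub (regGradX l f x x y) (regGradX l f z x y)
  have e : regGradX l f x x y - regGradX l f z x y = -((2 * l) • (x - z)) := by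
    unfold regGradX; rw [sub_self, smul_zero]; abel
  rw [e, norm_neg, norm_smul, mul_pow, Real.norm_of_nonneg (by positivity)] at h1
  have h2 := norm_sq_le_two_sub (dualGrad l f y x) (dualGrad l f y z)
  have h3 := pow_le_pow_left₀ (norm_nonneg _) (h.dualGrad_sub_le_center y x z) 2
  have h4 : l * μ ^ 2 * (‖regGradX l f x x y‖ ^ 2 / (2 * l) + ‖dualGrad l f y x‖ ^ 2 / (2 * μ))
      = μ ^ 2 / 2 * ‖regGradX l f x x y‖ ^ 2 + l * μ / 2 * ‖dualGrad l f y x‖ ^ 2 := by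
    field_simp
  have m0 := mul_le_mul_of_nonneg_left h0 (by positivity : 0 ≤ l * μ ^ 2)
  rw [h4] at m0
  set A := ‖regGradX l f z x y‖ ^ 2 with hA
  set B := ‖dualGrad l f y z‖ ^ 2 with hB
  set D := ‖x - z‖ ^ 2 with hD
  have pA : 0 ≤ A := by positivity
  have pB : 0 ≤ B := by positivity
  have pD : 0 ≤ D := by positivity
  have g1 : ‖regGradX l f x x y‖ ^ 2 ≤ 2 * A + 8 * l ^ 2 * D := by nlinarith
  have g2 : ‖dualGrad l f y x‖ ^ 2 ≤ 2 * B + 8 * l ^ 2 * D := by nlinarith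
  have m1 := mul_le_mul_of_nonneg_left g1 (by positivity : 0 ≤ μ ^ 2 / 2)
  have m2 := mul_le_mul_of_nonneg_left g2 (by positivity : 0 ≤ l * μ / 2)
  have k1 : μ ^ 2 ≤ l ^ 2 := pow_le_pow_left₀ hμ.le hμl 2
  have k2 : l * μ ≤ l ^ 2 := by nlinarith
  have k3 : μ ^ 2 ≤ l * μ := by nlinarith
  have t1 := mul_le_mul_of_nonneg_right k1 pA
  have t2 := mul_le_mul_of_nonneg_right k2 pB
  have t3 := mul_le_mul_of_nonneg_right k3 (by positivity : 0 ≤ l ^ 2 * D)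
  have t4 : 0 ≤ l ^ 2 * (l * μ * D) := by positivity
  have t5 : 0 ≤ l ^ 2 * A := by positivity
  have t6 : 0 ≤ l ^ 2 * B := by positivity
  unfold residual
  rw [← hA, ← hB, ← hD]
  linarith

end SmoothPL

end

/-! ### Second moments and random iterations. -/

section Moments

variable {Ω : Type*} [MeasurableSpace Ω] {P : Measure Ω}
  {H : Type*} [NormedAddCommGroup H] [InnerProductSpace ℝ H]

theorem integrable_sq_of_lintegral_lt_top {f : Ω → H} (hf : AEStronglyMeasurable f P)
    (h : ∫⁻ ω, ENNReal.ofReal (‖f ω‖ ^ 2) ∂P < ⊤) : Integrable (fun ω => ‖f ω‖ ^ 2) P := by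
  refine ⟨hf.norm.pow 2, ?_⟩
  rw [hasFiniteIntegral_iff_ofReal (Filter.Eventually.of_forall fun ω => sq_nonneg _)]
  exact h

theorem integrable_of_integrable_sq [IsFiniteMeasure P] {f : Ω → H}
    (hf : AEStronglyMeasurable f P) (h : Integrable (fun ω => ‖f ω‖ ^ 2) P) : Integrable f P :=
  ((memLp_two_iff_integrable_sq_norm hf).2 h).integrable one_le_two

theorem lintegral_ofReal_sq_eq {f : Ω → H} (h : Integrable (fun ω => ‖f ω‖ ^ 2) P) :
    ∫⁻ ω, ENNReal.ofReal (‖f ω‖ ^ 2) ∂P = ENNReal.ofReal (∫ ω, ‖f ω‖ ^ 2 ∂P) :=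
  (ofReal_integral_eq_lintegral_ofReal h (Filter.Eventually.of_forall fun _ => sq_nonneg _)).symm

theorem integral_sq_le_of_lintegral_le {f : Ω → H} (hf : AEStronglyMeasurable f P) {r : ℝ}
    (hr : 0 ≤ r) (h : ∫⁻ ω, ENNReal.ofReal (‖f ω‖ ^ 2) ∂P ≤ ENNReal.ofReal r) :
    ∫ ω, ‖f ω‖ ^ 2 ∂P ≤ r := by
  have hi := integrable_sq_of_lintegral_lt_top hf (h.trans_lt ENNReal.ofReal_lt_top)
  rw [lintegral_ofReal_sq_eq hi] at h
  exact (ENNReal.ofReal_le_ofReal_iff hr).1 h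

/-- The mean square of `f` − m is nonnegative; expand it. -/
theorem norm_integral_sq_le [IsProbabilityMeasure P] [CompleteSpace H] {f : Ω → H}
    (hf : AEStronglyMeasurable f P) (h : Integrable (fun ω => ‖f ω‖ ^ 2) P) :
    ‖∫ ω, f ω ∂P‖ ^ 2 ≤ ∫ ω, ‖f ω‖ ^ 2 ∂P := by
  have hi := integrable_of_integrable_sq hf h
  set m := ∫ ω, f ω ∂P with hm
  have h1 : ∫ ω, (2 * inner ℝ m (f ω) - ‖m‖ ^ 2) ∂P ≤ ∫ ω, ‖f ω‖ ^ 2 ∂P := by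
    refine integral_mono (((hi.const_inner m).const_mul 2).sub (integrable_const _)) h fun ω => ?_
    have := norm_sub_sq_real m (f ω)
    simp only
    nlinarith [sq_nonneg ‖m - f ω‖]
  rw [integral_sub ((hi.const_inner m).const_mul 2) (integrable_const _), integral_const_mul,
    integral_inner hi, ← hm, real_inner_self_eq_norm_sq] at h1
  simp at h1
  linarith

theorem lintegral_sq_const_add [IsProbabilityMeasure P] [CompleteSpace H] {f : Ω → H}
    (hf : Integrable f P) (h : Integrable (fun ω => ‖f ω‖ ^ 2) P) (hmean : ∫ ω, f ω ∂P = 0)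
    (v : H) : ∫⁻ ω, ENNReal.ofReal (‖v + f ω‖ ^ 2) ∂P
      = ENNReal.ofReal (‖v‖ ^ 2 + ∫ ω, ‖f ω‖ ^ 2 ∂P) := by
  have e : ∀ ω, ‖v + f ω‖ ^ 2 = ‖v‖ ^ 2 + 2 * inner ℝ v (f ω) + ‖f ω‖ ^ 2 := fun ω =>
    norm_add_sq_real _ _
  have hi : Integrable (fun ω => ‖v‖ ^ 2 + 2 * inner ℝ v (f ω)) P :=
    (integrable_const _).add ((hf.const_inner v).const_mul 2)
  have hi2 : Integrable (fun ω => ‖v + f ω‖ ^ 2) P := by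
    simp only [e]; exact hi.add h
  rw [lintegral_ofReal_sq_eq hi2]
  congr 1
  simp only [e]
  rw [integral_add hi h, integral_add (integrable_const _) ((hf.const_inner v).const_mul 2),
    integral_const_mul, integral_inner hf, hmean]
  simp

end Moments

section Chain

variable {Θ S : Type*}

/-- The state after `k` steps of the recursion `s ↦ step (ω k) s`. -/
def iter (step : Θ → S → S) (s : S) (ω : ℕ → Θ) : ℕ → S
  | 0 => s
  | k + 1 => step (ω k) (iter step s ω k)

theorem iter_congr (step : Θ → S → S) (s : S) {ω ω' : ℕ → Θ} {k : ℕ}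
    (h : ∀ j < k, ω j = ω' j) : iter step s ω k = iter step s ω' k := by
  induction k with
  | zero => rfl
  | succ k ih =>
    simp only [iter]
    rw [h k (Nat.lt_succ_self k), ih fun j hj => h j (hj.trans (Nat.lt_succ_self k))]

variable [MeasurableSpace Θ] [MeasurableSpace S]

theorem measurable_iter {step : Θ → S → S} (hs : Measurable fun q : Θ × S => step q.1 q.2) (k : ℕ) :
    Measurable fun q : S × (ℕ → Θ) => iter step q.1 q.2 k := by
  induction k with
  | zero => exact measurable_fst
  | succ k ih =>
    exact hs.comp (((measurable_pi_apply k).comp measurable_snd).prodMk ih)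

theorem measurable_iter_snd {step : Θ → S → S} (hs : Measurable fun q : Θ × S => step q.1 q.2)
    (s : S) (k : ℕ) : Measurable fun ω : ℕ → Θ => iter step s ω k :=
  (measurable_iter hs k).comp measurable_prodMk_left

variable (ρ : Measure Θ) [IsProbabilityMeasure ρ]

/-- Independence of past and present: `A` sees only the coordinates before `k`. -/
theorem map_prodMk_infinitePi {A : (ℕ → Θ) → S} (hA : Measurable A) (k : ℕ)
    (hdep : ∀ ω ω', (∀ j < k, ω j = ω' j) → A ω = A ω') :
    (Measure.infinitePi fun _ : ℕ => ρ).map (fun ω => (A ω, ω k))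
      = ((Measure.infinitePi fun _ : ℕ => ρ).map A).prod ρ := by
  have hne : Nonempty Θ := nonempty_of_isProbabilityMeasure ρ
  obtain ⟨θ₀⟩ := hne
  have hind : iIndepFun (fun (i : ℕ) (ω : ℕ → Θ) => ω i) (Measure.infinitePi fun _ : ℕ => ρ) :=
    iIndepFun_infinitePi (X := fun _ => id) fun _ => measurable_id
  have h1 := hind.indepFun_finset (Finset.range k) {k} (by simp) fun i => measurable_pi_apply i
  -- `A` is factored through the first `k` coordinates by filling the others with a fixed `θ₀`; by
  -- `hdep` the filling is immaterial.
  let ext : (Finset.range k → Θ) → ℕ → Θ := fun v j =>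
    if h : j ∈ Finset.range k then v ⟨j, h⟩ else θ₀
  have hext : Measurable ext := by
    refine measurable_pi_lambda _ fun j => ?_
    by_cases h : j ∈ Finset.range k
    · simp only [ext, dif_pos h]; exact measurable_pi_apply _
    · simp only [ext, dif_neg h]; exact measurable_const
  have h2 := h1.comp (hA.comp hext)
    (measurable_pi_apply (⟨k, Finset.mem_singleton_self k⟩ : ({k} : Finset ℕ)))
  have e1 : (A ∘ ext) ∘ (fun (ω : ℕ → Θ) (i : Finset.range k) => ω i) = A := by
    funext ω
    refine hdep _ _ fun j hj => ?_
    simp [ext, hj]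
  rw [e1] at h2
  have h3 := (indepFun_iff_map_prod_eq_prod_map_map hA.aemeasurable
    (measurable_pi_apply k).aemeasurable).1 h2
  rw [h3]
  congr 1
  exact Measure.infinitePi_map_eval (fun _ : ℕ => ρ) k

/-- Conditioning on the past: the state before step `k` is independent of the draw `ω k`, so the
draw is integrated with the state frozen. Integrals valued in `ENNReal` spare any integrability
condition along the iteration. -/
theorem lintegral_iter_prod {step : Θ → S → S} (hs : Measurable fun q : Θ × S => step q.1 q.2)
    (s : S) (k : ℕ) {F : S → Θ → ENNReal} (hF : Measurable fun q : S × Θ => F q.1 q.2) :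
    ∫⁻ ω, F (iter step s ω k) (ω k) ∂(Measure.infinitePi fun _ : ℕ => ρ)
      = ∫⁻ ω, ∫⁻ θ, F (iter step s ω k) θ ∂ρ ∂(Measure.infinitePi fun _ : ℕ => ρ) := by
  have hA := measurable_iter_snd hs s k
  have h := map_prodMk_infinitePi ρ hA k fun ω ω' h => iter_congr step s h
  have h1 : ∫⁻ q, F q.1 q.2 ∂((Measure.infinitePi fun _ : ℕ => ρ).map
      (fun ω => (iter step s ω k, ω k))) = _ :=
    lintegral_map hF (hA.prodMk (measurable_pi_apply k))
  rw [← h1, h, lintegral_prod _ hF.aemeasurable, lintegral_map hF.lintegral_prod_right' hA]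

theorem integral_iter_prod {H : Type*} [NormedAddCommGroup H] [NormedSpace ℝ H]
    {step : Θ → S → S} (hs : Measurable fun q : Θ × S => step q.1 q.2)
    (s : S) (k : ℕ) {F : S → Θ → H} (hF : StronglyMeasurable fun q : S × Θ => F q.1 q.2)
    (hi : Integrable (fun ω => F (iter step s ω k) (ω k)) (Measure.infinitePi fun _ : ℕ => ρ)) :
    ∫ ω, F (iter step s ω k) (ω k) ∂(Measure.infinitePi fun _ : ℕ => ρ)
      = ∫ ω, ∫ θ, F (iter step s ω k) θ ∂ρ ∂(Measure.infinitePi fun _ : ℕ => ρ) := by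
  have hA := measurable_iter_snd hs s k
  have hm : Measurable (fun ω : ℕ → Θ => (iter step s ω k, ω k)) :=
    hA.prodMk (measurable_pi_apply k)
  have h := map_prodMk_infinitePi ρ hA k fun ω ω' h => iter_congr step s h
  have h1 := integral_map hm.aemeasurable (hF.aestronglyMeasurable
    (μ := (Measure.infinitePi fun _ : ℕ => ρ).map (fun ω => (iter step s ω k, ω k))))
  have h2 : Integrable (fun q : S × Θ => F q.1 q.2)
      ((Measure.infinitePi fun _ : ℕ => ρ).map (fun ω => (iter step s ω k, ω k))) :=
    (integrable_map_measure hF.aestronglyMeasurable hm.aemeasurable).2 hi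
  rw [← h1]
  rw [h] at h2 ⊢
  rw [integral_prod _ h2, integral_map hA.aemeasurable]
  exact (hF.integral_prod_right' (ν := ρ)).aestronglyMeasurable

end Chain

/-! ### Noise and drift of the local updates. -/

/-- A stochastic gradient oracle on `H` with mean `G`, variance at most `σ²` and a Lipschitz mean. -/
structure Oracle {Ξ H : Type*} [MeasurableSpace Ξ] [NormedAddCommGroup H] [InnerProductSpace ℝ H]
    [MeasurableSpace H] (D : Measure Ξ) (g : H → Ξ → H) (G : H → H) (σ Λ : ℝ) : Prop where
  measurable : Measurable fun q : H × Ξ => g q.1 q.2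
  measurable_mean : Measurable G
  integrable : ∀ w, Integrable (g w) D
  mean : ∀ w, ∫ ξ, g w ξ ∂D = G w
  sq_integrable : ∀ w, Integrable (fun ξ => ‖g w ξ - G w‖ ^ 2) D
  variance : ∀ w, ∫ ξ, ‖g w ξ - G w‖ ^ 2 ∂D ≤ σ ^ 2
  lipschitz : ∀ w w', ‖G w - G w'‖ ^ 2 ≤ Λ * ‖w - w'‖ ^ 2

/-- One local step, with the accumulated noise as a second component of the state. -/
def noiseStep {Ξ H : Type*} [NormedAddCommGroup H] [InnerProductSpace ℝ H] (g : H → Ξ → H)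
    (G : H → H) (J : H → H) (δ : ℝ) (ξ : Ξ) (s : H × H) : H × H :=
  (s.1 + δ • J (g s.1 ξ), s.2 + (g s.1 ξ - G s.1))

namespace Oracle

variable {Ξ H : Type*} [MeasurableSpace Ξ] [NormedAddCommGroup H] [InnerProductSpace ℝ H]
  [MeasurableSpace H] [BorelSpace H] [FiniteDimensional ℝ H]
  [SecondCountableTopology H]
  {D : Measure Ξ} [IsProbabilityMeasure D] {g : H → Ξ → H} {G : H → H} {σ Λ : ℝ}

theorem integral_noise (h : Oracle D g G σ Λ) (w : H) : ∫ ξ, (g w ξ - G w) ∂D = 0 := by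
  rw [integral_sub (h.integrable w) (integrable_const _), h.mean]
  simp

theorem integrable_noise (h : Oracle D g G σ Λ) (w : H) : Integrable (fun ξ => g w ξ - G w) D :=
  (h.integrable w).sub (integrable_const _)

theorem lintegral_noise (h : Oracle D g G σ Λ) (w v : H) :
    ∫⁻ ξ, ENNReal.ofReal (‖v + (g w ξ - G w)‖ ^ 2) ∂D ≤ ENNReal.ofReal (‖v‖ ^ 2 + σ ^ 2) := by
  have : CompleteSpace H := FiniteDimensional.complete ℝ H
  rw [lintegral_sq_const_add (h.integrable_noise w) (h.sq_integrable w) (h.integral_noise w)]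
  exact ENNReal.ofReal_le_ofReal (add_le_add_right (h.variance w) _)

theorem measurable_noiseStep (h : Oracle D g G σ Λ) {J : H → H} (hJ : Measurable J) (δ : ℝ) :
    Measurable fun q : Ξ × (H × H) => noiseStep g G J δ q.1 q.2 := by
  have h1 : Measurable fun q : Ξ × (H × H) => g q.2.1 q.1 :=
    h.measurable.comp ((measurable_fst.comp measurable_snd).prodMk measurable_fst)
  have h2 := h.measurable_mean
  have h3 : Measurable fun q : Ξ × (H × H) => q.2.1 := measurable_fst.comp measurable_snd
  have h4 : Measurable fun q : Ξ × (H × H) => q.2.2 := measurable_snd.comp measurable_snd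
  exact (h3.add ((hJ.comp h1).const_smul δ)).prodMk (h4.add (h1.sub (h2.comp h3)))

/-- The increments are martingale differences: given the past the cross term has mean zero, and each
step adds at most σ². -/
theorem lintegral_noise_sum (h : Oracle D g G σ Λ) {J : H → H} (hJ : Measurable J) (δ : ℝ) (w : H)
    (k : ℕ) : ∫⁻ ξ, ENNReal.ofReal (‖(iter (noiseStep g G J δ) (w, 0) ξ k).2‖ ^ 2)
      ∂(Measure.infinitePi fun _ : ℕ => D) ≤ ENNReal.ofReal (k * σ ^ 2) := by
  induction k with
  | zero => simp [iter]
  | succ k ih =>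
    have hm := h.measurable_noiseStep hJ δ
    have hF : Measurable fun q : (H × H) × Ξ =>
        ENNReal.ofReal (‖(noiseStep g G J δ q.2 q.1).2‖ ^ 2) := by
      have := hm.comp measurable_swap
      exact ((measurable_snd.comp this).norm.pow_const 2).ennreal_ofReal
    have h1 := lintegral_iter_prod D hm (w, 0) k
      (F := fun s ξ => ENNReal.ofReal (‖(noiseStep g G J δ ξ s).2‖ ^ 2)) hF
    change ∫⁻ ξ, ENNReal.ofReal (‖(noiseStep g G J δ (ξ k)
      (iter (noiseStep g G J δ) (w, 0) ξ k)).2‖ ^ 2) ∂_ ≤ _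
    rw [h1]
    have hm2 := (measurable_iter_snd hm (w, 0) k).snd.norm.pow_const 2 |>.ennreal_ofReal
    calc _ ≤ ∫⁻ ξ, (ENNReal.ofReal (‖(iter (noiseStep g G J δ) (w, 0) ξ k).2‖ ^ 2)
            + ENNReal.ofReal (σ ^ 2)) ∂(Measure.infinitePi fun _ : ℕ => D) := by
          refine lintegral_mono fun ξ => ?_
          rw [← ENNReal.ofReal_add (by positivity) (by positivity)]
          exact h.lintegral_noise _ _
      _ ≤ ENNReal.ofReal (k * σ ^ 2) + ENNReal.ofReal (σ ^ 2) := by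
          rw [lintegral_add_right _ measurable_const]
          simp only [lintegral_const, measure_univ, mul_one]
          exact add_le_add_left ih _
      _ = _ := by
          rw [← ENNReal.ofReal_add (by positivity) (by positivity)]
          congr 1; push_cast; ring

theorem sq_integrable_noise_sum (h : Oracle D g G σ Λ) {J : H → H} (hJ : Measurable J) (δ : ℝ)
    (w : H) (k : ℕ) : Integrable (fun ξ => ‖(iter (noiseStep g G J δ) (w, 0) ξ k).2‖ ^ 2)
      (Measure.infinitePi fun _ : ℕ => D) :=
  integrable_sq_of_lintegral_lt_top
    (measurable_iter_snd (h.measurable_noiseStep hJ δ) (w, 0) k).snd.aestronglyMeasurable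
    ((h.lintegral_noise_sum hJ δ w k).trans_lt ENNReal.ofReal_lt_top)

theorem integrable_noise_sum (h : Oracle D g G σ Λ) {J : H → H} (hJ : Measurable J) (δ : ℝ)
    (w : H) (k : ℕ) : Integrable (fun ξ => (iter (noiseStep g G J δ) (w, 0) ξ k).2)
      (Measure.infinitePi fun _ : ℕ => D) :=
  integrable_of_integrable_sq
    (measurable_iter_snd (h.measurable_noiseStep hJ δ) (w, 0) k).snd.aestronglyMeasurable
    (h.sq_integrable_noise_sum hJ δ w k)

theorem integral_noise_sum (h : Oracle D g G σ Λ) {J : H → H} (hJ : Measurable J) (δ : ℝ)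
    (w : H) (k : ℕ) : ∫ ξ, (iter (noiseStep g G J δ) (w, 0) ξ k).2
      ∂(Measure.infinitePi fun _ : ℕ => D) = 0 := by
  induction k with
  | zero => simp [iter]
  | succ k ih =>
    have hm := h.measurable_noiseStep hJ δ
    have i0 := h.integrable_noise_sum hJ δ w k
    have i1 := h.integrable_noise_sum hJ δ w (k + 1)
    have e : ∀ ξ : ℕ → Ξ, (iter (noiseStep g G J δ) (w, 0) ξ (k + 1)).2
        = (iter (noiseStep g G J δ) (w, 0) ξ k).2
          + (g (iter (noiseStep g G J δ) (w, 0) ξ k).1 (ξ k)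
            - G (iter (noiseStep g G J δ) (w, 0) ξ k).1) := fun ξ => rfl
    have i2 : Integrable (fun ξ : ℕ → Ξ => g (iter (noiseStep g G J δ) (w, 0) ξ k).1 (ξ k)
        - G (iter (noiseStep g G J δ) (w, 0) ξ k).1) (Measure.infinitePi fun _ : ℕ => D) := by
      refine (i1.sub i0).congr (Filter.Eventually.of_forall fun ξ => ?_)
      simp [e]
    simp only [e]
    rw [integral_add i0 i2, ih, zero_add]
    have hF : StronglyMeasurable fun q : (H × H) × Ξ => g q.1.1 q.2 - G q.1.1 := by
      refine Measurable.stronglyMeasurable ?_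
      have h1 : Measurable fun q : (H × H) × Ξ => g q.1.1 q.2 :=
        h.measurable.comp ((measurable_fst.comp measurable_fst).prodMk measurable_snd)
      exact h1.sub (h.measurable_mean.comp (measurable_fst.comp measurable_fst))
    rw [integral_iter_prod D hm (w, 0) k (F := fun s ξ => g s.1 ξ - G s.1) hF i2]
    simp [h.integral_noise]

/-- The distance to the start obeys a recursion with factor 2 + 4δ²Λ ≤ 3. Exponential growth in `k`
is harmless, because δ is chosen after the number of local steps. -/
theorem lintegral_drift (h : Oracle D g G σ Λ) {J : H → H} (hJ : Measurable J)
    (hJn : ∀ v, ‖J v‖ = ‖v‖) {δ : ℝ} (hδ : 8 * δ ^ 2 * Λ ≤ 1) (w : H) (k : ℕ) :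
    ∫⁻ ξ, ENNReal.ofReal (‖(iter (noiseStep g G J δ) (w, 0) ξ k).1 - w‖ ^ 2)
      ∂(Measure.infinitePi fun _ : ℕ => D)
      ≤ ENNReal.ofReal (3 ^ k * (δ ^ 2 * (2 * σ ^ 2 + 4 * ‖G w‖ ^ 2))) := by
  set Q := δ ^ 2 * (2 * σ ^ 2 + 4 * ‖G w‖ ^ 2) with hQ
  have hQ0 : 0 ≤ Q := by positivity
  -- The form with 3^k − 1 closes the induction: 3(3^k − 1)Q + 2Q = (3^(k+1) − 1)Q.
  suffices hs : ∫⁻ ξ, ENNReal.ofReal (‖(iter (noiseStep g G J δ) (w, 0) ξ k).1 - w‖ ^ 2)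
      ∂(Measure.infinitePi fun _ : ℕ => D) ≤ ENNReal.ofReal ((3 ^ k - 1) * Q) by
    refine hs.trans (ENNReal.ofReal_le_ofReal ?_)
    linarith
  induction k with
  | zero => simp [iter]
  | succ k ih =>
    have hm := h.measurable_noiseStep hJ δ
    have hF : Measurable fun q : (H × H) × Ξ =>
        ENNReal.ofReal (‖(noiseStep g G J δ q.2 q.1).1 - w‖ ^ 2) := by
      have := hm.comp measurable_swap
      exact (((measurable_fst.comp this).sub_const w).norm.pow_const 2).ennreal_ofReal
    have h1 := lintegral_iter_prod D hm (w, 0) k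
      (F := fun s ξ => ENNReal.ofReal (‖(noiseStep g G J δ ξ s).1 - w‖ ^ 2)) hF
    change ∫⁻ ξ, ENNReal.ofReal (‖(noiseStep g G J δ (ξ k)
      (iter (noiseStep g G J δ) (w, 0) ξ k)).1 - w‖ ^ 2) ∂_ ≤ _
    rw [h1]
    have key : ∀ s : H × H, ∫⁻ ξ, ENNReal.ofReal (‖(noiseStep g G J δ ξ s).1 - w‖ ^ 2) ∂D
        ≤ ENNReal.ofReal 3 * ENNReal.ofReal (‖s.1 - w‖ ^ 2) + ENNReal.ofReal (2 * Q) := by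
      intro s
      have hb : ∀ ξ, ‖(noiseStep g G J δ ξ s).1 - w‖ ^ 2
          ≤ 2 * ‖s.1 - w‖ ^ 2 + 2 * δ ^ 2 * ‖G s.1 + (g s.1 ξ - G s.1)‖ ^ 2 := by
        intro ξ
        have e : (noiseStep g G J δ ξ s).1 - w = (s.1 - w) + δ • J (g s.1 ξ) := by
          simp only [noiseStep]; abel
        have := norm_add_sq_le_two (s.1 - w) (δ • J (g s.1 ξ))
        rw [e]
        refine this.trans_eq ?_
        rw [norm_smul, hJn, mul_pow, Real.norm_eq_abs, sq_abs, add_sub_cancel]; ring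
      have hG : ‖G s.1‖ ^ 2 ≤ 2 * ‖G w‖ ^ 2 + 2 * (Λ * ‖s.1 - w‖ ^ 2) :=
        (norm_sq_le_two_sub _ (G w)).trans (by linarith [h.lipschitz s.1 w])
      calc _ ≤ ∫⁻ ξ, (ENNReal.ofReal (2 * ‖s.1 - w‖ ^ 2) + ENNReal.ofReal (2 * δ ^ 2)
              * ENNReal.ofReal (‖G s.1 + (g s.1 ξ - G s.1)‖ ^ 2)) ∂D := by
            refine lintegral_mono fun ξ => ?_
            rw [← ENNReal.ofReal_mul (by positivity), ← ENNReal.ofReal_add (by positivity)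
              (by positivity)]
            exact ENNReal.ofReal_le_ofReal (hb ξ)
        _ ≤ ENNReal.ofReal (2 * ‖s.1 - w‖ ^ 2) + ENNReal.ofReal (2 * δ ^ 2)
              * ENNReal.ofReal (‖G s.1‖ ^ 2 + σ ^ 2) := by
            rw [lintegral_add_left measurable_const, lintegral_const_mul' _ _ ENNReal.ofReal_ne_top]
            simp only [lintegral_const, measure_univ, mul_one]
            gcongr
            exact h.lintegral_noise _ _
        _ ≤ _ := by
            rw [← ENNReal.ofReal_mul (by positivity), ← ENNReal.ofReal_add (by positivity)
              (by positivity), ← ENNReal.ofReal_mul (by positivity), ← ENNReal.ofReal_add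
              (by positivity) (by positivity)]
            refine ENNReal.ofReal_le_ofReal ?_
            have m1 := mul_le_mul_of_nonneg_left hG (by positivity : 0 ≤ 2 * δ ^ 2)
            have m2 := mul_le_mul_of_nonneg_right hδ (sq_nonneg ‖s.1 - w‖)
            have m3 : 0 ≤ ‖s.1 - w‖ ^ 2 := by positivity
            rw [hQ]
            linarith
    calc _ ≤ ∫⁻ ξ, (ENNReal.ofReal 3
            * ENNReal.ofReal (‖(iter (noiseStep g G J δ) (w, 0) ξ k).1 - w‖ ^ 2)
            + ENNReal.ofReal (2 * Q)) ∂(Measure.infinitePi fun _ : ℕ => D) :=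
          lintegral_mono fun ξ => key _
      _ ≤ ENNReal.ofReal 3 * ENNReal.ofReal ((3 ^ k - 1) * Q) + ENNReal.ofReal (2 * Q) := by
          rw [lintegral_add_right _ measurable_const,
            lintegral_const_mul' _ _ ENNReal.ofReal_ne_top]
          simp only [lintegral_const, measure_univ, mul_one]
          gcongr
      _ = _ := by
          have : (1 : ℝ) ≤ 3 ^ k := one_le_pow₀ (by norm_num)
          have h0 : 0 ≤ (3 ^ k - 1) * Q := mul_nonneg (by linarith) hQ0
          rw [← ENNReal.ofReal_mul (by positivity), ← ENNReal.ofReal_add (by positivity)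
            (by positivity)]
          congr 1; ring

end Oracle

/-! ### Uniformly random sets of clients. -/

section Sampling

variable {H : Type*} [NormedAddCommGroup H] [InnerProductSpace ℝ H] {M : ℕ}

theorem card_powersetCard_mem {m : ℕ} (hm : 1 ≤ m) (i : Fin M) :
    ((Finset.univ.powersetCard m).filter fun S : Finset (Fin M) => i ∈ S).card
      = (M - 1).choose (m - 1) := by
  have := Finset.card_filter_powersetCard_subset {i} (Finset.univ : Finset (Fin M)) m
    (Finset.subset_univ _) (by simpa using hm)
  simpa using this

/-- Only the independence of this count from the pair matters below, not its value. -/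
theorem exists_card_powersetCard_pair (M m : ℕ) : ∃ N : ℕ, ∀ i j : Fin M, i ≠ j →
    ((Finset.univ.powersetCard m).filter fun S : Finset (Fin M) => i ∈ S ∧ j ∈ S).card = N := by
  have e : ∀ i j : Fin M, ∀ S : Finset (Fin M), (i ∈ S ∧ j ∈ S) ↔ {i, j} ⊆ S := fun i j S => by
    simp [Finset.insert_subset_iff]
  by_cases hm : 2 ≤ m
  · refine ⟨(M - 2).choose (m - 2), fun i j hij => ?_⟩
    have := Finset.card_filter_powersetCard_subset {i, j} (Finset.univ : Finset (Fin M)) m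
      (Finset.subset_univ _) (by rwa [Finset.card_pair hij])
    rw [Finset.card_pair hij, Finset.card_univ, Fintype.card_fin] at this
    simp only [e]
    exact this
  · refine ⟨0, fun i j hij => ?_⟩
    rw [Finset.card_eq_zero, Finset.filter_eq_empty_iff]
    intro S hS hc
    rw [e] at hc
    have h1 := Finset.card_le_card hc
    rw [Finset.card_pair hij, (Finset.mem_powersetCard.1 hS).2] at h1
    exact hm h1

theorem sum_powersetCard_sum_eq_zero {m : ℕ} (hm : 1 ≤ m) {v : Fin M → H} (hv : ∑ i, v i = 0) :
    ∑ S ∈ Finset.univ.powersetCard m, ∑ i ∈ S, v i = 0 := by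
  have e : ∀ S : Finset (Fin M), ∑ i ∈ S, v i = ∑ i, if i ∈ S then v i else 0 := fun S => by
    rw [Finset.sum_ite_mem, Finset.univ_inter]
  simp only [e]
  rw [Finset.sum_comm]
  have : ∀ i, (∑ S ∈ Finset.univ.powersetCard m, if i ∈ S then v i else 0)
      = ((M - 1).choose (m - 1)) • v i := fun i => by
    rw [← Finset.sum_filter, Finset.sum_const, card_powersetCard_mem hm]
  simp only [this]
  rw [← Finset.smul_sum, hv, smul_zero]

/-- All pairs i ≠ j have the same weight N, and the inner products over all pairs sum to ‖∑ v‖² = 0.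
The off-diagonal part is therefore −N∑‖v i‖²: sampling without replacement is negatively correlated,
and dropping this term gives the bound. -/
theorem sum_powersetCard_norm_sq_le {m : ℕ} (hm : 1 ≤ m) {v : Fin M → H} (hv : ∑ i, v i = 0) :
    ∑ S ∈ Finset.univ.powersetCard m, ‖∑ i ∈ S, v i‖ ^ 2
      ≤ ((M - 1).choose (m - 1) : ℝ) * ∑ i, ‖v i‖ ^ 2 := by
  obtain ⟨N, hN⟩ := exists_card_powersetCard_pair M m
  have e : ∀ S : Finset (Fin M), ‖∑ i ∈ S, v i‖ ^ 2
      = ∑ i, ∑ j, if i ∈ S ∧ j ∈ S then inner ℝ (v i) (v j) else (0 : ℝ) := fun S => by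
    have : ∑ i ∈ S, v i = ∑ i, if i ∈ S then v i else 0 := by
      rw [Finset.sum_ite_mem, Finset.univ_inter]
    rw [← real_inner_self_eq_norm_sq, this, sum_inner]
    refine Finset.sum_congr rfl fun i _ => ?_
    rw [inner_sum]
    refine Finset.sum_congr rfl fun j _ => ?_
    by_cases hi : i ∈ S <;> by_cases hj : j ∈ S <;> simp [hi, hj]
  simp only [e]
  rw [Finset.sum_comm]
  have h1 : ∀ i, (∑ S ∈ Finset.univ.powersetCard m, ∑ j,
      if i ∈ S ∧ j ∈ S then inner ℝ (v i) (v j) else (0 : ℝ))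
      = ((M - 1).choose (m - 1) - N : ℝ) * ‖v i‖ ^ 2 + N * inner ℝ (v i) (∑ j, v j) := by
    intro i
    rw [Finset.sum_comm]
    have h2 : ∀ j, (∑ S ∈ Finset.univ.powersetCard m,
        if i ∈ S ∧ j ∈ S then inner ℝ (v i) (v j) else (0 : ℝ))
        = (if i = j then ((M - 1).choose (m - 1) - N : ℝ) * inner ℝ (v i) (v j) else 0)
          + N * inner ℝ (v i) (v j) := by
      intro j
      rw [← Finset.sum_filter, Finset.sum_const, nsmul_eq_mul]
      by_cases hij : i = j
      · subst hij
        simp only [and_self, if_true, card_powersetCard_mem hm]; ring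
      · rw [hN i j hij, if_neg hij, zero_add]
    simp only [h2]
    rw [Finset.sum_add_distrib, Finset.sum_ite_eq, if_pos (Finset.mem_univ i), inner_sum,
      Finset.mul_sum, real_inner_self_eq_norm_sq]
  simp only [h1, hv, inner_zero_right, mul_zero, add_zero]
  rw [← Finset.mul_sum]
  refine mul_le_mul_of_nonneg_right ?_ (Finset.sum_nonneg fun i _ => sq_nonneg _)
  linarith [(Nat.cast_nonneg N : (0 : ℝ) ≤ N)]

/-- The law of the set of participating clients. -/
abbrev subsetLaw (M m : ℕ) : Measure (Finset (Fin M)) :=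
  uniformOn {S : Finset (Fin M) | S.card = m}

theorem coe_powersetCard_univ (M m : ℕ) :
    {S : Finset (Fin M) | S.card = m} = ↑(Finset.univ.powersetCard m : Finset (Finset (Fin M))) := by
  ext S; simp

theorem isProbabilityMeasure_subsetLaw {m : ℕ} (hmM : m ≤ M) :
    IsProbabilityMeasure (subsetLaw M m) := by
  refine isProbabilityMeasure_uniformOn (Set.toFinite _) ?_
  rw [coe_powersetCard_univ]
  have : ((Finset.univ : Finset (Fin M)).powersetCard m).Nonempty :=
    Finset.powersetCard_nonempty.2 (by simpa using hmM)
  exact_mod_cast this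

theorem ae_card_subsetLaw (M m : ℕ) : ∀ᵐ S ∂(subsetLaw M m), S.card = m :=
  ae_cond_mem (Set.toFinite _).measurableSet

theorem integral_subsetLaw [CompleteSpace H] {m : ℕ} (F : Finset (Fin M) → H) :
    ∫ S, F S ∂(subsetLaw M m)
      = ((M.choose m : ℝ))⁻¹ • ∑ S ∈ Finset.univ.powersetCard m, F S := by
  have : IsFiniteMeasure (subsetLaw M m) := by unfold subsetLaw; infer_instance
  rw [integral_fintype .of_finite, Finset.smul_sum]
  have hr : ∀ S : Finset (Fin M), (subsetLaw M m).real {S} • F S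
      = if S ∈ Finset.univ.powersetCard m then ((M.choose m : ℝ))⁻¹ • F S else 0 := by
    intro S
    have h1 := uniformOn_apply_finset (s := (Finset.univ : Finset (Fin M)).powersetCard m)
      (t := {S})
    rw [← coe_powersetCard_univ, Finset.coe_singleton, Finset.card_powersetCard, Finset.card_univ,
      Fintype.card_fin] at h1
    rw [measureReal_def, h1]
    by_cases hS : S ∈ (Finset.univ : Finset (Fin M)).powersetCard m
    · rw [if_pos hS, Finset.inter_singleton_of_mem hS]; simp
    · rw [if_neg hS, Finset.inter_singleton_of_notMem hS]; simp
  simp only [hr]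
  rw [Finset.sum_ite_mem, Finset.univ_inter]

/-- The variance of the mean over a uniformly random set of `m` clients. -/
theorem integral_subsetLaw_norm_sq_le {m : ℕ} (hm : 1 ≤ m) (hmM : m ≤ M) {v : Fin M → H}
    (hv : ∑ i, v i = 0) {s : ℝ} (hs : ∀ i, ‖v i‖ ^ 2 ≤ s) :
    ∫ S, ‖(m : ℝ)⁻¹ • ∑ i ∈ S, v i‖ ^ 2 ∂(subsetLaw M m) ≤ s / m := by
  rw [integral_subsetLaw (H := ℝ)]
  have hm0 : (0 : ℝ) < m := by exact_mod_cast hm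
  have hM0 : (0 : ℝ) < M := by exact_mod_cast hm.trans hmM
  have hc : (0 : ℝ) < M.choose m := by exact_mod_cast Nat.choose_pos hmM
  have h1 := sum_powersetCard_norm_sq_le hm hv
  have h2 : ∑ i, ‖v i‖ ^ 2 ≤ M * s := by
    refine (Finset.sum_le_sum fun i _ => hs i).trans_eq ?_
    simp
  have h3 : (M : ℝ) * (M - 1).choose (m - 1) = M.choose m * m := by
    have := Nat.add_one_mul_choose_eq (M - 1) (m - 1)
    rw [Nat.sub_add_cancel hm, Nat.sub_add_cancel (hm.trans hmM)] at this
    exact_mod_cast this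
  simp only [norm_smul, mul_pow]
  rw [← Finset.mul_sum, smul_eq_mul, norm_inv, Real.norm_of_nonneg hm0.le]
  calc _ ≤ (M.choose m : ℝ)⁻¹ * ((m : ℝ)⁻¹ ^ 2 * (((M - 1).choose (m - 1) : ℝ) * (M * s))) := by
        gcongr
        exact h1.trans (mul_le_mul_of_nonneg_left h2 (by positivity))
    _ = (M.choose m : ℝ)⁻¹ * ((m : ℝ)⁻¹ ^ 2 * ((M * (M - 1).choose (m - 1) : ℝ) * s)) := by ring
    _ = s / m := by rw [h3]; field_simp

theorem integral_subsetLaw_mean [CompleteSpace H] {m : ℕ} (hm : 1 ≤ m) {v : Fin M → H}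
    (hv : ∑ i, v i = 0) : ∫ S, (m : ℝ)⁻¹ • ∑ i ∈ S, v i ∂(subsetLaw M m) = 0 := by
  rw [integral_subsetLaw, ← Finset.smul_sum, sum_powersetCard_sum_eq_zero hm hv, smul_zero,
    smul_zero]

end Sampling

/-! ### The error of the averaged local gradients of a round. -/

/-- Independent centered random vectors are orthogonal. -/
theorem integral_norm_sum_sq_pi {M : ℕ} {Ω : Fin M → Type*} [∀ i, MeasurableSpace (Ω i)]
    (P : ∀ i, Measure (Ω i)) [∀ i, IsProbabilityMeasure (P i)]
    {H : Type*} [NormedAddCommGroup H] [InnerProductSpace ℝ H] [MeasurableSpace H] [BorelSpace H]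
    [FiniteDimensional ℝ H] [SecondCountableTopology H]
    {X : ∀ i, Ω i → H} (hX : ∀ i, Measurable (X i)) (h2 : ∀ i, Integrable (fun ω => ‖X i ω‖ ^ 2) (P i))
    (h0 : ∀ i, ∫ ω, X i ω ∂(P i) = 0) (S : Finset (Fin M)) :
    Integrable (fun ω => ‖∑ i ∈ S, X i (ω i)‖ ^ 2) (Measure.pi P) ∧
    ∫ ω, ‖∑ i ∈ S, X i (ω i)‖ ^ 2 ∂(Measure.pi P) = ∑ i ∈ S, ∫ ω, ‖X i ω‖ ^ 2 ∂(P i) := by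
  have : CompleteSpace H := FiniteDimensional.complete ℝ H
  have hmp : ∀ i, MeasurePreserving (fun ω : ∀ i, Ω i => ω i) (Measure.pi P) (P i) := fun i =>
    measurePreserving_eval P i
  have hi : ∀ i, Integrable (X i) (P i) := fun i =>
    integrable_of_integrable_sq (hX i).aestronglyMeasurable (h2 i)
  have hi' : ∀ i, Integrable (fun ω : ∀ i, Ω i => X i (ω i)) (Measure.pi P) := fun i =>
    (hmp i).integrable_comp_of_integrable (hi i)
  have h2' : ∀ i, Integrable (fun ω : ∀ i, Ω i => ‖X i (ω i)‖ ^ 2) (Measure.pi P) := fun i =>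
    (hmp i).integrable_comp_of_integrable (h2 i)
  have h0' : ∀ i, ∫ ω : ∀ i, Ω i, X i (ω i) ∂(Measure.pi P) = 0 := fun i => by
    rw [← h0 i, ← (hmp i).map_eq, integral_map (hmp i).measurable.aemeasurable
      (hX i).aestronglyMeasurable]
  have h2e : ∀ i, ∫ ω : ∀ i, Ω i, ‖X i (ω i)‖ ^ 2 ∂(Measure.pi P) = ∫ ω, ‖X i ω‖ ^ 2 ∂(P i) :=
    fun i => by
      rw [← (hmp i).map_eq, integral_map (hmp i).measurable.aemeasurable
        ((hX i).norm.pow_const 2).aestronglyMeasurable]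
  have hind := iIndepFun_pi (μ := P) fun i => (hX i).aemeasurable
  have hin : ∀ i j, Integrable (fun ω : ∀ i, Ω i => inner ℝ (X i (ω i)) (X j (ω j)))
      (Measure.pi P) := fun i j => by
    refine ((h2' i).add (h2' j)).mono'
      ((hi' i).aestronglyMeasurable.inner (hi' j).aestronglyMeasurable)
      (Filter.Eventually.of_forall fun ω => ?_)
    have := norm_inner_le_norm (𝕜 := ℝ) (X i (ω i)) (X j (ω j))
    simp only [Pi.add_apply]
    nlinarith [sq_nonneg (‖X i (ω i)‖ - ‖X j (ω j)‖), sq_nonneg ‖X i (ω i)‖, sq_nonneg ‖X j (ω j)‖]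
  have e : ∀ ω : ∀ i, Ω i, ‖∑ i ∈ S, X i (ω i)‖ ^ 2
      = ∑ i ∈ S, ∑ j ∈ S, inner ℝ (X i (ω i)) (X j (ω j)) := fun ω => by
    rw [← real_inner_self_eq_norm_sq, sum_inner]
    simp only [inner_sum]
  simp only [e]
  have hI := fun i => integrable_finsetSum S fun j _ => hin i j
  refine ⟨integrable_finsetSum S fun i _ => hI i, ?_⟩
  rw [integral_finsetSum S fun i _ => hI i]
  refine Finset.sum_congr rfl fun i hiS => ?_
  rw [integral_finsetSum S fun j _ => hin i j, Finset.sum_eq_single_of_mem i hiS]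
  · simp only [real_inner_self_eq_norm_sq]
    exact h2e i
  · intro j _ hji
    refine ((hind.indepFun (Ne.symm hji)).integral_bilin (hi' i) (hi' j) (innerSL ℝ)).trans ?_
    rw [h0', map_zero]; rfl

theorem norm_mean_sq_le {ι H : Type*} [NormedAddCommGroup H] [InnerProductSpace ℝ H] (s : Finset ι)
    {n : ℕ} (hn : s.card = n) (v : ι → H) :
    ‖(n : ℝ)⁻¹ • ∑ i ∈ s, v i‖ ^ 2 ≤ (n : ℝ)⁻¹ * ∑ i ∈ s, ‖v i‖ ^ 2 := by
  rcases Nat.eq_zero_or_pos n with h0 | hpos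
  · simp [h0]
  have hn0 : (0 : ℝ) < n := by exact_mod_cast hpos
  have h1 := sq_sum_le_card_mul_sum_sq (s := s) (f := fun i => ‖v i‖)
  have h2 := pow_le_pow_left₀ (norm_nonneg _) (norm_sum_le s v) 2
  rw [hn] at h1
  rw [norm_smul, norm_inv, Real.norm_of_nonneg hn0.le, mul_pow]
  calc _ ≤ (n : ℝ)⁻¹ ^ 2 * (n * ∑ i ∈ s, ‖v i‖ ^ 2) :=
        mul_le_mul_of_nonneg_left (h2.trans h1) (by positivity)
    _ = _ := by field_simp

section Round

variable {M : ℕ} {Ξ : Fin M → Type u} [∀ i, MeasurableSpace (Ξ i)]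
  {D : ∀ i, Measure (Ξ i)} [∀ i, IsProbabilityMeasure (D i)]
  {H : Type*} [NormedAddCommGroup H] [InnerProductSpace ℝ H] [MeasurableSpace H] [BorelSpace H]
  [FiniteDimensional ℝ H] [SecondCountableTopology H]
  {g : ∀ i, H → Ξ i → H} {G : Fin M → H → H} {J : H → H} {σ Λ sG : ℝ}

/-- The average of the mean gradients of all clients. -/
def meanGrad (G : Fin M → H → H) (w : H) : H := (M : ℝ)⁻¹ • ∑ i, G i w

/-- The contribution of the sampling noise to the error of the averaged local gradients. -/
def noiseErr (g : ∀ i, H → Ξ i → H) (G : Fin M → H → H) (J : H → H) (δ : ℝ) (K m : ℕ) (w : H)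
    (θ : RoundDraw Ξ) : H :=
  (m : ℝ)⁻¹ • ∑ i ∈ θ.1, (K : ℝ)⁻¹ • (iter (noiseStep (g i) (G i) J δ) (w, 0) (θ.2 i) K).2

/-- The contribution of the client drift. -/
def driftErr (g : ∀ i, H → Ξ i → H) (G : Fin M → H → H) (J : H → H) (δ : ℝ) (K m : ℕ) (w : H)
    (θ : RoundDraw Ξ) : H :=
  (m : ℝ)⁻¹ • ∑ i ∈ θ.1, (K : ℝ)⁻¹ • ∑ k ∈ Finset.range K,
    (G i (iter (noiseStep (g i) (G i) J δ) (w, 0) (θ.2 i) k).1 - G i w)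

/-- The contribution of partial participation. -/
def sampErr (G : Fin M → H → H) (m : ℕ) (w : H) (S : Finset (Fin M)) : H :=
  (m : ℝ)⁻¹ • ∑ i ∈ S, (G i w - meanGrad G w)

/-- The error of the averaged local gradients of a round. -/
def roundErr (g : ∀ i, H → Ξ i → H) (G : Fin M → H → H) (J : H → H) (δ : ℝ) (K m : ℕ) (w : H)
    (θ : RoundDraw Ξ) : H :=
  noiseErr g G J δ K m w θ + driftErr g G J δ K m w θ + sampErr G m w θ.1

/-- The law of the randomness of one round. -/
abbrev roundLaw (m : ℕ) (D : ∀ i, Measure (Ξ i)) [∀ i, IsProbabilityMeasure (D i)] :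
    Measure (RoundDraw Ξ) :=
  (subsetLaw M m).prod (Measure.pi fun i => Measure.infinitePi fun _ : ℕ => D i)

/-- The variance caused by partial participation. -/
def sampVar (M m : ℕ) (sG : ℝ) : ℝ := open Classical in if m = M ∨ sG = 0 then 0 else sG ^ 2 / m

theorem sampVar_nonneg (M m : ℕ) (sG : ℝ) : 0 ≤ sampVar M m sG := by
  unfold sampVar; split_ifs <;> positivity

theorem iter_noiseStep_snd {Ξ : Type*} (g : H → Ξ → H) (G : H → H) (J : H → H) (δ : ℝ) (w : H)
    (ξ : ℕ → Ξ) (k : ℕ) : (iter (noiseStep g G J δ) (w, 0) ξ k).2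
      = ∑ j ∈ Finset.range k, (g (iter (noiseStep g G J δ) (w, 0) ξ j).1 (ξ j)
        - G (iter (noiseStep g G J δ) (w, 0) ξ j).1) := by
  induction k with
  | zero => rfl
  | succ k ih => rw [Finset.sum_range_succ, ← ih]; rfl

/-- The intermediate terms cancel: noise compares stochastic with mean gradients along the local
path, drift compares the path with its start, sampling compares the chosen clients with all of them.
-/
theorem roundErr_eq {δ : ℝ} {K m : ℕ} (hK : 1 ≤ K) (hm : 1 ≤ m) (w : H) {θ : RoundDraw Ξ}
    (hθ : θ.1.card = m) : roundErr g G J δ K m w θ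
      = (m : ℝ)⁻¹ • ∑ i ∈ θ.1, (K : ℝ)⁻¹ • ∑ k ∈ Finset.range K,
          g i (iter (noiseStep (g i) (G i) J δ) (w, 0) (θ.2 i) k).1 (θ.2 i k) - meanGrad G w := by
  have hm0 : (m : ℝ) ≠ 0 := by positivity
  have hK0 : (K : ℝ) ≠ 0 := by positivity
  have e1 : sampErr G m w θ.1 = (m : ℝ)⁻¹ • ∑ i ∈ θ.1, G i w - meanGrad G w := by
    unfold sampErr
    rw [Finset.sum_sub_distrib, Finset.sum_const, hθ, smul_sub, ← Nat.cast_smul_eq_nsmul ℝ,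
      inv_smul_smul₀ hm0]
  unfold roundErr noiseErr driftErr
  rw [e1, ← add_sub_assoc]
  congr 1
  rw [← smul_add, ← smul_add, ← Finset.sum_add_distrib, ← Finset.sum_add_distrib]
  congr 1
  refine Finset.sum_congr rfl fun i _ => ?_
  rw [iter_noiseStep_snd, ← smul_add, ← Finset.sum_add_distrib]
  simp only [sub_add_sub_cancel]
  rw [Finset.sum_sub_distrib, Finset.sum_const, Finset.card_range, smul_sub,
    ← Nat.cast_smul_eq_nsmul ℝ, inv_smul_smul₀ hK0, sub_add_cancel]

theorem measurable_sum_mem {f : ∀ i, (ℕ → Ξ i) → H} (hf : ∀ i, Measurable (f i)) :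
    Measurable fun θ : RoundDraw Ξ => ∑ i ∈ θ.1, f i (θ.2 i) := by
  have e : (fun θ : RoundDraw Ξ => ∑ i ∈ θ.1, f i (θ.2 i))
      = fun θ => ∑ i, if i ∈ θ.1 then f i (θ.2 i) else 0 := by
    funext θ
    rw [Finset.sum_ite_mem, Finset.univ_inter]
  rw [e]
  refine Finset.measurable_sum _ fun i _ => Measurable.ite ?_ ?_ measurable_const
  · exact measurable_fst (measurableSet_mem_finset i)
  · exact (hf i).comp ((measurable_pi_apply i).comp measurable_snd)

theorem ae_card_roundLaw (m : ℕ) : ∀ᵐ θ ∂(roundLaw m D), θ.1.card = m :=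
  Measure.quasiMeasurePreserving_fst.ae (ae_card_subsetLaw M m)

/-- Bounds on a round are proved for each fixed set of clients, over which only the data points are
random. -/
theorem lintegral_roundLaw_le {m : ℕ} (hmM : m ≤ M) {F : RoundDraw Ξ → ENNReal} (hF : Measurable F)
    {r : ENNReal} (h : ∀ S : Finset (Fin M), S.card = m →
      ∫⁻ ξ, F (S, ξ) ∂(Measure.pi fun i => Measure.infinitePi fun _ : ℕ => D i) ≤ r) :
    ∫⁻ θ, F θ ∂(roundLaw m D) ≤ r := by
  have := isProbabilityMeasure_subsetLaw hmM
  rw [lintegral_prod _ hF.aemeasurable]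
  calc _ ≤ ∫⁻ _, r ∂(subsetLaw M m) := by
        refine lintegral_mono_ae ?_
        filter_upwards [ae_card_subsetLaw M m] with S hS using h S hS
    _ = r := by simp

theorem measurable_noiseErr (ho : ∀ i, Oracle (D i) (g i) (G i) σ Λ) (hJ : Measurable J) (δ : ℝ)
    (K m : ℕ) (w : H) : Measurable (noiseErr g G J δ K m w) :=
  (measurable_sum_mem fun i => ((measurable_iter_snd ((ho i).measurable_noiseStep hJ δ) (w, 0)
    K).snd.const_smul _)).const_smul _

theorem measurable_driftErr (ho : ∀ i, Oracle (D i) (g i) (G i) σ Λ) (hJ : Measurable J) (δ : ℝ)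
    (K m : ℕ) (w : H) : Measurable (driftErr g G J δ K m w) := by
  refine (measurable_sum_mem (f := fun i ξ => (K : ℝ)⁻¹ • ∑ k ∈ Finset.range K,
    (G i (iter (noiseStep (g i) (G i) J δ) (w, 0) ξ k).1 - G i w)) fun i => ?_).const_smul _
  refine (Finset.measurable_sum _ fun k _ => ?_).const_smul _
  exact ((ho i).measurable_mean.comp
    (measurable_iter_snd ((ho i).measurable_noiseStep hJ δ) (w, 0) k).fst).sub_const _

theorem measurable_sampErr (G : Fin M → H → H) (m : ℕ) (w : H) : Measurable (sampErr G m w) :=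
  measurable_of_finite _

theorem lintegral_noiseErr (ho : ∀ i, Oracle (D i) (g i) (G i) σ Λ) (hJ : Measurable J) (δ : ℝ)
    {K m : ℕ} (hK : 1 ≤ K) (hm : 1 ≤ m) (hmM : m ≤ M) (w : H) :
    ∫⁻ θ, ENNReal.ofReal (‖noiseErr g G J δ K m w θ‖ ^ 2) ∂(roundLaw m D)
      ≤ ENNReal.ofReal (σ ^ 2 / (m * K)) := by
  have hm0 : (0 : ℝ) < m := by exact_mod_cast hm
  have hK0 : (0 : ℝ) < K := by exact_mod_cast hK
  refine lintegral_roundLaw_le hmM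
    ((measurable_noiseErr ho hJ δ K m w).norm.pow_const 2).ennreal_ofReal fun S hS => ?_
  have hmeas := fun i => (measurable_iter_snd ((ho i).measurable_noiseStep hJ δ) (w, 0) K).snd
  obtain ⟨h1, h2⟩ := integral_norm_sum_sq_pi (fun i => Measure.infinitePi fun _ : ℕ => D i) hmeas
    (fun i => (ho i).sq_integrable_noise_sum hJ δ w K)
    (fun i => (ho i).integral_noise_sum hJ δ w K) S
  have e : ∀ ξ : ∀ i, ℕ → Ξ i, ‖noiseErr g G J δ K m w (S, ξ)‖ ^ 2 = (m : ℝ)⁻¹ ^ 2 * (K : ℝ)⁻¹ ^ 2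
      * ‖∑ i ∈ S, (iter (noiseStep (g i) (G i) J δ) (w, 0) (ξ i) K).2‖ ^ 2 := fun ξ => by
    unfold noiseErr
    rw [← Finset.smul_sum, norm_smul, norm_smul, mul_pow, mul_pow, Real.norm_of_nonneg
      (by positivity), Real.norm_of_nonneg (by positivity), mul_assoc]
  have hi : Integrable (fun ξ : ∀ i, ℕ → Ξ i => ‖noiseErr g G J δ K m w (S, ξ)‖ ^ 2)
      (Measure.pi fun i => Measure.infinitePi fun _ : ℕ => D i) := by
    simp only [e]; exact h1.const_mul _
  rw [lintegral_ofReal_sq_eq hi]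
  refine ENNReal.ofReal_le_ofReal ?_
  simp only [e]
  rw [integral_const_mul, h2]
  have h3 : ∀ i ∈ S, ∫ ξ, ‖(iter (noiseStep (g i) (G i) J δ) (w, 0) ξ K).2‖ ^ 2
      ∂(Measure.infinitePi fun _ : ℕ => D i) ≤ K * σ ^ 2 := fun i _ =>
    integral_sq_le_of_lintegral_le (hmeas i).aestronglyMeasurable (by positivity)
      ((ho i).lintegral_noise_sum hJ δ w K)
  have h4 := Finset.sum_le_card_nsmul S _ _ h3
  rw [hS, nsmul_eq_mul] at h4
  calc _ ≤ (m : ℝ)⁻¹ ^ 2 * (K : ℝ)⁻¹ ^ 2 * (m * (K * σ ^ 2)) := by gcongr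
    _ = _ := by field_simp

theorem integral_noiseErr (ho : ∀ i, Oracle (D i) (g i) (G i) σ Λ) (hJ : Measurable J) (δ : ℝ)
    {K m : ℕ} (hmM : m ≤ M) (w : H) (hi : Integrable (noiseErr g G J δ K m w) (roundLaw m D)) :
    ∫ θ, noiseErr g G J δ K m w θ ∂(roundLaw m D) = 0 := by
  have := isProbabilityMeasure_subsetLaw hmM
  rw [integral_prod _ hi]
  have h0 : ∀ S, ∫ ξ, noiseErr g G J δ K m w (S, ξ)
      ∂(Measure.pi fun i => Measure.infinitePi fun _ : ℕ => D i) = 0 := by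
    intro S
    unfold noiseErr
    have hmp : ∀ i, MeasurePreserving (fun ξ : ∀ i, ℕ → Ξ i => ξ i)
        (Measure.pi fun i => Measure.infinitePi fun _ : ℕ => D i)
        (Measure.infinitePi fun _ : ℕ => D i) := fun i =>
      measurePreserving_eval (fun i => Measure.infinitePi fun _ : ℕ => D i) i
    have hI : ∀ i, Integrable (fun ξ : ∀ i, ℕ → Ξ i =>
        (iter (noiseStep (g i) (G i) J δ) (w, 0) (ξ i) K).2)
        (Measure.pi fun i => Measure.infinitePi fun _ : ℕ => D i) := fun i =>
      (hmp i).integrable_comp_of_integrable ((ho i).integrable_noise_sum hJ δ w K)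
    have hs := integral_finsetSum S (f := fun i (ξ : ∀ i, ℕ → Ξ i) => (K : ℝ)⁻¹ •
      (iter (noiseStep (g i) (G i) J δ) (w, 0) (ξ i) K).2) fun i _ => (hI i).smul _
    rw [integral_smul]
    refine (congrArg _ hs).trans ?_
    rw [Finset.sum_eq_zero, smul_zero]
    intro i _
    rw [integral_smul]
    have := integral_map (μ := Measure.pi fun i => Measure.infinitePi fun _ : ℕ => D i)
      (hmp i).measurable.aemeasurable (f := fun ξ =>
        (iter (noiseStep (g i) (G i) J δ) (w, 0) ξ K).2)
      (measurable_iter_snd ((ho i).measurable_noiseStep hJ δ) (w, 0) K).snd.aestronglyMeasurable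
    rw [(hmp i).map_eq, (ho i).integral_noise_sum hJ δ w K] at this
    rw [← this, smul_zero]
  simp only [h0, integral_zero]

/-- Convexity of the square, over clients and over local steps, reduces to `lintegral_drift`;
bounded heterogeneity replaces the gradient of each client by the mean gradient. -/
theorem lintegral_driftErr (ho : ∀ i, Oracle (D i) (g i) (G i) σ Λ) (hΛ : 0 ≤ Λ)
    (hJ : Measurable J) (hJn : ∀ v, ‖J v‖ = ‖v‖) {δ : ℝ} (hδ : 8 * δ ^ 2 * Λ ≤ 1)
    {K m : ℕ} (hK : 1 ≤ K) (hm : 1 ≤ m) (hmM : m ≤ M) (w : H)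
    (hsG : ∀ i, ‖G i w - meanGrad G w‖ ^ 2 ≤ sG ^ 2) :
    ∫⁻ θ, ENNReal.ofReal (‖driftErr g G J δ K m w θ‖ ^ 2) ∂(roundLaw m D)
      ≤ ENNReal.ofReal (Λ * 3 ^ K * δ ^ 2 * (2 * σ ^ 2 + 8 * sG ^ 2 + 8 * ‖meanGrad G w‖ ^ 2)) := by
  have hm0 : (0 : ℝ) < m := by exact_mod_cast hm
  have hK0 : (0 : ℝ) < K := by exact_mod_cast hK
  refine lintegral_roundLaw_le hmM
    ((measurable_driftErr ho hJ δ K m w).norm.pow_const 2).ennreal_ofReal fun S hS => ?_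
  set q : ℝ := 3 ^ K * (δ ^ 2 * (2 * σ ^ 2 + 8 * sG ^ 2 + 8 * ‖meanGrad G w‖ ^ 2)) with hq
  set F : Fin M → ℕ → (∀ i, ℕ → Ξ i) → ℝ := fun i k ξ =>
    ‖(iter (noiseStep (g i) (G i) J δ) (w, 0) (ξ i) k).1 - w‖ ^ 2 with hF
  have hmp : ∀ i, MeasurePreserving (fun ξ : ∀ i, ℕ → Ξ i => ξ i)
      (Measure.pi fun i => Measure.infinitePi fun _ : ℕ => D i)
      (Measure.infinitePi fun _ : ℕ => D i) := fun i =>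
    measurePreserving_eval (fun i => Measure.infinitePi fun _ : ℕ => D i) i
  have hmeas : ∀ i k, Measurable fun ξ : ℕ → Ξ i =>
      (iter (noiseStep (g i) (G i) J δ) (w, 0) ξ k).1 - w := fun i k =>
    (measurable_iter_snd ((ho i).measurable_noiseStep hJ δ) (w, 0) k).fst.sub_const _
  have hFm : ∀ i k, Measurable (F i k) := fun i k =>
    ((hmeas i k).comp (measurable_pi_apply i)).norm.pow_const 2
  have hlin : ∀ i, ∀ k ∈ Finset.range K, ∫⁻ ξ, ENNReal.ofReal (F i k ξ)
      ∂(Measure.pi fun i => Measure.infinitePi fun _ : ℕ => D i) ≤ ENNReal.ofReal q := by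
    intro i k hk
    have h1 := (hmp i).lintegral_comp ((hmeas i k).norm.pow_const 2).ennreal_ofReal
    refine h1.le.trans (((ho i).lintegral_drift hJ hJn hδ w k).trans
      (ENNReal.ofReal_le_ofReal ?_))
    have h2 : ‖G i w‖ ^ 2 ≤ 2 * ‖meanGrad G w‖ ^ 2 + 2 * sG ^ 2 :=
      (norm_sq_le_two_sub _ (meanGrad G w)).trans (by linarith [hsG i])
    have h3 : (3 : ℝ) ^ k ≤ 3 ^ K :=
      pow_le_pow_right₀ (by norm_num) (Finset.mem_range.1 hk).le
    rw [hq]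
    refine mul_le_mul h3 (mul_le_mul_of_nonneg_left ?_ (sq_nonneg _)) (by positivity)
      (by positivity)
    linarith
  have hb : ∀ ξ, ‖driftErr g G J δ K m w (S, ξ)‖ ^ 2
      ≤ ∑ i ∈ S, ∑ k ∈ Finset.range K, (m : ℝ)⁻¹ * (K : ℝ)⁻¹ * Λ * F i k ξ := by
    intro ξ
    refine (norm_mean_sq_le S hS _).trans ?_
    rw [Finset.mul_sum]
    refine Finset.sum_le_sum fun i _ => ?_
    simp only [mul_assoc]
    rw [← Finset.mul_sum]
    refine mul_le_mul_of_nonneg_left ?_ (by positivity)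
    refine (norm_mean_sq_le (Finset.range K) (Finset.card_range K) _).trans ?_
    rw [← Finset.mul_sum]
    refine mul_le_mul_of_nonneg_left ?_ (by positivity)
    exact Finset.sum_le_sum fun k _ => (ho i).lipschitz _ _
  calc _ ≤ ∫⁻ ξ, ∑ i ∈ S, ∑ k ∈ Finset.range K, ENNReal.ofReal ((m : ℝ)⁻¹ * (K : ℝ)⁻¹ * Λ)
          * ENNReal.ofReal (F i k ξ) ∂(Measure.pi fun i => Measure.infinitePi fun _ : ℕ => D i) := by
        refine lintegral_mono fun ξ => (ENNReal.ofReal_le_ofReal (hb ξ)).trans_eq ?_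
        rw [ENNReal.ofReal_sum_of_nonneg fun i _ => Finset.sum_nonneg fun k _ => by positivity]
        refine Finset.sum_congr rfl fun i _ => ?_
        rw [ENNReal.ofReal_sum_of_nonneg fun k _ => by positivity]
        exact Finset.sum_congr rfl fun k _ => ENNReal.ofReal_mul (by positivity)
    _ = ∑ i ∈ S, ∑ k ∈ Finset.range K, ENNReal.ofReal ((m : ℝ)⁻¹ * (K : ℝ)⁻¹ * Λ)
          * ∫⁻ ξ, ENNReal.ofReal (F i k ξ)
            ∂(Measure.pi fun i => Measure.infinitePi fun _ : ℕ => D i) := by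
        rw [lintegral_finsetSum _ fun i _ => Finset.measurable_sum _ fun k _ =>
          ((hFm i k).ennreal_ofReal.const_mul _)]
        refine Finset.sum_congr rfl fun i _ => ?_
        rw [lintegral_finsetSum _ fun k _ => ((hFm i k).ennreal_ofReal.const_mul _)]
        exact Finset.sum_congr rfl fun k _ => lintegral_const_mul _ (hFm i k).ennreal_ofReal
    _ ≤ ∑ i ∈ S, ∑ k ∈ Finset.range K, ENNReal.ofReal ((m : ℝ)⁻¹ * (K : ℝ)⁻¹ * Λ)
          * ENNReal.ofReal q := by
        refine Finset.sum_le_sum fun i _ => Finset.sum_le_sum fun k hk => ?_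
        gcongr
        exact hlin i k hk
    _ = ENNReal.ofReal (m * (K * ((m : ℝ)⁻¹ * (K : ℝ)⁻¹ * Λ * q))) := by
        rw [Finset.sum_const, Finset.sum_const, hS, Finset.card_range, nsmul_eq_mul, nsmul_eq_mul,
          ← ENNReal.ofReal_mul (by positivity), ← ENNReal.ofReal_natCast, ← ENNReal.ofReal_natCast,
          ← ENNReal.ofReal_mul (by positivity), ← ENNReal.ofReal_mul (by positivity)]
    _ = _ := by
        congr 1; rw [hq]; field_simp

theorem sum_sub_meanGrad (hM : 1 ≤ M) (w : H) : ∑ i, (G i w - meanGrad G w) = 0 := by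
  have hM0 : (M : ℝ) ≠ 0 := by positivity
  unfold meanGrad
  rw [Finset.sum_sub_distrib, Finset.sum_const, Finset.card_univ, Fintype.card_fin,
    ← Nat.cast_smul_eq_nsmul ℝ, smul_inv_smul₀ hM0, sub_self]

theorem integral_sampErr_sq {m : ℕ} (hm : 1 ≤ m) (hmM : m ≤ M) (w : H)
    (hsG : ∀ i, ‖G i w - meanGrad G w‖ ^ 2 ≤ sG ^ 2) :
    ∫ S, ‖sampErr G m w S‖ ^ 2 ∂(subsetLaw M m) ≤ sampVar M m sG := by
  have := isProbabilityMeasure_subsetLaw hmM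
  have h0 := sum_sub_meanGrad (G := G) (hm.trans hmM) w
  have h1 := integral_subsetLaw_norm_sq_le hm hmM h0 hsG
  unfold sampVar
  split_ifs with h
  -- Under full participation the deviations from the mean cancel exactly; for sG = 0 they all
  -- vanish.
  · rcases h with rfl | h
    · refine le_of_eq ?_
      rw [integral_eq_zero_of_ae]
      filter_upwards [ae_card_subsetLaw m m] with S hS
      have : S = Finset.univ := by rw [← Finset.card_eq_iff_eq_univ, hS, Fintype.card_fin]
      simp [sampErr, this, h0]
    · rw [h] at h1
      simpa [sampErr] using h1
  · exact h1

/-- The bias and the variance of the averaged local gradients of a round. -/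
theorem roundErr_bounds (ho : ∀ i, Oracle (D i) (g i) (G i) σ Λ) (hΛ : 0 ≤ Λ)
    (hJ : Measurable J) (hJn : ∀ v, ‖J v‖ = ‖v‖) {δ : ℝ} (hδ : 8 * δ ^ 2 * Λ ≤ 1)
    {K m : ℕ} (hK : 1 ≤ K) (hm : 1 ≤ m) (hmM : m ≤ M) (w : H)
    (hsG : ∀ i, ‖G i w - meanGrad G w‖ ^ 2 ≤ sG ^ 2) {B : ℝ}
    (hB : Λ * 3 ^ K * δ ^ 2 * (2 * σ ^ 2 + 8 * sG ^ 2 + 8 * ‖meanGrad G w‖ ^ 2) ≤ B) :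
    Integrable (roundErr g G J δ K m w) (roundLaw m D) ∧
    Integrable (fun θ => ‖roundErr g G J δ K m w θ‖ ^ 2) (roundLaw m D) ∧
    ‖∫ θ, roundErr g G J δ K m w θ ∂(roundLaw m D)‖ ^ 2 ≤ B ∧
    ∫ θ, ‖roundErr g G J δ K m w θ‖ ^ 2 ∂(roundLaw m D)
      ≤ 3 * (σ ^ 2 / (m * K) + sampVar M m sG) + 3 * B := by
  have := isProbabilityMeasure_subsetLaw hmM
  have : CompleteSpace H := FiniteDimensional.complete ℝ H
  have hB0 : 0 ≤ B := le_trans (by positivity) hB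
  have mn := measurable_noiseErr ho hJ δ K m w
  have md := measurable_driftErr ho hJ δ K m w
  have ms : Measurable fun θ : RoundDraw Ξ => sampErr G m w θ.1 :=
    (measurable_sampErr G m w).comp measurable_fst
  have ln := lintegral_noiseErr ho hJ δ hK hm hmM w
  have ld := (lintegral_driftErr ho hΛ hJ hJn hδ hK hm hmM w hsG).trans
    (ENNReal.ofReal_le_ofReal hB)
  have in2 := integrable_sq_of_lintegral_lt_top mn.aestronglyMeasurable
    (ln.trans_lt ENNReal.ofReal_lt_top)
  have id2 := integrable_sq_of_lintegral_lt_top md.aestronglyMeasurable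
    (ld.trans_lt ENNReal.ofReal_lt_top)
  have bn := integral_sq_le_of_lintegral_le mn.aestronglyMeasurable (by positivity) ln
  have bd := integral_sq_le_of_lintegral_le md.aestronglyMeasurable hB0 ld
  have is2 : Integrable (fun θ : RoundDraw Ξ => ‖sampErr G m w θ.1‖ ^ 2) (roundLaw m D) :=
    (Integrable.of_finite (f := fun S => ‖sampErr G m w S‖ ^ 2) (μ := subsetLaw M m)).comp_fst _
  have bs : ∫ θ, ‖sampErr G m w θ.1‖ ^ 2 ∂(roundLaw m D) ≤ sampVar M m sG := by
    refine le_trans (le_of_eq ?_) (integral_sampErr_sq hm hmM w hsG)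
    have := integral_fun_fst (μ := subsetLaw M m)
      (ν := Measure.pi fun i => Measure.infinitePi fun _ : ℕ => D i)
      (fun S => ‖sampErr G m w S‖ ^ 2)
    simpa using this
  have i1n := integrable_of_integrable_sq mn.aestronglyMeasurable in2
  have i1d := integrable_of_integrable_sq md.aestronglyMeasurable id2
  have i1s : Integrable (fun θ : RoundDraw Ξ => sampErr G m w θ.1) (roundLaw m D) :=
    integrable_of_integrable_sq ms.aestronglyMeasurable is2
  have i1nd : Integrable (fun θ => noiseErr g G J δ K m w θ + driftErr g G J δ K m w θ)
      (roundLaw m D) := i1n.add i1d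
  have hi : Integrable (roundErr g G J δ K m w) (roundLaw m D) := i1nd.add i1s
  have hbound : ∀ θ, ‖roundErr g G J δ K m w θ‖ ^ 2 ≤ 3 * (‖noiseErr g G J δ K m w θ‖ ^ 2
      + ‖driftErr g G J δ K m w θ‖ ^ 2 + ‖sampErr G m w θ.1‖ ^ 2) := by
    intro θ
    have h1 := norm_add₃_le (a := noiseErr g G J δ K m w θ) (b := driftErr g G J δ K m w θ)
      (c := sampErr G m w θ.1)
    have h2 := pow_le_pow_left₀ (norm_nonneg _) h1 2
    refine h2.trans ?_
    nlinarith [sq_nonneg (‖noiseErr g G J δ K m w θ‖ - ‖driftErr g G J δ K m w θ‖),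
      sq_nonneg (‖noiseErr g G J δ K m w θ‖ - ‖sampErr G m w θ.1‖),
      sq_nonneg (‖driftErr g G J δ K m w θ‖ - ‖sampErr G m w θ.1‖)]
  have ind2 : Integrable (fun θ => ‖noiseErr g G J δ K m w θ‖ ^ 2
      + ‖driftErr g G J δ K m w θ‖ ^ 2) (roundLaw m D) := in2.add id2
  have inds2 : Integrable (fun θ => ‖noiseErr g G J δ K m w θ‖ ^ 2
      + ‖driftErr g G J δ K m w θ‖ ^ 2 + ‖sampErr G m w θ.1‖ ^ 2) (roundLaw m D) := ind2.add is2
  have hsum := inds2.const_mul 3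
  have hi2 : Integrable (fun θ => ‖roundErr g G J δ K m w θ‖ ^ 2) (roundLaw m D) := by
    refine hsum.mono' (hi.aestronglyMeasurable.norm.pow 2)
      (Filter.Eventually.of_forall fun θ => ?_)
    rw [Real.norm_of_nonneg (by positivity)]
    exact hbound θ
  refine ⟨hi, hi2, ?_, ?_⟩
  -- Noise and sampling error are centered, so the bias is that of the drift alone.
  · have e : ∫ θ, roundErr g G J δ K m w θ ∂(roundLaw m D)
        = ∫ θ, driftErr g G J δ K m w θ ∂(roundLaw m D) := by
      have hs0 : ∫ θ, sampErr G m w θ.1 ∂(roundLaw m D) = 0 := by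
        have h1 := integral_fun_fst (μ := subsetLaw M m)
          (ν := Measure.pi fun i => Measure.infinitePi fun _ : ℕ => D i) (sampErr G m w)
        have h2 := integral_subsetLaw_mean hm (sum_sub_meanGrad (G := G) (hm.trans hmM) w)
        rw [h1, show ∫ S, sampErr G m w S ∂(subsetLaw M m) = 0 from h2, smul_zero]
      unfold roundErr
      rw [integral_add i1nd i1s, integral_add i1n i1d, hs0,
        integral_noiseErr ho hJ δ hmM w i1n, zero_add, add_zero]
    rw [e]
    exact (norm_integral_sq_le md.aestronglyMeasurable id2).trans bd
  · refine (integral_mono hi2 hsum hbound).trans ?_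
    rw [integral_const_mul, integral_add ind2 is2, integral_add in2 id2]
    linarith

end Round

/-! ### Gradients of the sample losses and of the objectives. -/

theorem measurable_gradient_param {X F : Type*} [MeasurableSpace X] [NormedAddCommGroup F]
    [InnerProductSpace ℝ F] [FiniteDimensional ℝ F] [CompleteSpace F] [MeasurableSpace F]
    [BorelSpace F] [SecondCountableTopology F] {f : X → F → ℝ}
    (hf : Measurable fun q : F × X => f q.2 q.1)
    (hd : ∀ x, Differentiable ℝ (f x)) : Measurable fun q : F × X => gradient (f q.2) q.1 := by
  set b := stdOrthonormalBasis ℝ F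
  have e : (fun q : F × X => gradient (f q.2) q.1)
      = fun q => ∑ j, (inner ℝ (b j) (gradient (f q.2) q.1)) • b j := by
    funext q; exact (b.sum_repr' _).symm
  rw [e]
  refine Finset.measurable_sum _ fun j _ => Measurable.smul_const ?_ _
  -- The coordinates of the gradient are limits of difference quotients with increment 1/n, which
  -- are jointly measurable in the point and the parameter.
  have hlim : ∀ q : F × X, Filter.Tendsto (fun n : ℕ => (n : ℝ) •
      (f q.2 (q.1 + (n : ℝ)⁻¹ • b j) - f q.2 q.1)) Filter.atTop
      (nhds (inner ℝ (b j) (gradient (f q.2) q.1))) := by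
    intro q
    have h1 := (hd q.2 q.1).hasGradientAt.hasFDerivAt.lim (b j) (c := fun n : ℕ => (n : ℝ))
      (l := Filter.atTop) (by simpa using tendsto_natCast_atTop_atTop)
    simpa [real_inner_comm] using h1
  refine measurable_of_tendsto_metrizable (fun n => ?_) (tendsto_pi_nhds.2 hlim)
  have h1 : Measurable fun q : F × X => f q.2 (q.1 + (n : ℝ)⁻¹ • b j) :=
    hf.comp ((measurable_fst.add_const _).prodMk measurable_snd)
  simp only [smul_eq_mul]
  exact (h1.sub hf).const_mul _

theorem hasGradientAt_const_mul_sum {ι F : Type*} [NormedAddCommGroup F] [InnerProductSpace ℝ F]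
    [CompleteSpace F] {s : Finset ι} {f : ι → F → ℝ} {g : ι → F} {w : F}
    (h : ∀ i ∈ s, HasGradientAt (f i) (g i) w) (c : ℝ) :
    HasGradientAt (fun w => c * ∑ i ∈ s, f i w) (c • ∑ i ∈ s, g i) w := by
  rw [hasGradientAt_iff_hasFDerivAt]
  refine ((HasFDerivAt.fun_sum fun i hi => (h i hi).hasFDerivAt).const_mul c).congr_fderiv ?_
  rw [map_smulₛₗ, map_sum]
  rfl

section

variable {d₁ d₂ M : ℕ} {Ξ : Fin M → Type u} [∀ i, MeasurableSpace (Ξ i)]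

/-- The embedding of the first decision space into the product. -/
def inX (v : E d₁) : W d₁ d₂ := WithLp.toLp 2 (v, 0)

theorem inX_sub (v w : E d₁) : (inX (v - w) : W d₁ d₂) = inX v - inX w :=
  WithLp.ofLp_injective 2 (Prod.ext rfl (sub_zero 0).symm)

theorem measurable_inX : Measurable (inX : E d₁ → W d₁ d₂) :=
  (WithLp.measurable_toLp 2 _).comp (measurable_id.prodMk measurable_const)

theorem measurable_fst_W : Measurable fun w : W d₁ d₂ => w.fst :=
  measurable_fst.comp (WithLp.measurable_ofLp 2 _)

theorem measurable_snd_W : Measurable fun w : W d₁ d₂ => w.snd :=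
  measurable_snd.comp (WithLp.measurable_ofLp 2 _)

/-- Adding `l ‖x - c‖²` shifts the `x`-gradient. -/
theorem grad_add_sq {f : E d₁ → E d₂ → ℝ} (hf : Differentiable ℝ fun w : W d₁ d₂ => f w.fst w.snd)
    (l : ℝ) (c : E d₁) :
    (Differentiable ℝ fun w : W d₁ d₂ => f w.fst w.snd + l * ‖w.fst - c‖ ^ 2) ∧
    ∀ x y, grad (fun x y => f x y + l * ‖x - c‖ ^ 2) x y
      = grad f x y + inX ((2 * l) • (x - c)) := by
  have hg : ∀ w : W d₁ d₂, HasGradientAt (fun w : W d₁ d₂ => f w.fst w.snd + l * ‖w.fst - c‖ ^ 2)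
      (gradient (fun w : W d₁ d₂ => f w.fst w.snd) w
        + inX ((2 * l) • (w.fst - c))) w := by
    intro w
    have h1 := (hf w).hasGradientAt.hasFDerivAt
    have h2 : HasFDerivAt (fun w : W d₁ d₂ => w.fst - c) (WithLp.fstL 2 ℝ (E d₁) (E d₂)) w :=
      (WithLp.fstL 2 ℝ (E d₁) (E d₂)).hasFDerivAt.sub_const c
    have h3 := (h2.norm_sq).const_mul l
    rw [hasGradientAt_iff_hasFDerivAt]
    refine (h1.add h3).congr_fderiv ?_
    ext v
    unfold inX
    simp [WithLp.prod_inner_apply, inner_sub_left, inner_smul_left]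
    ring
  exact ⟨fun w => (hg w).differentiableAt, fun x y => (hg _).gradient⟩

/-- The gradient of the loss of client `i` on a data point. -/
def sgrad (loss : ∀ i, E d₁ → E d₂ → Ξ i → ℝ) (i : Fin M) (w : W d₁ d₂) (ξ : Ξ i) : W d₁ d₂ :=
  grad (fun x' y' => loss i x' y' ξ) w.fst w.snd

/-- The gradient of the local objective of client `i`. -/
def cgrad (D : ∀ i, Measure (Ξ i)) (loss : ∀ i, E d₁ → E d₂ → Ξ i → ℝ) (i : Fin M)
    (w : W d₁ d₂) : W d₁ d₂ := grad (clientObj D loss i) w.fst w.snd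

/-- The stochastic gradients of all clients, with the relation to the global objective. -/
structure FedOracle (L σ σG : ℝ) (D : ∀ i, Measure (Ξ i)) (loss : ∀ i, E d₁ → E d₂ → Ξ i → ℝ)
    (F : E d₁ → E d₂ → ℝ) : Prop where
  oracle : ∀ i, Oracle (D i) (sgrad loss i) (cgrad D loss i) σ (2 * L ^ 2)
  mean : ∀ w, meanGrad (cgrad D loss) w = grad F w.fst w.snd
  heterogeneity : ∀ i w, ‖cgrad D loss i w - grad F w.fst w.snd‖ ^ 2 ≤ σG ^ 2

theorem sq_lipschitz_of_lipschitz {L : ℝ} {g : E d₁ → E d₂ → W d₁ d₂}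
    (hg : ∀ x₁ y₁ x₂ y₂, ‖g x₁ y₁ - g x₂ y₂‖ ≤ L * (‖x₁ - x₂‖ + ‖y₁ - y₂‖)) (w w' : W d₁ d₂) :
    ‖g w.fst w.snd - g w'.fst w'.snd‖ ^ 2 ≤ 2 * L ^ 2 * ‖w - w'‖ ^ 2 := by
  have h1 := pow_le_pow_left₀ (norm_nonneg _) (hg w.fst w.snd w'.fst w'.snd) 2
  have h2 : ‖w - w'‖ ^ 2 = ‖w.fst - w'.fst‖ ^ 2 + ‖w.snd - w'.snd‖ ^ 2 :=
    WithLp.prod_norm_sq_eq_of_L2 (w - w')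
  rw [h2]
  refine h1.trans ?_
  rw [mul_pow]
  have := sq_nonneg (‖w.fst - w'.fst‖ - ‖w.snd - w'.snd‖)
  nlinarith [mul_nonneg (sq_nonneg L) this]

namespace NCPL

variable {l μ σ σG : ℝ} {D : ∀ i, Measure (Ξ i)} [∀ i, IsProbabilityMeasure (D i)]
  {loss : ∀ i, E d₁ → E d₂ → Ξ i → ℝ}

theorem measurable_sgrad (h : NCPL l μ σ σG D loss) (i : Fin M) :
    Measurable fun q : W d₁ d₂ × Ξ i => sgrad loss i q.1 q.2 := by
  have h1 : Measurable fun q : W d₁ d₂ × Ξ i => loss i q.1.fst q.1.snd q.2 := by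
    have h2 : Measurable fun q : W d₁ d₂ × Ξ i => ((q.1.fst, q.1.snd), q.2) :=
      ((measurable_fst_W.comp measurable_fst).prodMk
        (measurable_snd_W.comp measurable_fst)).prodMk measurable_snd
    exact (h.loss_measurable i).comp h2
  exact measurable_gradient_param (f := fun ξ (w : W d₁ d₂) => loss i w.fst w.snd ξ) h1
    (h.loss_differentiable i)

theorem measurable_cgrad (h : NCPL l μ σ σG D loss) (i : Fin M) :
    Measurable (cgrad D loss i) := by
  have : LipschitzWith (Real.toNNReal (2 * |l|)) (cgrad D loss i) := by
    refine LipschitzWith.of_dist_le_mul fun w w' => ?_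
    rw [dist_eq_norm, dist_eq_norm, Real.coe_toNNReal _ (by positivity)]
    refine (h.client_smooth i _ _ _ _).trans ?_
    have h1 := norm_fst_le (w - w')
    have h2 := norm_snd_le (w - w')
    rw [WithLp.sub_fst] at h1
    rw [WithLp.sub_snd] at h2
    have h3 := mul_le_mul_of_nonneg_right (le_abs_self l)
      (by positivity : 0 ≤ ‖w.fst - w'.fst‖ + ‖w.snd - w'.snd‖)
    have h4 := mul_le_mul_of_nonneg_left (add_le_add h1 h2) (abs_nonneg l)
    linarith
  exact this.continuous.measurable

theorem obj_differentiable (h : NCPL l μ σ σG D loss) :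
    (Differentiable ℝ fun w : W d₁ d₂ => obj D loss w.fst w.snd) ∧
    ∀ w : W d₁ d₂, grad (obj D loss) w.fst w.snd = meanGrad (cgrad D loss) w := by
  have hg : ∀ w : W d₁ d₂, HasGradientAt (fun w : W d₁ d₂ => obj D loss w.fst w.snd)
      (meanGrad (cgrad D loss) w) w := fun w =>
    hasGradientAt_const_mul_sum (fun i _ => (h.client_differentiable i w).hasGradientAt) _
  exact ⟨fun w => (hg w).differentiableAt, fun w => (hg w).gradient⟩

theorem fedOracle (h : NCPL l μ σ σG D loss) : FedOracle l σ σG D loss (obj D loss) where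
  oracle i :=
    { measurable := h.measurable_sgrad i
      measurable_mean := h.measurable_cgrad i
      integrable := fun w => h.sgrad_integrable i w.fst w.snd
      mean := fun w => h.sgrad_unbiased i w.fst w.snd
      sq_integrable := fun w => h.sgrad_sq_integrable i w.fst w.snd
      variance := fun w => h.sgrad_variance i w.fst w.snd
      lipschitz := sq_lipschitz_of_lipschitz (h.client_smooth i) }
  mean w := (h.obj_differentiable.2 w).symm
  heterogeneity i w := h.heterogeneity i w.fst w.snd

theorem smoothPL (h : NCPL l μ σ σG D loss) (hM : 1 ≤ M) (hl : 0 < l) (hμ : 0 < μ) :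
    SmoothPL l μ (obj D loss) where
  differentiable := h.obj_differentiable.1
  lipschitz x₁ y₁ x₂ y₂ := by
    have hM0 : (0 : ℝ) < M := by exact_mod_cast hM
    have e1 := h.obj_differentiable.2 (WithLp.toLp 2 (x₁, y₁))
    have e2 := h.obj_differentiable.2 (WithLp.toLp 2 (x₂, y₂))
    have e3 : grad (obj D loss) x₁ y₁ - grad (obj D loss) x₂ y₂ = (M : ℝ)⁻¹ •
        ∑ i, (grad (clientObj D loss i) x₁ y₁ - grad (clientObj D loss i) x₂ y₂) := by
      rw [Finset.sum_sub_distrib, smul_sub]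
      exact congrArg₂ _ e1 e2
    rw [e3, norm_smul, norm_inv, Real.norm_of_nonneg hM0.le]
    have h1 : ‖∑ i, (grad (clientObj D loss i) x₁ y₁ - grad (clientObj D loss i) x₂ y₂)‖
        ≤ M * (l * (‖x₁ - x₂‖ + ‖y₁ - y₂‖)) := by
      refine (norm_sum_le_of_le _ fun i _ => h.client_smooth i x₁ y₁ x₂ y₂).trans_eq ?_
      simp
    calc _ ≤ (M : ℝ)⁻¹ * (M * (l * (‖x₁ - x₂‖ + ‖y₁ - y₂‖))) := by gcongr
      _ = _ := by field_simp
  l_pos := hl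
  μ_pos := hμ
  primal_bddBelow := h.primal_bddBelow
  max_attained := h.max_attained
  pl := h.pl

theorem clientObj_proxLoss (h : NCPL l μ σ σG D loss) (c : E d₁) (i : Fin M) (x : E d₁)
    (y : E d₂) : clientObj D (proxLoss l loss c) i x y
      = clientObj D loss i x y + l * ‖x - c‖ ^ 2 := by
  unfold clientObj proxLoss
  rw [integral_add (h.loss_integrable i x y) (integrable_const _)]
  simp

theorem sgrad_proxLoss (h : NCPL l μ σ σG D loss) (c : E d₁) (i : Fin M) (w : W d₁ d₂)
    (ξ : Ξ i) : sgrad (proxLoss l loss c) i w ξ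
      = sgrad loss i w ξ + inX ((2 * l) • (w.fst - c)) :=
  (grad_add_sq (h.loss_differentiable i ξ) l c).2 w.fst w.snd

theorem cgrad_proxLoss (h : NCPL l μ σ σG D loss) (c : E d₁) (i : Fin M) (w : W d₁ d₂) :
    cgrad D (proxLoss l loss c) i w
      = cgrad D loss i w + inX ((2 * l) • (w.fst - c)) := by
  have : clientObj D (proxLoss l loss c) i = fun x y => clientObj D loss i x y
      + l * ‖x - c‖ ^ 2 := by
    funext x y; exact h.clientObj_proxLoss c i x y
  unfold cgrad
  rw [this]
  exact (grad_add_sq (h.client_differentiable i) l c).2 w.fst w.snd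

theorem grad_reg (h : NCPL l μ σ σG D loss) (c : E d₁) (x : E d₁) (y : E d₂) :
    grad (reg l (obj D loss) c) x y
      = grad (obj D loss) x y + inX ((2 * l) • (x - c)) :=
  (grad_add_sq h.obj_differentiable.1 l c).2 x y

theorem measurable_sgrad_proxLoss (h : NCPL l μ σ σG D loss) (i : Fin M) :
    Measurable fun q : E d₁ × W d₁ d₂ × Ξ i => sgrad (proxLoss l loss q.1) i q.2.1 q.2.2 := by
  simp only [h.sgrad_proxLoss]
  refine ((h.measurable_sgrad i).comp measurable_snd).add ?_
  have h1 : Measurable fun q : E d₁ × W d₁ d₂ × Ξ i => q.2.1.fst :=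
    measurable_fst_W.comp (measurable_fst.comp measurable_snd)
  exact measurable_inX.comp ((h1.sub measurable_fst).const_smul (2 * l))

/-- The penalty adds the same deterministic vector to stochastic, client and global gradients, so
bias, variance and heterogeneity are untouched; the Lipschitz constant grows by 2l. -/
theorem fedOracle_proxLoss (h : NCPL l μ σ σG D loss) (hM : 1 ≤ M) (hl : 0 < l) (c : E d₁) :
    FedOracle (3 * l) σ σG D (proxLoss l loss c) (reg l (obj D loss) c) where
  oracle i :=
    { measurable := (h.measurable_sgrad_proxLoss i).comp (measurable_prodMk_left (x := c))
      measurable_mean := by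
        have e : cgrad D (proxLoss l loss c) i = fun w => cgrad D loss i w
            + inX ((2 * l) • (w.fst - c)) := funext (h.cgrad_proxLoss c i)
        rw [e]
        refine (h.measurable_cgrad i).add ?_
        exact measurable_inX.comp ((measurable_fst_W.sub_const c).const_smul (2 * l))
      integrable := fun w => by
        have e : sgrad (proxLoss l loss c) i w = fun ξ => sgrad loss i w ξ
            + inX ((2 * l) • (w.fst - c)) := funext (h.sgrad_proxLoss c i w)
        rw [e]
        exact (h.sgrad_integrable i w.fst w.snd).add (integrable_const _)
      mean := fun w => by
        have e : sgrad (proxLoss l loss c) i w = fun ξ => sgrad loss i w ξ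
            + inX ((2 * l) • (w.fst - c)) := funext (h.sgrad_proxLoss c i w)
        have h1 : ∫ ξ, sgrad loss i w ξ ∂(D i) = cgrad D loss i w :=
          h.sgrad_unbiased i w.fst w.snd
        have h2 : Integrable (sgrad loss i w) (D i) := h.sgrad_integrable i w.fst w.snd
        rw [h.cgrad_proxLoss, e, integral_add h2 (integrable_const _), h1]
        simp
      sq_integrable := fun w => by
        simp only [h.sgrad_proxLoss, h.cgrad_proxLoss, add_sub_add_right_eq_sub]
        exact h.sgrad_sq_integrable i w.fst w.snd
      variance := fun w => by
        simp only [h.sgrad_proxLoss, h.cgrad_proxLoss, add_sub_add_right_eq_sub]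
        exact h.sgrad_variance i w.fst w.snd
      lipschitz := by
        refine sq_lipschitz_of_lipschitz (g := grad (clientObj D (proxLoss l loss c) i))
          fun x₁ y₁ x₂ y₂ => ?_
        have e1 := h.cgrad_proxLoss c i (WithLp.toLp 2 (x₁, y₁))
        have e2 := h.cgrad_proxLoss c i (WithLp.toLp 2 (x₂, y₂))
        have e3 : grad (clientObj D (proxLoss l loss c) i) x₁ y₁
            - grad (clientObj D (proxLoss l loss c) i) x₂ y₂
            = (grad (clientObj D loss i) x₁ y₁ - grad (clientObj D loss i) x₂ y₂)
              + (inX ((2 * l) • (x₁ - x₂)) : W d₁ d₂) := by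
          refine (congrArg₂ (· - ·) e1 e2).trans ?_
          have e5 : (inX ((2 * l) • (x₁ - x₂)) : W d₁ d₂)
              = inX ((2 * l) • (x₁ - c)) - inX ((2 * l) • (x₂ - c)) := by
            rw [← inX_sub, ← smul_sub, sub_sub_sub_cancel_right]
          rw [e5]
          exact add_sub_add_comm _ _ _ _
        rw [e3]
        refine (norm_add_le _ _).trans ?_
        have n1 := h.client_smooth i x₁ y₁ x₂ y₂
        have n2 := norm_W_le (inX ((2 * l) • (x₁ - x₂)) : W d₁ d₂)
        have n3 : ‖(2 * l) • (x₁ - x₂)‖ = 2 * l * ‖x₁ - x₂‖ := by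
          rw [norm_smul, Real.norm_of_nonneg (by positivity)]
        change _ ≤ ‖(2 * l) • (x₁ - x₂)‖ + ‖(0 : E d₂)‖ at n2
        rw [n3, norm_zero, add_zero] at n2
        nlinarith [norm_nonneg (y₁ - y₂), mul_nonneg hl.le (norm_nonneg (y₁ - y₂))] }
  mean w := by
    have hM0 : (M : ℝ) ≠ 0 := by positivity
    refine Eq.trans ?_ (h.grad_reg c w.fst w.snd).symm
    rw [h.obj_differentiable.2 w]
    unfold meanGrad
    simp only [h.cgrad_proxLoss]
    rw [Finset.sum_add_distrib, smul_add, Finset.sum_const, Finset.card_univ, Fintype.card_fin,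
      ← Nat.cast_smul_eq_nsmul ℝ, inv_smul_smul₀ hM0]
  heterogeneity i w := by
    rw [h.cgrad_proxLoss, h.grad_reg, add_sub_add_right_eq_sub]
    exact h.heterogeneity i w.fst w.snd

end NCPL

end

/-! ### A round as a perturbed descent-ascent step. -/

section

variable {d₁ d₂ M : ℕ} {Ξ : Fin M → Type u}

/-- The direction of a descent-ascent step. -/
def flipX (w : W d₁ d₂) : W d₁ d₂ := WithLp.toLp 2 (-w.fst, w.snd)

theorem norm_flipX (w : W d₁ d₂) : ‖flipX w‖ = ‖w‖ := by
  have h1 : ‖flipX w‖ ^ 2 = ‖-w.fst‖ ^ 2 + ‖w.snd‖ ^ 2 := WithLp.prod_norm_sq_eq_of_L2 (flipX w)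
  have h2 := WithLp.prod_norm_sq_eq_of_L2 w
  rw [norm_neg, ← h2] at h1
  exact (pow_left_inj₀ (norm_nonneg _) (norm_nonneg _) two_ne_zero).1 h1

theorem measurable_flipX : Measurable (flipX : W d₁ d₂ → W d₁ d₂) :=
  (WithLp.measurable_toLp 2 _).comp (measurable_fst_W.neg.prodMk measurable_snd_W)

theorem fst_sum {ι : Type*} (s : Finset ι) (v : ι → W d₁ d₂) :
    (∑ i ∈ s, v i).fst = ∑ i ∈ s, (v i).fst :=
  map_sum (WithLp.fstL 2 ℝ (E d₁) (E d₂)) v s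

theorem snd_sum {ι : Type*} (s : Finset ι) (v : ι → W d₁ d₂) :
    (∑ i ∈ s, v i).snd = ∑ i ∈ s, (v i).snd :=
  map_sum (WithLp.sndL 2 ℝ (E d₁) (E d₂)) v s

/-- With equal local step sizes in x and y, a local step is a single move along the isometry `flipX`
of the stochastic gradient; different steps in x and y are left to the server. -/
theorem localRun_eq_iter (a : Params) (hxy : a.ηyl = a.ηxl) (loss : ∀ i, E d₁ → E d₂ → Ξ i → ℝ)
    (G : Fin M → W d₁ d₂ → W d₁ d₂) (i : Fin M) (ξ : ℕ → Ξ i) (x : E d₁) (y : E d₂) (k : ℕ) :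
    (iter (noiseStep (sgrad loss i) (G i) flipX a.ηxl) (WithLp.toLp 2 (x, y), 0) ξ k).1
      = WithLp.toLp 2 ((localRun a (loss i) ξ x y k).x, (localRun a (loss i) ξ x y k).y) := by
  induction k with
  | zero => rfl
  | succ k ih =>
    change (iter (noiseStep (sgrad loss i) (G i) flipX a.ηxl) (WithLp.toLp 2 (x, y), 0) ξ k).1
      + a.ηxl • flipX (sgrad loss i
        (iter (noiseStep (sgrad loss i) (G i) flipX a.ηxl) (WithLp.toLp 2 (x, y), 0) ξ k).1 (ξ k))
      = _
    rw [ih]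
    refine WithLp.ofLp_injective 2 (Prod.ext ?_ ?_)
    · change (localRun a (loss i) ξ x y k).x + a.ηxl • -(gradX (fun x' y' => loss i x' y' (ξ k))
        (localRun a (loss i) ξ x y k).x (localRun a (loss i) ξ x y k).y) = _
      rw [smul_neg, ← sub_eq_add_neg]; rfl
    · change (localRun a (loss i) ξ x y k).y + a.ηxl • (gradY (fun x' y' => loss i x' y' (ξ k))
        (localRun a (loss i) ξ x y k).x (localRun a (loss i) ξ x y k).y) = _
      rw [← hxy]; rfl

theorem localRun_samples (a : Params) {Ω : Type u} (loss : E d₁ → E d₂ → Ω → ℝ)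
    (ξ : ℕ → Ω) (x : E d₁) (y : E d₂) (k : ℕ) : (localRun a loss ξ x y k).samples = k := by
  induction k with
  | zero => rfl
  | succ k ih => simp [localRun, localStep, ih]

theorem localRun_x (a : Params) (hxy : a.ηyl = a.ηxl) (loss : ∀ i, E d₁ → E d₂ → Ξ i → ℝ)
    (G : Fin M → W d₁ d₂ → W d₁ d₂) (i : Fin M) (ξ : ℕ → Ξ i) (x : E d₁) (y : E d₂) (k : ℕ) :
    (localRun a (loss i) ξ x y k).x = x - a.ηxl • (∑ j ∈ Finset.range k, sgrad loss i
      (iter (noiseStep (sgrad loss i) (G i) flipX a.ηxl) (WithLp.toLp 2 (x, y), 0) ξ j).1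
        (ξ j)).fst ∧
    (localRun a (loss i) ξ x y k).y = y + a.ηxl • (∑ j ∈ Finset.range k, sgrad loss i
      (iter (noiseStep (sgrad loss i) (G i) flipX a.ηxl) (WithLp.toLp 2 (x, y), 0) ξ j).1
        (ξ j)).snd := by
  induction k with
  | zero => simp [localRun]
  | succ k ih =>
    rw [Finset.sum_range_succ, WithLp.add_fst, WithLp.add_snd, smul_add, smul_add,
      localRun_eq_iter a hxy]
    constructor
    · rw [← sub_sub, ← ih.1]; rfl
    · rw [← add_assoc, ← ih.2, ← hxy]; rfl

/-- The update of one round in terms of the gradient of the global objective and an error. -/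
theorem round_eq {L σ σG : ℝ} [∀ i, MeasurableSpace (Ξ i)] {D : ∀ i, Measure (Ξ i)}
    {loss : ∀ i, E d₁ → E d₂ → Ξ i → ℝ} {F : E d₁ → E d₂ → ℝ}
    (hF : FedOracle L σ σG D loss F) (p : ℝ) {m : ℕ} (hm : 1 ≤ m) {a : Params} (hK : 1 ≤ a.K)
    (hxy : a.ηyl = a.ηxl) {θ : RoundDraw Ξ} (hθ : θ.1.card = m) (s : ServerState d₁ d₂ M) :
    (round p m a loss θ s).x = s.x - (a.ηxl * a.ηxg * a.K) • (gradX F s.x s.y + p • (s.x - s.z)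
      + (roundErr (sgrad loss) (cgrad D loss) flipX a.ηxl a.K m
        (WithLp.toLp 2 (s.x, s.y)) θ).fst) ∧
    (round p m a loss θ s).y = s.y + (a.ηxl * a.ηyg * a.K) • (gradY F s.x s.y
      + (roundErr (sgrad loss) (cgrad D loss) flipX a.ηxl a.K m
        (WithLp.toLp 2 (s.x, s.y)) θ).snd) := by
  have hm0 : (m : ℝ) ≠ 0 := by positivity
  have hK0 : (a.K : ℝ) ≠ 0 := by positivity
  set e := roundErr (sgrad loss) (cgrad D loss) flipX a.ηxl a.K m (WithLp.toLp 2 (s.x, s.y)) θ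
    with he
  set Γ : Fin M → W d₁ d₂ := fun i => ∑ k ∈ Finset.range a.K, sgrad loss i
    (iter (noiseStep (sgrad loss i) (cgrad D loss i) flipX a.ηxl)
      (WithLp.toLp 2 (s.x, s.y), 0) (θ.2 i) k).1 (θ.2 i k) with hΓ
  have h1 : grad F s.x s.y + e = (m : ℝ)⁻¹ • ∑ i ∈ θ.1, (a.K : ℝ)⁻¹ • Γ i := by
    have h2 := roundErr_eq (g := sgrad loss) (G := cgrad D loss) (J := flipX) (δ := a.ηxl) hK hm
      (WithLp.toLp 2 (s.x, s.y)) hθ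
    have h3 : meanGrad (cgrad D loss) (WithLp.toLp 2 (s.x, s.y)) = grad F s.x s.y :=
      hF.mean (WithLp.toLp 2 (s.x, s.y))
    rw [← he, h3] at h2
    rw [h2, add_sub_cancel]
  rw [← Finset.smul_sum] at h1
  have hx : gradX F s.x s.y + e.fst = (m : ℝ)⁻¹ • (a.K : ℝ)⁻¹ • ∑ i ∈ θ.1, (Γ i).fst := by
    rw [← fst_sum]
    exact congrArg WithLp.fst h1
  have hy : gradY F s.x s.y + e.snd = (m : ℝ)⁻¹ • (a.K : ℝ)⁻¹ • ∑ i ∈ θ.1, (Γ i).snd := by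
    rw [← snd_sum]
    exact congrArg WithLp.snd h1
  have hlx : ∑ i ∈ θ.1, (localRun a (loss i) (θ.2 i) s.x s.y a.K).x
      = (m : ℝ) • s.x - a.ηxl • ∑ i ∈ θ.1, (Γ i).fst := by
    rw [Finset.sum_congr rfl fun i _ => (localRun_x a hxy loss (cgrad D loss) i (θ.2 i) s.x s.y
      a.K).1, Finset.sum_sub_distrib, Finset.sum_const, hθ, ← Nat.cast_smul_eq_nsmul ℝ,
      ← Finset.smul_sum]
  have hly : ∑ i ∈ θ.1, (localRun a (loss i) (θ.2 i) s.x s.y a.K).y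
      = (m : ℝ) • s.y + a.ηxl • ∑ i ∈ θ.1, (Γ i).snd := by
    rw [Finset.sum_congr rfl fun i _ => (localRun_x a hxy loss (cgrad D loss) i (θ.2 i) s.x s.y
      a.K).2, Finset.sum_add_distrib, Finset.sum_const, hθ, ← Nat.cast_smul_eq_nsmul ℝ,
      ← Finset.smul_sum]
  constructor
  · change s.x + a.ηxg • ((m : ℝ)⁻¹ • (∑ i ∈ θ.1, (localRun a (loss i) (θ.2 i) s.x s.y a.K).x)
      - s.x) - (a.ηxl * a.ηxg * a.K * p) • (s.x - s.z) = _
    have e1 : gradX F s.x s.y + p • (s.x - s.z) + e.fst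
        = (m : ℝ)⁻¹ • (a.K : ℝ)⁻¹ • ∑ i ∈ θ.1, (Γ i).fst + p • (s.x - s.z) := by
      rw [← hx]; abel
    have e3 : (m : ℝ)⁻¹ • ((m : ℝ) • s.x - a.ηxl • ∑ i ∈ θ.1, (Γ i).fst) - s.x
        = -((m : ℝ)⁻¹ • a.ηxl • ∑ i ∈ θ.1, (Γ i).fst) := by
      rw [smul_sub, inv_smul_smul₀ hm0, sub_sub_cancel_left]
    rw [e1, hlx, e3, smul_neg, smul_add, smul_smul, smul_smul, smul_smul, smul_smul, smul_smul]
    have e2 : a.ηxg * (m : ℝ)⁻¹ * a.ηxl = a.ηxl * a.ηxg * a.K * (m : ℝ)⁻¹ * (a.K : ℝ)⁻¹ := by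
      field_simp
    rw [e2]
    abel
  · change s.y + a.ηyg • ((m : ℝ)⁻¹ • (∑ i ∈ θ.1, (localRun a (loss i) (θ.2 i) s.x s.y a.K).y)
      - s.y) = _
    rw [hy, hly, smul_add, inv_smul_smul₀ hm0, add_sub_cancel_left, smul_smul, smul_smul,
      smul_smul, smul_smul]
    congr 2
    field_simp

/-- One round, as a map on the iterates `(x, y, z)`. -/
def roundStep (p : ℝ) (m : ℕ) (a : Params) (loss : ∀ i, E d₁ → E d₂ → Ξ i → ℝ)
    (θ : RoundDraw Ξ) (s : E d₁ × E d₂ × E d₁) : E d₁ × E d₂ × E d₁ :=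
  let r := round p m a loss θ ⟨s.1, s.2.1, s.2.2, 0, fun _ => 0⟩
  (r.x, r.y, r.z)

theorem run_eq_iter (p : ℝ) (m : ℕ) (a : Params) (loss : ∀ i, E d₁ → E d₂ → Ξ i → ℝ)
    (x₀ : E d₁) (y₀ : E d₂) (z₀ : E d₁) (ω : ℕ → RoundDraw Ξ) (t : ℕ) :
    iter (roundStep p m a loss) (x₀, y₀, z₀) ω t = ((run p m a loss x₀ y₀ z₀ ω t).x,
      (run p m a loss x₀ y₀ z₀ ω t).y, (run p m a loss x₀ y₀ z₀ ω t).z) := by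
  induction t with
  | zero => rfl
  | succ t ih =>
    simp only [iter, run, ih]
    rfl

theorem run_rounds (p : ℝ) (m : ℕ) (a : Params) (loss : ∀ i, E d₁ → E d₂ → Ξ i → ℝ)
    (x₀ : E d₁) (y₀ : E d₂) (z₀ : E d₁) (ω : ℕ → RoundDraw Ξ) (t : ℕ) :
    (run p m a loss x₀ y₀ z₀ ω t).rounds = t := by
  induction t with
  | zero => rfl
  | succ t ih => simp [run, round, ih]

theorem run_samples_le (p : ℝ) (m : ℕ) (a : Params) (loss : ∀ i, E d₁ → E d₂ → Ξ i → ℝ)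
    (x₀ : E d₁) (y₀ : E d₂) (z₀ : E d₁) (ω : ℕ → RoundDraw Ξ) (i : Fin M) (t : ℕ) :
    (run p m a loss x₀ y₀ z₀ ω t).samples i ≤ t * a.K := by
  induction t with
  | zero => simp [run]
  | succ t ih =>
    simp only [run, round, localRun_samples]
    split_ifs <;> nlinarith

variable [∀ i, MeasurableSpace (Ξ i)] {C : Type*} [MeasurableSpace C]

/-- The parameter in `C` is kept as a variable because the losses of the second stage are centered
at a random point. -/
theorem measurable_localRun {lossC : C → ∀ i, E d₁ → E d₂ → Ξ i → ℝ} {i : Fin M}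
    (hm : Measurable fun q : C × W d₁ d₂ × Ξ i => sgrad (lossC q.1) i q.2.1 q.2.2) (a : Params)
    (k : ℕ) :
    Measurable (fun q : C × (ℕ → Ξ i) × (E d₁ × E d₂) =>
      (localRun a (lossC q.1 i) q.2.1 q.2.2.1 q.2.2.2 k).x) ∧
    Measurable (fun q : C × (ℕ → Ξ i) × (E d₁ × E d₂) =>
      (localRun a (lossC q.1 i) q.2.1 q.2.2.1 q.2.2.2 k).y) := by
  induction k with
  | zero =>
    exact ⟨measurable_fst.comp (measurable_snd.comp measurable_snd),
      measurable_snd.comp (measurable_snd.comp measurable_snd)⟩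
  | succ k ih =>
    have hg : Measurable fun q : C × (ℕ → Ξ i) × (E d₁ × E d₂) => sgrad (lossC q.1) i
        (WithLp.toLp 2 ((localRun a (lossC q.1 i) q.2.1 q.2.2.1 q.2.2.2 k).x,
          (localRun a (lossC q.1 i) q.2.1 q.2.2.1 q.2.2.2 k).y)) (q.2.1 k) := by
      have hw := (WithLp.measurable_toLp 2 (E d₁ × E d₂)).comp (ih.1.prodMk ih.2)
      have hξ : Measurable fun q : C × (ℕ → Ξ i) × (E d₁ × E d₂) => q.2.1 k :=
        (measurable_pi_apply k).comp (measurable_fst.comp measurable_snd)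
      exact hm.comp (measurable_fst.prodMk (hw.prodMk hξ))
    exact ⟨ih.1.sub ((measurable_fst_W.comp hg).const_smul a.ηxl),
      ih.2.add ((measurable_snd_W.comp hg).const_smul a.ηyl)⟩

theorem measurable_sum_mem_param {Y H : Type*} [MeasurableSpace Y] [NormedAddCommGroup H]
    [MeasurableSpace H] [BorelSpace H] [SecondCountableTopology H] {S : Y → Finset (Fin M)}
    (hS : Measurable S) {f : Fin M → Y → H} (hf : ∀ i, Measurable (f i)) :
    Measurable fun q => ∑ i ∈ S q, f i q := by
  have e : (fun q => ∑ i ∈ S q, f i q) = fun q => ∑ i, if i ∈ S q then f i q else 0 := by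
    funext q
    rw [Finset.sum_ite_mem, Finset.univ_inter]
  rw [e]
  exact Finset.measurable_sum _ fun i _ =>
    Measurable.ite (hS (measurableSet_mem_finset i)) (hf i) measurable_const

theorem measurable_roundStep {lossC : C → ∀ i, E d₁ → E d₂ → Ξ i → ℝ}
    (hm : ∀ i, Measurable fun q : C × W d₁ d₂ × Ξ i => sgrad (lossC q.1) i q.2.1 q.2.2)
    (p : ℝ) (m : ℕ) (a : Params) :
    Measurable fun q : C × RoundDraw Ξ × (E d₁ × E d₂ × E d₁) =>
      roundStep p m a (lossC q.1) q.2.1 q.2.2 := by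
  have mx : Measurable fun q : C × RoundDraw Ξ × (E d₁ × E d₂ × E d₁) => q.2.2.1 :=
    measurable_fst.comp (measurable_snd.comp measurable_snd)
  have my : Measurable fun q : C × RoundDraw Ξ × (E d₁ × E d₂ × E d₁) => q.2.2.2.1 :=
    measurable_fst.comp (measurable_snd.comp (measurable_snd.comp measurable_snd))
  have mz : Measurable fun q : C × RoundDraw Ξ × (E d₁ × E d₂ × E d₁) => q.2.2.2.2 :=
    measurable_snd.comp (measurable_snd.comp (measurable_snd.comp measurable_snd))
  have mS : Measurable fun q : C × RoundDraw Ξ × (E d₁ × E d₂ × E d₁) => q.2.1.1 :=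
    measurable_fst.comp (measurable_fst.comp measurable_snd)
  have mξ : ∀ i, Measurable fun q : C × RoundDraw Ξ × (E d₁ × E d₂ × E d₁) => q.2.1.2 i :=
    fun i => (measurable_pi_apply i).comp (measurable_snd.comp (measurable_fst.comp measurable_snd))
  have marg : ∀ i, Measurable fun q : C × RoundDraw Ξ × (E d₁ × E d₂ × E d₁) =>
      (q.1, q.2.1.2 i, (q.2.2.1, q.2.2.2.1)) := fun i =>
    measurable_fst.prodMk ((mξ i).prodMk (mx.prodMk my))
  have sx : Measurable fun q : C × RoundDraw Ξ × (E d₁ × E d₂ × E d₁) =>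
      ∑ i ∈ q.2.1.1, (localRun a (lossC q.1 i) (q.2.1.2 i) q.2.2.1 q.2.2.2.1 a.K).x :=
    measurable_sum_mem_param mS fun i => (measurable_localRun (hm i) a a.K).1.comp (marg i)
  have sy : Measurable fun q : C × RoundDraw Ξ × (E d₁ × E d₂ × E d₁) =>
      ∑ i ∈ q.2.1.1, (localRun a (lossC q.1 i) (q.2.1.2 i) q.2.2.1 q.2.2.2.1 a.K).y :=
    measurable_sum_mem_param mS fun i => (measurable_localRun (hm i) a a.K).2.comp (marg i)
  have hx : Measurable fun q : C × RoundDraw Ξ × (E d₁ × E d₂ × E d₁) =>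
      (roundStep p m a (lossC q.1) q.2.1 q.2.2).1 :=
    (mx.add (((sx.const_smul (m : ℝ)⁻¹).sub mx).const_smul a.ηxg)).sub
      ((mx.sub mz).const_smul (a.ηxl * a.ηxg * a.K * p))
  have hy : Measurable fun q : C × RoundDraw Ξ × (E d₁ × E d₂ × E d₁) =>
      (roundStep p m a (lossC q.1) q.2.1 q.2.2).2.1 :=
    my.add (((sy.const_smul (m : ℝ)⁻¹).sub my).const_smul a.ηyg)
  exact hx.prodMk (hy.prodMk (mz.add ((hx.sub mz).const_smul a.β)))

end

/-! ### Telescoping and contraction in expectation. -/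

section Descent

/-- A bound quadratic in the error needs only the mean and second moment of the error. No
measurability of `U` is required. -/
theorem lintegral_ofReal_le_of_quadratic {Ω H : Type*} [MeasurableSpace Ω] {P : Measure Ω}
    [IsProbabilityMeasure P] [NormedAddCommGroup H] [InnerProductSpace ℝ H] [CompleteSpace H]
    {e : Ω → H} (he : Integrable e P) (he2 : Integrable (fun ω => ‖e ω‖ ^ 2) P) {U : Ω → ℝ}
    (hU0 : ∀ ω, 0 ≤ U ω) {A c : ℝ} {q : H}
    (hU : ∀ᵐ ω ∂P, U ω ≤ A + inner ℝ q (e ω) + c * ‖e ω‖ ^ 2) :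
    ∫⁻ ω, ENNReal.ofReal (U ω) ∂P
      ≤ ENNReal.ofReal (A + inner ℝ q (∫ ω, e ω ∂P) + c * ∫ ω, ‖e ω‖ ^ 2 ∂P) := by
  have hi : Integrable (fun ω => A + inner ℝ q (e ω) + c * ‖e ω‖ ^ 2) P :=
    ((integrable_const A).add (he.const_inner q)).add (he2.const_mul c)
  have h1 : ∫ ω, (A + inner ℝ q (e ω) + c * ‖e ω‖ ^ 2) ∂P
      = A + inner ℝ q (∫ ω, e ω ∂P) + c * ∫ ω, ‖e ω‖ ^ 2 ∂P := by
    have i1 : Integrable (fun ω => A + inner ℝ q (e ω)) P :=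
      (integrable_const A).add (he.const_inner q)
    rw [integral_add i1 (he2.const_mul c), integral_add (integrable_const A) (he.const_inner q),
      integral_inner he, integral_const_mul]
    simp
  rw [← h1, ofReal_integral_eq_lintegral_ofReal hi
    (hU.mono fun ω h => (hU0 ω).trans h)]
  exact lintegral_mono_ae (hU.mono fun ω h => ENNReal.ofReal_le_ofReal h)

variable {Θ S : Type*} [MeasurableSpace Θ] [MeasurableSpace S] (ρ : Measure Θ)
  [IsProbabilityMeasure ρ]

theorem lintegral_iter_succ {step : Θ → S → S} (hs : Measurable fun q : Θ × S => step q.1 q.2)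
    {U : S → ENNReal} (hU : Measurable U) (s : S) (k : ℕ) :
    ∫⁻ ω, U (iter step s ω (k + 1)) ∂(Measure.infinitePi fun _ : ℕ => ρ)
      = ∫⁻ ω, ∫⁻ θ, U (step θ (iter step s ω k)) ∂ρ ∂(Measure.infinitePi fun _ : ℕ => ρ) :=
  lintegral_iter_prod ρ hs s k (F := fun s θ => U (step θ s)) (hU.comp (hs.comp measurable_swap))

/-- Telescoping a descent inequality along a random iteration. -/
theorem lintegral_iter_sum_le {step : Θ → S → S} (hs : Measurable fun q : Θ × S => step q.1 q.2)
    {U R : S → ENNReal} (hU : Measurable U) (hR : Measurable R) {C : ENNReal}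
    (h : ∀ s, ∫⁻ θ, U (step θ s) ∂ρ + R s ≤ U s + C) (s : S) (T : ℕ) :
    ∫⁻ ω, U (iter step s ω T) ∂(Measure.infinitePi fun _ : ℕ => ρ)
      + ∑ t ∈ Finset.range T, ∫⁻ ω, R (iter step s ω t) ∂(Measure.infinitePi fun _ : ℕ => ρ)
      ≤ U s + T * C := by
  induction T with
  | zero => simp [iter]
  | succ T ih =>
    have m1 : Measurable fun ω => R (iter step s ω T) := hR.comp (measurable_iter_snd hs s T)
    have m2 : Measurable fun ω => U (iter step s ω T) := hU.comp (measurable_iter_snd hs s T)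
    have h1 : ∫⁻ ω, U (iter step s ω (T + 1)) ∂(Measure.infinitePi fun _ : ℕ => ρ)
        + ∫⁻ ω, R (iter step s ω T) ∂(Measure.infinitePi fun _ : ℕ => ρ)
        ≤ ∫⁻ ω, U (iter step s ω T) ∂(Measure.infinitePi fun _ : ℕ => ρ) + C := by
      rw [lintegral_iter_succ ρ hs hU, ← lintegral_add_right _ m1]
      refine (lintegral_mono fun ω => h (iter step s ω T)).trans_eq ?_
      rw [lintegral_add_left m2, lintegral_const, measure_univ, mul_one]
    rw [Finset.sum_range_succ]
    calc _ = (∫⁻ ω, U (iter step s ω (T + 1)) ∂(Measure.infinitePi fun _ : ℕ => ρ)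
          + ∫⁻ ω, R (iter step s ω T) ∂(Measure.infinitePi fun _ : ℕ => ρ))
          + ∑ t ∈ Finset.range T, ∫⁻ ω, R (iter step s ω t) ∂(Measure.infinitePi fun _ : ℕ => ρ) := by
          ring
      _ ≤ (∫⁻ ω, U (iter step s ω T) ∂(Measure.infinitePi fun _ : ℕ => ρ) + C)
          + ∑ t ∈ Finset.range T, ∫⁻ ω, R (iter step s ω t) ∂(Measure.infinitePi fun _ : ℕ => ρ) := by
          gcongr
      _ = (∫⁻ ω, U (iter step s ω T) ∂(Measure.infinitePi fun _ : ℕ => ρ)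
          + ∑ t ∈ Finset.range T, ∫⁻ ω, R (iter step s ω t) ∂(Measure.infinitePi fun _ : ℕ => ρ))
          + C := by ring
      _ ≤ U s + T * C + C := by gcongr
      _ = _ := by push_cast; ring

/-- Iterating a contraction in expectation along a random iteration. -/
theorem lintegral_iter_contract {step : Θ → S → S}
    (hs : Measurable fun q : Θ × S => step q.1 q.2) {U : S → ENNReal} (hU : Measurable U)
    {r C B : ENNReal} (hB : r * B + C ≤ B) (h : ∀ s, ∫⁻ θ, U (step θ s) ∂ρ ≤ r * U s + C) (s : S)
    (T : ℕ) :
    ∫⁻ ω, U (iter step s ω T) ∂(Measure.infinitePi fun _ : ℕ => ρ) ≤ r ^ T * U s + B := by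
  induction T with
  | zero => simp [iter]
  | succ T ih =>
    have m2 : Measurable fun ω => U (iter step s ω T) := hU.comp (measurable_iter_snd hs s T)
    rw [lintegral_iter_succ ρ hs hU]
    calc _ ≤ ∫⁻ ω, (r * U (iter step s ω T) + C) ∂(Measure.infinitePi fun _ : ℕ => ρ) :=
          lintegral_mono fun ω => h (iter step s ω T)
      _ = r * ∫⁻ ω, U (iter step s ω T) ∂(Measure.infinitePi fun _ : ℕ => ρ) + C := by
          rw [lintegral_add_left (m2.const_mul r), lintegral_const_mul r m2, lintegral_const,
            measure_univ, mul_one]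
      _ ≤ r * (r ^ T * U s + B) + C := by gcongr
      _ = r ^ (T + 1) * U s + (r * B + C) := by ring
      _ ≤ _ := by gcongr

end Descent

/-! ### Continuity of the potential, the residual and the primal gradient. -/

section Continuity

variable {d₁ d₂ : ℕ} {l μ : ℝ} {f : E d₁ → E d₂ → ℝ}

theorem continuous_of_norm_sub_le {F G : Type*} [SeminormedAddCommGroup F]
    [SeminormedAddCommGroup G] {g : F → G} {C : ℝ} (h : ∀ x y, ‖g x - g y‖ ≤ C * ‖x - y‖) :
    Continuous g := by
  have : LipschitzWith C.toNNReal g := by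
    refine LipschitzWith.of_dist_le_mul fun x y => ?_
    rw [dist_eq_norm, dist_eq_norm]
    exact (h x y).trans (mul_le_mul_of_nonneg_right (Real.le_coe_toNNReal C) (norm_nonneg _))
  exact this.continuous

namespace SmoothPL

theorem continuous_uncurry (h : SmoothPL l μ f) : Continuous fun q : E d₁ × E d₂ => f q.1 q.2 := by
  have h1 : Continuous fun w : W d₁ d₂ => f w.fst w.snd :=
    continuous_iff_continuousAt.2 fun w => (h.differentiable w).hasGradientAt.continuousAt
  have h2 : Continuous fun q : E d₁ × E d₂ => (WithLp.toLp 2 q : W d₁ d₂) :=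
    WithLp.prod_continuous_toLp 2 (E d₁) (E d₂)
  exact h1.comp h2

theorem continuous_gradX (h : SmoothPL l μ f) :
    Continuous fun q : E d₁ × E d₂ => gradX f q.1 q.2 := by
  refine continuous_of_norm_sub_le (C := 2 * l) fun q q' => (h.gradX_sub_le _ _ _ _).trans ?_
  have h1 : ‖q.1 - q'.1‖ ≤ ‖q - q'‖ := _root_.norm_fst_le (q - q')
  have h2 : ‖q.2 - q'.2‖ ≤ ‖q - q'‖ := _root_.norm_snd_le (q - q')
  have := mul_le_mul_of_nonneg_left (add_le_add h1 h2) h.l_pos.le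
  linarith

theorem continuous_gradY (h : SmoothPL l μ f) :
    Continuous fun q : E d₁ × E d₂ => gradY f q.1 q.2 := by
  refine continuous_of_norm_sub_le (C := 2 * l) fun q q' => (h.gradY_sub_le _ _ _ _).trans ?_
  have h1 : ‖q.1 - q'.1‖ ≤ ‖q - q'‖ := _root_.norm_fst_le (q - q')
  have h2 : ‖q.2 - q'.2‖ ≤ ‖q - q'‖ := _root_.norm_snd_le (q - q')
  have := mul_le_mul_of_nonneg_left (add_le_add h1 h2) h.l_pos.le
  linarith

theorem continuous_xmin (h : SmoothPL l μ f) :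
    Continuous fun q : E d₂ × E d₁ => xmin l f q.1 q.2 := by
  refine continuous_of_norm_sub_le (C := 3) fun q q' => ?_
  have h1 := h.xmin_sub_le q.1 q'.1 q.2
  have h2 := h.xmin_sub_le_center q'.1 q.2 q'.2
  have h3 := norm_sub_le_norm_sub_add_norm_sub (xmin l f q.1 q.2) (xmin l f q'.1 q.2)
    (xmin l f q'.1 q'.2)
  have h4 : ‖q.1 - q'.1‖ ≤ ‖q - q'‖ := _root_.norm_fst_le (q - q')
  have h5 : ‖q.2 - q'.2‖ ≤ ‖q - q'‖ := _root_.norm_snd_le (q - q')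
  linarith

theorem continuous_envelope (h : SmoothPL l μ f) : Continuous (envelope l f) := by
  have h1 : Continuous (prox l (primal f)) := continuous_of_norm_sub_le h.prox_primal_sub_le
  exact (h.primal_quadBounds.continuous.comp h1).add
    (((h1.sub continuous_id).norm.pow 2).const_mul l)

theorem continuous_lyapunov (h : SmoothPL l μ f) :
    Continuous fun s : E d₁ × E d₂ × E d₁ => lyapunov l f s.1 s.2.1 s.2.2 := by
  have hx : Continuous fun s : E d₁ × E d₂ × E d₁ => xmin l f s.2.1 s.2.2 :=
    h.continuous_xmin.comp continuous_snd
  have c1 : Continuous fun s : E d₁ × E d₂ × E d₁ => reg l f s.2.2 s.1 s.2.1 :=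
    (h.continuous_uncurry.comp (f := fun s : E d₁ × E d₂ × E d₁ => (s.1, s.2.1))
      (by fun_prop)).add (by fun_prop)
  have c2 : Continuous fun s : E d₁ × E d₂ × E d₁ => dual l f s.2.1 s.2.2 :=
    (h.continuous_uncurry.comp (hx.prodMk (continuous_fst.comp continuous_snd))).add
      (((hx.sub (continuous_snd.comp continuous_snd)).norm.pow 2).const_mul l)
  exact (c1.sub (c2.const_mul 2)).add
    ((h.continuous_envelope.comp (continuous_snd.comp continuous_snd)).const_mul 2)

theorem continuous_residual (h : SmoothPL l μ f) :
    Continuous fun s : E d₁ × E d₂ × E d₁ => residual l μ f s.1 s.2.1 s.2.2 := by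
  have hx : Continuous fun s : E d₁ × E d₂ × E d₁ => xmin l f s.2.1 s.2.2 :=
    h.continuous_xmin.comp continuous_snd
  have c1 : Continuous fun s : E d₁ × E d₂ × E d₁ => regGradX l f s.2.2 s.1 s.2.1 :=
    (h.continuous_gradX.comp (f := fun s : E d₁ × E d₂ × E d₁ => (s.1, s.2.1))
      (by fun_prop)).add (by fun_prop)
  have c2 : Continuous fun s : E d₁ × E d₂ × E d₁ => dualGrad l f s.2.1 s.2.2 :=
    h.continuous_gradY.comp (hx.prodMk (continuous_fst.comp continuous_snd))
  exact ((c1.norm.pow 2).add (c2.norm.pow 2)).add (by fun_prop)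

theorem continuous_gradient_primal (h : SmoothPL l μ f) : Continuous (gradient (primal f)) :=
  continuous_of_norm_sub_le h.gradient_primal_sub_le

end SmoothPL

end Continuity

/-! ### A round under prescribed effective step sizes. -/

section Round

variable {d₁ d₂ M : ℕ} {Ξ : Fin M → Type u} [∀ i, MeasurableSpace (Ξ i)]

/-- Parameters with effective step sizes `A` in `x` and `A / 4` in `y`, and with local step sizes so
small that the bias of the averaged gradients has size `ν`. -/
structure StepParams (L σ σG ν A : ℝ) (a : Params) : Prop where
  K_pos : 1 ≤ a.K
  local_eq : a.ηyl = a.ηxl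
  stepX : a.ηxl * a.ηxg * a.K = A
  stepY : a.ηxl * a.ηyg * a.K = A / 4
  stable : 8 * a.ηxl ^ 2 * (2 * L ^ 2) ≤ 1
  bias : 2 * L ^ 2 * 3 ^ a.K * a.ηxl ^ 2 * (2 * σ ^ 2 + 8 * σG ^ 2 + 8) ≤ ν

/-- The variance of the averaged gradients of a round. -/
def roundVar (σ σG : ℝ) (M m K : ℕ) : ℝ := σ ^ 2 / (m * K) + sampVar M m σG

theorem roundVar_nonneg (σ σG : ℝ) (M m K : ℕ) : 0 ≤ roundVar σ σG M m K :=
  add_nonneg (by positivity) (sampVar_nonneg M m σG)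

variable {D : ∀ i, Measure (Ξ i)} [∀ i, IsProbabilityMeasure (D i)]
  {loss : ∀ i, E d₁ → E d₂ → Ξ i → ℝ} {F : E d₁ → E d₂ → ℝ} {L σ σG ν A : ℝ} {a : Params} {m : ℕ}

/-- One round is a descent-ascent step with a random error of small bias and bounded variance. -/
theorem exists_round_error (hF : FedOracle L σ σG D loss F) (ha : StepParams L σ σG ν A a)
    (hm : 1 ≤ m) (hmM : m ≤ M) (p : ℝ) (s : E d₁ × E d₂ × E d₁) :
    ∃ e : RoundDraw Ξ → W d₁ d₂,
      Integrable e (roundLaw m D) ∧ Integrable (fun θ => ‖e θ‖ ^ 2) (roundLaw m D) ∧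
      ‖∫ θ, e θ ∂(roundLaw m D)‖ ^ 2 ≤ ν * (1 + ‖grad F s.1 s.2.1‖ ^ 2) ∧
      ∫ θ, ‖e θ‖ ^ 2 ∂(roundLaw m D)
        ≤ 3 * roundVar σ σG M m a.K + 3 * (ν * (1 + ‖grad F s.1 s.2.1‖ ^ 2)) ∧
      ∀ᵐ θ ∂(roundLaw m D),
        (roundStep p m a loss θ s).1
          = s.1 - A • (gradX F s.1 s.2.1 + p • (s.1 - s.2.2) + (e θ).fst) ∧
        (roundStep p m a loss θ s).2.1 = s.2.1 + (A / 4) • (gradY F s.1 s.2.1 + (e θ).snd) ∧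
        (roundStep p m a loss θ s).2.2
          = s.2.2 + a.β • ((roundStep p m a loss θ s).1 - s.2.2) := by
  have hmean : meanGrad (cgrad D loss) (WithLp.toLp 2 (s.1, s.2.1)) = grad F s.1 s.2.1 :=
    hF.mean (WithLp.toLp 2 (s.1, s.2.1))
  have h := roundErr_bounds hF.oracle (by positivity) measurable_flipX norm_flipX ha.stable
    ha.K_pos hm hmM (WithLp.toLp 2 (s.1, s.2.1)) (sG := σG)
    (B := ν * (1 + ‖grad F s.1 s.2.1‖ ^ 2))
    (fun i => by rw [hmean]; exact hF.heterogeneity i (WithLp.toLp 2 (s.1, s.2.1))) (by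
      rw [hmean]
      -- With R the squared gradient norm, 2σ² + 8σG² + 8R ≤ (2σ² + 8σG² + 8)(1 + R).
      refine le_trans ?_ (mul_le_mul_of_nonneg_right ha.bias
        (by positivity : 0 ≤ 1 + ‖grad F s.1 s.2.1‖ ^ 2))
      rw [mul_assoc _ _ (1 + ‖grad F s.1 s.2.1‖ ^ 2)]
      refine mul_le_mul_of_nonneg_left ?_ (by positivity)
      have : 0 ≤ (2 * σ ^ 2 + 8 * σG ^ 2) * ‖grad F s.1 s.2.1‖ ^ 2 := by positivity
      nlinarith)
  refine ⟨_, h.1, h.2.1, h.2.2.1, h.2.2.2, (ae_card_roundLaw m).mono fun θ hθ => ?_⟩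
  have h1 := round_eq hF p hm ha.K_pos ha.local_eq hθ ⟨s.1, s.2.1, s.2.2, 0, fun _ => 0⟩
  rw [ha.stepX, ha.stepY] at h1
  exact ⟨h1.1, h1.2, rfl⟩

end Round

/-! ### Expected progress in the two stages. -/

section Stages

variable {d₁ d₂ M : ℕ} {Ξ : Fin M → Type u} [∀ i, MeasurableSpace (Ξ i)]
  {D : ∀ i, Measure (Ξ i)} [∀ i, IsProbabilityMeasure (D i)]
  {loss : ∀ i, E d₁ → E d₂ → Ξ i → ℝ} {f : E d₁ → E d₂ → ℝ} {l μ L σ σG ν A : ℝ} {a : Params}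
  {m : ℕ}

theorem StepParams.bias_nonneg (ha : StepParams L σ σG ν A a) : 0 ≤ ν :=
  le_trans (by positivity) ha.bias

/-- A bias ν ≤ lAN costs no more than the variance does at step size A: the constant parts add up to
at most 34lA²N, and the part proportional to the gradient R is left for the descent to absorb. -/
theorem noise_terms_le {A l ν N R q₂ b₂ : ℝ} (hA : 0 < A) (hl : 0 < l) (hAl : A * l ≤ 1 / 100)
    (hν0 : 0 ≤ ν) (hR : 0 ≤ R) (hν : ν ≤ l * A * N) (hb : b₂ ≤ ν * (1 + R))
    (hq : q₂ ≤ 3 * N + 3 * (ν * (1 + R))) :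
    3 * A * b₂ + 10 * l * A ^ 2 * q₂ ≤ 34 * l * A ^ 2 * N + 33 / 10 * A * (ν * R) := by
  have h1 : 3 * A * b₂ ≤ 3 * A * (ν * (1 + R)) := mul_le_mul_of_nonneg_left hb (by positivity)
  have h2 : 10 * l * A ^ 2 * q₂ ≤ 10 * l * A ^ 2 * (3 * N + 3 * (ν * (1 + R))) :=
    mul_le_mul_of_nonneg_left hq (by positivity)
  have h3 : 30 * A * (ν * (1 + R)) * (A * l) ≤ 30 * A * (ν * (1 + R)) * (1 / 100) :=
    mul_le_mul_of_nonneg_left hAl (by positivity)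
  have h4 : 33 / 10 * A * ν ≤ 33 / 10 * A * (l * A * N) :=
    mul_le_mul_of_nonneg_left hν (by positivity)
  have h5 : 0 ≤ A * (l * A * N) := mul_nonneg hA.le (hν0.trans hν)
  nlinarith

/-- Expected descent of the potential in a round of the smoothed method. -/
theorem smoothed_round_descent (hf : SmoothPL l μ f) (hμl : μ ≤ l)
    (hF : FedOracle L σ σG D loss f) (ha : StepParams L σ σG ν A a) (hβ : a.β = A / 4 * μ / 64)
    (hA : 0 < A) (hAl : A * l ≤ 1 / 100) (hνμ : 30000 * l * ν ≤ μ)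
    (hν : ν ≤ l * A * roundVar σ σG M m a.K) (hm : 1 ≤ m) (hmM : m ≤ M)
    (s : E d₁ × E d₂ × E d₁) :
    ∫⁻ θ, ENNReal.ofReal (lyapunov l f (roundStep (2 * l) m a loss θ s).1
        (roundStep (2 * l) m a loss θ s).2.1 (roundStep (2 * l) m a loss θ s).2.2
        - ⨅ x, primal f x) ∂(roundLaw m D)
      + ENNReal.ofReal (A / 1024 * residual l μ f s.1 s.2.1 s.2.2)
      ≤ ENNReal.ofReal (lyapunov l f s.1 s.2.1 s.2.2 - ⨅ x, primal f x)
        + ENNReal.ofReal (34 * l * A ^ 2 * roundVar σ σG M m a.K) := by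
  have hl := hf.l_pos
  have hμ := hf.μ_pos
  have hν0 := ha.bias_nonneg
  have := isProbabilityMeasure_subsetLaw hmM
  obtain ⟨e, he, he2, hb, hq, hstep⟩ := exists_round_error hF ha hm hmM (2 * l) s
  have hres : 0 ≤ A / 1024 * residual l μ f s.1 s.2.1 s.2.2 := by
    unfold residual; positivity
  have hN := roundVar_nonneg σ σG M m a.K
  set N := roundVar σ σG M m a.K
  set u := regGradX l f s.2.2 s.1 s.2.1 with hu
  set v := dualGrad l f s.2.1 s.2.2 with hv
  set Y := A / 1024 * residual l μ f s.1 s.2.1 s.2.2 with hY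
  have hR := hf.norm_grad_sq_le s.1 s.2.1 s.2.2
  rw [← ENNReal.ofReal_add (sub_nonneg.2 (hf.iInf_primal_le_lyapunov _ _ _)) (by positivity)]
  -- The residual is constant in the draw and is moved under the integral, which avoids subtraction
  -- in `ENNReal`.
  have hadd : ∀ φ : RoundDraw Ξ → ℝ, (∀ θ, 0 ≤ φ θ) →
      ∫⁻ θ, ENNReal.ofReal (φ θ) ∂(roundLaw m D) + ENNReal.ofReal Y
        = ∫⁻ θ, ENNReal.ofReal (φ θ + Y) ∂(roundLaw m D) := by
    intro φ hφ
    rw [lintegral_congr fun θ => ENNReal.ofReal_add (hφ θ) hres,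
      lintegral_add_right _ measurable_const, lintegral_const, measure_univ, mul_one]
  rw [hadd _ fun θ => sub_nonneg.2 (hf.iInf_primal_le_lyapunov _ _ _)]
  -- The coefficient 7/40 is the gain 19/80 of `step_bound` less the price b/4 = A/16 of the center
  -- move, for b = A/4.
  refine (lintegral_ofReal_le_of_quadratic he he2 (c := 10 * l * A ^ 2)
    (q := errorForm l A f s.1 s.2.1 s.2.2)
    (A := lyapunov l f s.1 s.2.1 s.2.2 - (⨅ x, primal f x) + Y - 3 / 5 * A * ‖u‖ ^ 2
      - 7 / 40 * A * ‖v‖ ^ 2 - l * (A / 4 * μ / 64) / 2 * ‖s.1 - s.2.2‖ ^ 2)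
    (fun θ => add_nonneg (sub_nonneg.2 (hf.iInf_primal_le_lyapunov _ _ _)) hres) ?_).trans
    (ENNReal.ofReal_le_ofReal ?_)
  · refine hstep.mono fun θ hθ => ?_
    obtain ⟨h1, h2, h3⟩ := hθ
    have hdx : (roundStep (2 * l) m a loss θ s).1 - s.1 = -(A • (u + (e θ).fst)) := by
      rw [h1, sub_sub_cancel_left]; rfl
    have hdy : (roundStep (2 * l) m a loss θ s).2.1 - s.2.1
        = (A / 4) • (gradY f s.1 s.2.1 + (e θ).snd) := by rw [h2, add_sub_cancel_left]
    have k1 := hf.lyapunov_step s.1 (roundStep (2 * l) m a loss θ s).1 s.2.1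
      (roundStep (2 * l) m a loss θ s).2.1 s.2.2 (b := A / 4) (by positivity) (by linarith) hμl
    have k2 := hf.step_bound s.2.2 s.1 s.2.1 (e θ) hA hAl hdx hdy
    rw [h3, hβ]
    linarith
  · have k3 := hf.errorForm_le s.2.2 s.1 s.2.1 (∫ θ, e θ ∂(roundLaw m D)) hA
    rw [← hu, ← hv] at k3
    have k4 := noise_terms_le hA hl hAl hν0 (sq_nonneg _) hν hb hq
    have k5 : ν * ‖grad f s.1 s.2.1‖ ^ 2 ≤ ν * (4 * ‖u‖ ^ 2 + 2 * ‖v‖ ^ 2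
        + 8 * l ^ 2 * ‖s.1 - s.2.2‖ ^ 2) := mul_le_mul_of_nonneg_left hR hν0
    have hν1 : 30000 * ν ≤ 1 := by
      have : l * (30000 * ν) ≤ l * 1 := by linarith
      exact le_of_mul_le_mul_left this hl
    have k6 := mul_le_mul_of_nonneg_right hν1 (sq_nonneg ‖u‖)
    have k7 := mul_le_mul_of_nonneg_right hν1 (sq_nonneg ‖v‖)
    have k8 := mul_le_mul_of_nonneg_right hνμ
      (by positivity : 0 ≤ l * ‖s.1 - s.2.2‖ ^ 2)
    -- The term in ‖x − z‖² is the tight one: its gain lμA/512 must pay for the bias,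
    -- (33/10)(8/30000)lμA, and for the 1/1024 of the residual. This is where the constant 30000 is
    -- needed.
    have k9 : ν * ‖grad f s.1 s.2.1‖ ^ 2 ≤ 4 / 30000 * ‖u‖ ^ 2 + 2 / 30000 * ‖v‖ ^ 2
        + 8 / 30000 * (l * μ * ‖s.1 - s.2.2‖ ^ 2) := by linarith
    have k10 := mul_le_mul_of_nonneg_left k9 hA.le
    have p1 : 0 ≤ A * ‖u‖ ^ 2 := by positivity
    have p2 : 0 ≤ A * ‖v‖ ^ 2 := by positivity
    have p3 : 0 ≤ A * (l * μ * ‖s.1 - s.2.2‖ ^ 2) := by positivity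
    have hYe : Y = A / 1024 * (‖u‖ ^ 2 + ‖v‖ ^ 2 + l * μ * ‖s.1 - s.2.2‖ ^ 2) := rfl
    rw [hYe]
    linarith

/-- Expected contraction of the potential in a round of the method on the regularized problem. -/
theorem regularized_round_contract (hf : SmoothPL l μ f) (hμl : μ ≤ l) (c : E d₁)
    (hF : FedOracle L σ σG D loss (reg l f c))
    (hgX : ∀ x y, gradX (reg l f c) x y = regGradX l f c x y)
    (hgY : ∀ x y, gradY (reg l f c) x y = gradY f x y) (ha : StepParams L σ σG ν A a)
    (hA : 0 < A) (hAl : A * l ≤ 1 / 100) (hνμ : 30000 * l * ν ≤ μ)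
    (hν : ν ≤ l * A * roundVar σ σG M m a.K) (hm : 1 ≤ m) (hmM : m ≤ M)
    (s : E d₁ × E d₂ × E d₁) :
    ∫⁻ θ, ENNReal.ofReal (lyapunov l f (roundStep 0 m a loss θ s).1
        (roundStep 0 m a loss θ s).2.1 c - envelope l f c) ∂(roundLaw m D)
      ≤ ENNReal.ofReal (1 - A * μ / 4)
          * ENNReal.ofReal (lyapunov l f s.1 s.2.1 c - envelope l f c)
        + ENNReal.ofReal (34 * l * A ^ 2 * roundVar σ σG M m a.K) := by
  have hl := hf.l_pos
  have hμ := hf.μ_pos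
  have hν0 := ha.bias_nonneg
  have := isProbabilityMeasure_subsetLaw hmM
  obtain ⟨e, he, he2, hb, hq, hstep⟩ := exists_round_error hF ha hm hmM 0 s
  have hN := roundVar_nonneg σ σG M m a.K
  set N := roundVar σ σG M m a.K
  set u := regGradX l f c s.1 s.2.1 with hu
  set v := dualGrad l f s.2.1 c with hv
  have hAμ : A * μ ≤ 1 / 100 := (mul_le_mul_of_nonneg_left hμl hA.le).trans hAl
  have hU := sub_nonneg.2 (hf.envelope_le_lyapunov s.1 s.2.1 c)
  have hR : ‖grad (reg l f c) s.1 s.2.1‖ ^ 2 ≤ 3 * ‖u‖ ^ 2 + 2 * ‖v‖ ^ 2 := by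
    rw [norm_grad_sq, hgX, hgY]
    have n1 : ‖gradY f s.1 s.2.1 - v‖ ^ 2 ≤ ‖u‖ ^ 2 :=
      pow_le_pow_left₀ (norm_nonneg _) (hf.gradY_sub_dualGrad_le c s.1 s.2.1) 2
    have n2 := norm_sq_le_two_sub (gradY f s.1 s.2.1) v
    linarith
  rw [← ENNReal.ofReal_mul (by linarith),
    ← ENNReal.ofReal_add (mul_nonneg (by linarith) hU) (by positivity)]
  refine (lintegral_ofReal_le_of_quadratic he he2 (c := 10 * l * A ^ 2)
    (q := errorForm l A f s.1 s.2.1 c)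
    (A := lyapunov l f s.1 s.2.1 c - envelope l f c - 3 / 5 * A * ‖u‖ ^ 2
      - 19 / 80 * A * ‖v‖ ^ 2)
    (fun θ => sub_nonneg.2 (hf.envelope_le_lyapunov _ _ _)) ?_).trans
    (ENNReal.ofReal_le_ofReal ?_)
  · refine hstep.mono fun θ hθ => ?_
    obtain ⟨h1, h2, -⟩ := hθ
    have hdx : (roundStep 0 m a loss θ s).1 - s.1 = -(A • (u + (e θ).fst)) := by
      rw [h1, sub_sub_cancel_left, zero_smul, add_zero, hgX]
    have hdy : (roundStep 0 m a loss θ s).2.1 - s.2.1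
        = (A / 4) • (gradY f s.1 s.2.1 + (e θ).snd) := by rw [h2, add_sub_cancel_left, hgY]
    have k1 := hf.reg_sub_dual_step c s.1 (roundStep 0 m a loss θ s).1 s.2.1
      (roundStep 0 m a loss θ s).2.1
    have k2 := hf.step_bound c s.1 s.2.1 (e θ) hA hAl hdx hdy
    have p1 : 0 ≤ l * ‖(roundStep 0 m a loss θ s).1 - s.1‖ ^ 2 := by positivity
    have p2 : 0 ≤ l * ‖(roundStep 0 m a loss θ s).2.1 - s.2.1‖ ^ 2 := by positivity
    unfold lyapunov
    linarith
  · have k3 := hf.errorForm_le c s.1 s.2.1 (∫ θ, e θ ∂(roundLaw m D)) hA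
    rw [← hu, ← hv] at k3
    have k4 := noise_terms_le hA hl hAl hν0 (sq_nonneg _) hν hb hq
    have k5 : ν * ‖grad (reg l f c) s.1 s.2.1‖ ^ 2 ≤ ν * (3 * ‖u‖ ^ 2 + 2 * ‖v‖ ^ 2) :=
      mul_le_mul_of_nonneg_left hR hν0
    have hν1 : 30000 * ν ≤ 1 := by
      have : l * (30000 * ν) ≤ l * 1 := by linarith
      exact le_of_mul_le_mul_left this hl
    have k6 := mul_le_mul_of_nonneg_right hν1 (sq_nonneg ‖u‖)
    have k7 := mul_le_mul_of_nonneg_right hν1 (sq_nonneg ‖v‖)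
    have k9 : ν * ‖grad (reg l f c) s.1 s.2.1‖ ^ 2
        ≤ 3 / 30000 * ‖u‖ ^ 2 + 2 / 30000 * ‖v‖ ^ 2 := by linarith
    have k10 := mul_le_mul_of_nonneg_left k9 hA.le
    have p1 : 0 ≤ A * ‖u‖ ^ 2 := by positivity
    have p2 : 0 ≤ A * ‖v‖ ^ 2 := by positivity
    -- The PL inequality of the potential. Of the gradient terms at least A/8 of each square
    -- remains, which is Aμ/4 of the potential gap.
    have k11 : μ * (lyapunov l f s.1 s.2.1 c - envelope l f c)
        ≤ ‖u‖ ^ 2 / 2 + ‖v‖ ^ 2 / 2 := by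
      have k12 := mul_le_mul_of_nonneg_left (hf.lyapunov_sub_envelope_le s.1 s.2.1 c) hμ.le
      have k13 : μ * (‖u‖ ^ 2 / (2 * l) + ‖v‖ ^ 2 / (2 * μ))
          = μ / l * (‖u‖ ^ 2 / 2) + ‖v‖ ^ 2 / 2 := by field_simp
      have k14 : μ / l * (‖u‖ ^ 2 / 2) ≤ 1 * (‖u‖ ^ 2 / 2) :=
        mul_le_mul_of_nonneg_right ((div_le_one hl).2 hμl) (by positivity)
      rw [← hu, ← hv] at k12
      linarith
    have k15 := mul_le_mul_of_nonneg_left k11 hA.le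
    linarith

theorem drawLaw_eq (m : ℕ) :
    drawLaw m D = Measure.infinitePi fun _ : ℕ => roundLaw m D := rfl

theorem measurable_section {X Y Z : Type*} [MeasurableSpace X] [MeasurableSpace Y]
    [MeasurableSpace Z] {g : X → Y → Z} (h : Measurable fun q : X × Y => g q.1 q.2) (x : X) :
    Measurable (g x) :=
  h.comp measurable_prodMk_left

theorem measurable_roundStep_of {loss : ∀ i, E d₁ → E d₂ → Ξ i → ℝ}
    (h : ∀ i, Measurable fun q : W d₁ d₂ × Ξ i => sgrad loss i q.1 q.2) (p : ℝ) (m : ℕ)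
    (a : Params) :
    Measurable fun q : RoundDraw Ξ × (E d₁ × E d₂ × E d₁) => roundStep p m a loss q.1 q.2 := by
  have h1 : ∀ i, Measurable fun q : Unit × W d₁ d₂ × Ξ i => sgrad loss i q.2.1 q.2.2 := fun i =>
    (h i).comp measurable_snd
  have h2 := measurable_roundStep (C := Unit) (lossC := fun _ => loss) h1 p m a
  exact measurable_section (g := fun (_ : Unit) (q : RoundDraw Ξ × (E d₁ × E d₂ × E d₁)) =>
    roundStep p m a loss q.1 q.2) h2 ()

/-- The average residual along a run of the smoothed method. -/
theorem sum_residual_le (hf : SmoothPL l μ f) (hμl : μ ≤ l)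
    (hF : FedOracle L σ σG D loss f) (ha : StepParams L σ σG ν A a) (hβ : a.β = A / 4 * μ / 64)
    (hA : 0 < A) (hAl : A * l ≤ 1 / 100) (hνμ : 30000 * l * ν ≤ μ)
    (hν : ν ≤ l * A * roundVar σ σG M m a.K) (hm : 1 ≤ m) (hmM : m ≤ M)
    (s : E d₁ × E d₂ × E d₁) {Δ : ℝ}
    (hΔ : lyapunov l f s.1 s.2.1 s.2.2 - ⨅ x, primal f x ≤ Δ) (T : ℕ) :
    ∑ t ∈ Finset.range T, ∫⁻ ω, ENNReal.ofReal (A / 1024 * residual l μ f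
        (iter (roundStep (2 * l) m a loss) s ω t).1 (iter (roundStep (2 * l) m a loss) s ω t).2.1
        (iter (roundStep (2 * l) m a loss) s ω t).2.2) ∂(drawLaw m D)
      ≤ ENNReal.ofReal (Δ + T * (34 * l * A ^ 2 * roundVar σ σG M m a.K)) := by
  have := isProbabilityMeasure_subsetLaw hmM
  have hN := roundVar_nonneg σ σG M m a.K
  have hl := hf.l_pos
  have hs := measurable_roundStep_of (fun i => (hF.oracle i).measurable) (2 * l) m a
  have h := lintegral_iter_sum_le (roundLaw m D) hs
    (U := fun s => ENNReal.ofReal (lyapunov l f s.1 s.2.1 s.2.2 - ⨅ x, primal f x))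
    (R := fun s => ENNReal.ofReal (A / 1024 * residual l μ f s.1 s.2.1 s.2.2))
    (hf.continuous_lyapunov.measurable.sub_const _).ennreal_ofReal
    (hf.continuous_residual.measurable.const_mul _).ennreal_ofReal
    (smoothed_round_descent hf hμl hF ha hβ hA hAl hνμ hν hm hmM) s T
  have hΔ0 := (sub_nonneg.2 (hf.iInf_primal_le_lyapunov s.1 s.2.1 s.2.2)).trans hΔ
  rw [ENNReal.ofReal_add hΔ0 (by positivity), ENNReal.ofReal_mul (Nat.cast_nonneg T),
    ENNReal.ofReal_natCast]
  refine (le_add_self.trans h).trans ?_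
  gcongr

/-- The potential at the end of a run on the regularized problem. -/
theorem lyapunov_last_le (hf : SmoothPL l μ f) (hμl : μ ≤ l) (c : E d₁)
    (hF : FedOracle L σ σG D loss (reg l f c))
    (hgX : ∀ x y, gradX (reg l f c) x y = regGradX l f c x y)
    (hgY : ∀ x y, gradY (reg l f c) x y = gradY f x y) (ha : StepParams L σ σG ν A a)
    (hA : 0 < A) (hAl : A * l ≤ 1 / 100) (hνμ : 30000 * l * ν ≤ μ)
    (hν : ν ≤ l * A * roundVar σ σG M m a.K) (hm : 1 ≤ m) (hmM : m ≤ M)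
    (s : E d₁ × E d₂ × E d₁) (T : ℕ) :
    ∫⁻ ω, ENNReal.ofReal (lyapunov l f (iter (roundStep 0 m a loss) s ω T).1
        (iter (roundStep 0 m a loss) s ω T).2.1 c - envelope l f c) ∂(drawLaw m D)
      ≤ ENNReal.ofReal ((1 - A * μ / 4) ^ T * (lyapunov l f s.1 s.2.1 c - envelope l f c)
        + 136 * (l / μ) * A * roundVar σ σG M m a.K) := by
  have := isProbabilityMeasure_subsetLaw hmM
  have hN := roundVar_nonneg σ σG M m a.K
  have hl := hf.l_pos
  have hμ := hf.μ_pos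
  have hAμ : A * μ ≤ 1 / 100 := (mul_le_mul_of_nonneg_left hμl hA.le).trans hAl
  have hr : 0 ≤ 1 - A * μ / 4 := by linarith
  have hs := measurable_roundStep_of (fun i => (hF.oracle i).measurable) 0 m a
  have hmeas : Measurable fun s : E d₁ × E d₂ × E d₁ =>
      ENNReal.ofReal (lyapunov l f s.1 s.2.1 c - envelope l f c) := by
    have hc : Continuous fun s : E d₁ × E d₂ × E d₁ => lyapunov l f s.1 s.2.1 c :=
      hf.continuous_lyapunov.comp (f := fun s : E d₁ × E d₂ × E d₁ => (s.1, s.2.1, c))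
        (by fun_prop)
    exact (hc.measurable.sub_const _).ennreal_ofReal
  -- The noise floor is the noise 34lA²N of a round divided by the rate Aμ/4, hence 136(l/μ)AN.
  have h := lintegral_iter_contract (roundLaw m D) hs hmeas
    (B := ENNReal.ofReal (136 * (l / μ) * A * roundVar σ σG M m a.K)) (by
      rw [← ENNReal.ofReal_mul hr, ← ENNReal.ofReal_add (by positivity) (by positivity)]
      refine ENNReal.ofReal_le_ofReal (le_of_eq ?_)
      field_simp
      ring)
    (regularized_round_contract hf hμl c hF hgX hgY ha hA hAl hνμ hν hm hmM) s T
  refine h.trans_eq ?_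
  have hU := sub_nonneg.2 (hf.envelope_le_lyapunov s.1 s.2.1 c)
  rw [ENNReal.ofReal_add (by positivity) (by positivity), ENNReal.ofReal_mul (pow_nonneg hr T),
    ENNReal.ofReal_pow hr]

end Stages

/-! ### Measurability of a restart from a random point. -/

section Param

variable {C Θ S : Type*} [MeasurableSpace C] [MeasurableSpace Θ] [MeasurableSpace S]

/-- Storing the parameter as a conserved component of the state reduces joint measurability to the
case without a parameter. -/
theorem iter_param (step : C → Θ → S → S) (c : C) (s : S) (ω : ℕ → Θ) (k : ℕ) :
    iter (fun θ (q : C × S) => (q.1, step q.1 θ q.2)) (c, s) ω k = (c, iter (step c) s ω k) := by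
  induction k with
  | zero => rfl
  | succ k ih => simp only [iter, ih]

theorem measurable_iter_param {step : C → Θ → S → S}
    (hs : Measurable fun q : C × Θ × S => step q.1 q.2.1 q.2.2) (k : ℕ) :
    Measurable fun q : (C × S) × (ℕ → Θ) => iter (step q.1.1) q.1.2 q.2 k := by
  have h1 : Measurable fun q : Θ × (C × S) => (q.2.1, step q.2.1 q.1 q.2.2) := by
    have h2 : Measurable fun q : Θ × (C × S) => (q.2.1, q.1, q.2.2) :=
      (measurable_fst.comp measurable_snd).prodMk
        (measurable_fst.prodMk (measurable_snd.comp measurable_snd))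
    exact (measurable_fst.comp measurable_snd).prodMk (hs.comp h2)
  have h3 := measurable_iter (step := fun θ (q : C × S) => (q.1, step q.1 θ q.2)) h1 k
  have e : (fun q : (C × S) × (ℕ → Θ) => iter (step q.1.1) q.1.2 q.2 k)
      = fun q => (iter (fun θ (q : C × S) => (q.1, step q.1 θ q.2)) q.1 q.2 k).2 := by
    funext q
    rw [show q.1 = (q.1.1, q.1.2) from rfl, iter_param]
  rw [e]
  exact measurable_snd.comp h3

theorem measurable_iter_restart {X Y Θ : Type*} [MeasurableSpace X] [MeasurableSpace Y]
    [MeasurableSpace Θ] {step : X → Θ → X × Y × X → X × Y × X}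
    (hs : Measurable fun q : X × Θ × X × Y × X => step q.1 q.2.1 q.2.2) (k : ℕ) :
    Measurable fun q : (X × Y × X) × (ℕ → Θ) =>
      (iter (step q.1.1) (q.1.1, q.1.2.1, q.1.1) q.2 k).1 := by
  have h2 := measurable_iter_param hs k
  have h3 : Measurable fun q : (X × Y × X) × (ℕ → Θ) =>
      ((q.1.1, (q.1.1, q.1.2.1, q.1.1)), q.2) := by
    have m1 : Measurable fun q : (X × Y × X) × (ℕ → Θ) => q.1.1 :=
      measurable_fst.comp measurable_fst
    have m2 : Measurable fun q : (X × Y × X) × (ℕ → Θ) => q.1.2.1 :=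
      measurable_fst.comp (measurable_snd.comp measurable_fst)
    exact (m1.prodMk (m1.prodMk (m2.prodMk m1))).prodMk measurable_snd
  exact measurable_fst.comp (h2.comp h3)

theorem lintegral_uniformOn_univ {T : ℕ} (g : Fin T → ENNReal) :
    ∫⁻ t, g t ∂(uniformOn (Set.univ : Set (Fin T))) = (T : ENNReal)⁻¹ * ∑ t, g t := by
  rw [uniformOn, ProbabilityTheory.cond, Measure.restrict_univ, lintegral_smul_measure, lintegral_count,
    tsum_fintype, Measure.count_apply MeasurableSet.univ]
  simp

end Param

/-! ### From the residual and the potential to the gradient of the primal function. -/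

section TwoStage

variable {d₁ d₂ M : ℕ} {Ξ : Fin M → Type u} [∀ i, MeasurableSpace (Ξ i)]
  {D : ∀ i, Measure (Ξ i)} [∀ i, IsProbabilityMeasure (D i)]
  {loss : ∀ i, E d₁ → E d₂ → Ξ i → ℝ} {f : E d₁ → E d₂ → ℝ} {l μ σ σG ν A κ ε : ℝ}
  {a b : Params} {m : ℕ}

/-- The primal gradient near the proximal point of a nearly stationary point. -/
theorem norm_gradient_primal_le (hf : SmoothPL l μ f) (hμl : μ ≤ l) (hκ : κ = l / μ) (hε : 0 < ε)
    (x' : E d₁) (y' : E d₂) (x : E d₁) (y : E d₂) (z : E d₁) :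
    ‖gradient (primal f) x'‖ ≤ ε / 2 + 48 * κ / ε * residual l μ f x y z
      + 432 * l * κ ^ 3 / ε * (lyapunov l f x' y' x - envelope l f x) := by
  have hl := hf.l_pos
  have hμ := hf.μ_pos
  have hκ1 : 1 ≤ κ := by rw [hκ, one_le_div hμ]; exact hμl
  set q := prox l (primal f) x with hq
  have h1 := norm_sub_norm_le (gradient (primal f) x') (gradient (primal f) q)
  have h2 := hf.gradient_primal_sub_le x' q
  rw [hf.gradient_primal_prox] at h1
  have h3 := hf.dist_prox_self_sq_le hμl x y z
  have h4 := hf.dist_prox_sq_le_lyapunov hμl x' y' x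
  rw [← hq] at h1 h3 h4
  set U := lyapunov l f x' y' x - envelope l f x
  set R := residual l μ f x y z
  set P := ‖x - q‖
  set Q := ‖x' - q‖
  have e1 : l + l ^ 2 / μ = l * (1 + κ) := by rw [hκ]; field_simp
  have e2 : l = κ * μ := by rw [hκ]; field_simp
  have hQ0 : 0 ≤ Q := norm_nonneg _
  -- The Lipschitz constant 3l(1 + κ) of the primal gradient is at most 6lκ.
  have h5 : ‖gradient (primal f) x'‖ ≤ 2 * l * P + 6 * l * κ * Q := by
    rw [e1] at h2
    have : l * Q * 1 ≤ l * Q * κ := mul_le_mul_of_nonneg_left hκ1 (by positivity)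
    linarith
  have h6 : l ^ 2 * P ^ 2 ≤ 12 * κ * R := by
    have := mul_le_mul_of_nonneg_left h3 (by positivity : 0 ≤ κ)
    calc l ^ 2 * P ^ 2 = κ * (l * μ * P ^ 2) := by rw [e2]; ring
      _ ≤ _ := by linarith
  have h7 : l ^ 2 * κ ^ 2 * Q ^ 2 ≤ 12 * l * κ ^ 3 * U := by
    have := mul_le_mul_of_nonneg_left h4 (by positivity : 0 ≤ κ ^ 3)
    calc l ^ 2 * κ ^ 2 * Q ^ 2 = κ ^ 3 * (l * μ * Q ^ 2) := by
          rw [show l ^ 2 = l * (κ * μ) by rw [← e2, sq]]; ring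
      _ ≤ _ := by linarith
  -- The bound s + t ≤ ε/2 + (s² + t²)/ε trades the norm for squares, whose expectations are the
  -- ones under control.
  have h8 : 2 * l * P + 6 * l * κ * Q ≤ ε / 2 + (4 * (l ^ 2 * P ^ 2)
      + 36 * (l ^ 2 * κ ^ 2 * Q ^ 2)) / ε := by
    have h9 : 0 ≤ ((ε / 2 - 2 * l * P - 6 * l * κ * Q + ε / 2) ^ 2
        + (2 * l * P - 6 * l * κ * Q) ^ 2) / (2 * ε) := by positivity
    have h10 : ((ε / 2 - 2 * l * P - 6 * l * κ * Q + ε / 2) ^ 2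
        + (2 * l * P - 6 * l * κ * Q) ^ 2) / (2 * ε)
        = ε / 2 + (4 * (l ^ 2 * P ^ 2) + 36 * (l ^ 2 * κ ^ 2 * Q ^ 2)) / ε
          - (2 * l * P + 6 * l * κ * Q) := by field_simp; ring
    linarith
  have h11 : (4 * (l ^ 2 * P ^ 2) + 36 * (l ^ 2 * κ ^ 2 * Q ^ 2)) / ε
      ≤ (4 * (12 * κ * R) + 36 * (12 * l * κ ^ 3 * U)) / ε := by gcongr
  have h12 : (4 * (12 * κ * R) + 36 * (12 * l * κ ^ 3 * U)) / ε
      = 48 * κ / ε * R + 432 * l * κ ^ 3 / ε * U := by ring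
  linarith

namespace NCPL

theorem gradX_reg (h : NCPL l μ σ σG D loss) (c x : E d₁) (y : E d₂) :
    gradX (reg l (obj D loss) c) x y = regGradX l (obj D loss) c x y := by
  have h1 := congrArg WithLp.fst (h.grad_reg c x y)
  exact h1

theorem gradY_reg (h : NCPL l μ σ σG D loss) (c x : E d₁) (y : E d₂) :
    gradY (reg l (obj D loss) c) x y = gradY (obj D loss) x y := by
  have h1 := congrArg WithLp.snd (h.grad_reg c x y)
  have h2 : (grad (obj D loss) x y + inX ((2 * l) • (x - c))).snd
      = gradY (obj D loss) x y + 0 := rfl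
  rw [h2, add_zero] at h1
  exact h1

/-- The expected primal gradient after the second stage. -/
theorem second_stage_le (h : NCPL l μ σ σG D loss) (hl : 0 < l) (hμ : 0 < μ) (hμl : μ ≤ l)
    (hκ : κ = l / μ) (hε : 0 < ε) (hb : StepParams (3 * l) σ σG ν A b) (hA : 0 < A)
    (hAl : A * l ≤ 1 / 100) (hνμ : 30000 * l * ν ≤ μ) (hν : ν ≤ l * A * roundVar σ σG M m b.K)
    (hm : 1 ≤ m) (hmM : m ≤ M) (hT : κ ^ 4 * (1 - A * μ / 4) ^ b.T ≤ 1)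
    (hV : 300000 * (l * κ ^ 4 * A * roundVar σ σG M m b.K) ≤ ε ^ 2) (x : E d₁) (y : E d₂)
    (z : E d₁) :
    ∫⁻ ω, ENNReal.ofReal ‖gradient (primal (obj D loss))
        (iter (roundStep 0 m b (proxLoss l loss x)) (x, y, x) ω b.T).1‖ ∂(drawLaw m D)
      ≤ ENNReal.ofReal (3 / 4 * ε + 4000 * κ / ε * residual l μ (obj D loss) x y z) := by
  have := isProbabilityMeasure_subsetLaw hmM
  have hf := h.smoothPL (hm.trans hmM) hl hμ
  have hF := h.fedOracle_proxLoss (hm.trans hmM) hl x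
  have hN := roundVar_nonneg σ σG M m b.K
  have hκ1 : 1 ≤ κ := by rw [hκ, one_le_div hμ]; exact hμl
  have hAμ : A * μ ≤ 1 / 100 := (mul_le_mul_of_nonneg_left hμl hA.le).trans hAl
  have hr : 0 ≤ (1 - A * μ / 4) ^ b.T := pow_nonneg (by linarith) _
  have key := lyapunov_last_le hf hμl x hF (h.gradX_reg x) (h.gradY_reg x) hb hA hAl hνμ hν hm hmM
    (x, y, x) b.T
  have hR : 0 ≤ residual l μ (obj D loss) x y z := by unfold residual; positivity
  have hU0 := sub_nonneg.2 (hf.envelope_le_lyapunov x y x)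
  have hU := hf.lyapunov_self_le hμl x y z
  set R := residual l μ (obj D loss) x y z
  set N := roundVar σ σG M m b.K
  set r := (1 - A * μ / 4) ^ b.T
  set U₀ := lyapunov l (obj D loss) x y x - envelope l (obj D loss) x
  have c0 : 0 ≤ 432 * l * κ ^ 3 / ε := by positivity
  calc _ ≤ ∫⁻ ω, (ENNReal.ofReal (ε / 2 + 48 * κ / ε * R)
        + ENNReal.ofReal (432 * l * κ ^ 3 / ε) * ENNReal.ofReal (lyapunov l (obj D loss)
          (iter (roundStep 0 m b (proxLoss l loss x)) (x, y, x) ω b.T).1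
          (iter (roundStep 0 m b (proxLoss l loss x)) (x, y, x) ω b.T).2.1 x
          - envelope l (obj D loss) x)) ∂(drawLaw m D) := by
        refine lintegral_mono fun ω => ?_
        have hU' := sub_nonneg.2 (hf.envelope_le_lyapunov
          (iter (roundStep 0 m b (proxLoss l loss x)) (x, y, x) ω b.T).1
          (iter (roundStep 0 m b (proxLoss l loss x)) (x, y, x) ω b.T).2.1 x)
        rw [← ENNReal.ofReal_mul c0, ← ENNReal.ofReal_add (by positivity) (mul_nonneg c0 hU')]
        exact ENNReal.ofReal_le_ofReal (norm_gradient_primal_le hf hμl hκ hε _ _ x y z)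
    _ = ENNReal.ofReal (ε / 2 + 48 * κ / ε * R)
        + ENNReal.ofReal (432 * l * κ ^ 3 / ε) * ∫⁻ ω, ENNReal.ofReal (lyapunov l (obj D loss)
          (iter (roundStep 0 m b (proxLoss l loss x)) (x, y, x) ω b.T).1
          (iter (roundStep 0 m b (proxLoss l loss x)) (x, y, x) ω b.T).2.1 x
          - envelope l (obj D loss) x) ∂(drawLaw m D) := by
        rw [lintegral_add_left measurable_const, lintegral_const_mul' _ _ ENNReal.ofReal_ne_top,
          lintegral_const, drawLaw_eq, measure_univ, mul_one]
    _ ≤ ENNReal.ofReal (ε / 2 + 48 * κ / ε * R)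
        + ENNReal.ofReal (432 * l * κ ^ 3 / ε) * ENNReal.ofReal (r * U₀
          + 136 * (l / μ) * A * N) := by gcongr
    _ ≤ _ := by
        rw [← ENNReal.ofReal_mul c0, ← ENNReal.ofReal_add (by positivity) (by positivity)]
        refine ENNReal.ofReal_le_ofReal ?_
        have e2 : l = κ * μ := by rw [hκ]; field_simp
        have h1 : l * U₀ ≤ 9 * κ ^ 2 * R := by
          have h3 : l * U₀ * μ ^ 2 ≤ 9 * κ ^ 2 * R * μ ^ 2 := by
            calc l * U₀ * μ ^ 2 = l * μ ^ 2 * U₀ := by ring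
              _ ≤ 9 * l ^ 2 * R := hU
              _ = _ := by rw [e2]; ring
          exact le_of_mul_le_mul_right h3 (by positivity)
        -- The initial gap brings κ² and the passage to the gradient κ³; contraction by κ⁻⁴ leaves
        -- one factor κ, the same as in the first-stage term 48κR/ε. This explains the exponent in
        -- `hT`.
        have h2 : 432 * l * κ ^ 3 * (r * U₀) ≤ 3888 * κ * R := by
          calc 432 * l * κ ^ 3 * (r * U₀) = 432 * κ ^ 3 * r * (l * U₀) := by ring
            _ ≤ 432 * κ ^ 3 * r * (9 * κ ^ 2 * R) := mul_le_mul_of_nonneg_left h1 (by positivity)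
            _ = 3888 * κ * R * (κ ^ 4 * r) := by ring
            _ ≤ 3888 * κ * R * 1 := mul_le_mul_of_nonneg_left hT (by positivity)
            _ = _ := mul_one _
        -- The noise floor receives a quarter of ε: 4 · 432 · 136 < 300000.
        have h3 : 432 * l * κ ^ 3 * (136 * (l / μ) * A * N) ≤ ε ^ 2 / 4 := by
          rw [← hκ]
          have : 0 ≤ l * κ ^ 4 * A * N := by positivity
          calc 432 * l * κ ^ 3 * (136 * κ * A * N) = 58752 * (l * κ ^ 4 * A * N) := by ring
            _ ≤ _ := by linarith
        have h4 : 432 * l * κ ^ 3 / ε * (r * U₀ + 136 * (l / μ) * A * N)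
            ≤ (3888 * κ * R + ε ^ 2 / 4) / ε := by
          rw [div_mul_eq_mul_div]
          gcongr
          linarith
        have h5 : (3888 * κ * R + ε ^ 2 / 4) / ε = 3888 * κ / ε * R + ε / 4 := by field_simp
        have h6 : 0 ≤ κ / ε * R := by positivity
        have h7 : 48 * κ / ε * R + 3888 * κ / ε * R ≤ 4000 * κ / ε * R := by
          have : 4000 * κ / ε * R - (48 * κ / ε * R + 3888 * κ / ε * R) = 64 * (κ / ε * R) := by
            ring
          linarith
        linarith

theorem output_eq (l : ℝ) (m : ℕ) (a b : Params) (loss : ∀ i, E d₁ → E d₂ → Ξ i → ℝ)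
    (x₀ : E d₁) (y₀ : E d₂) (z₀ : E d₁) (ω : TwoStageDraw Ξ a.T) {q : E d₁ × E d₂ × E d₁}
    (hq : iter (roundStep (2 * l) m a loss) (x₀, y₀, z₀) ω.2.1 ω.1 = q) :
    output l m a b loss x₀ y₀ z₀ ω
      = (iter (roundStep 0 m b (proxLoss l loss q.1)) (q.1, q.2.1, q.1) ω.2.2 b.T).1 := by
  rw [run_eq_iter] at hq
  rw [← hq, run_eq_iter]
  rfl

theorem measurable_second_stage (h : NCPL l μ σ σG D loss) (m : ℕ) (b : Params) :
    Measurable fun q : (E d₁ × E d₂ × E d₁) × (ℕ → RoundDraw Ξ) =>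
      (iter (roundStep 0 m b (proxLoss l loss q.1.1)) (q.1.1, q.1.2.1, q.1.1) q.2 b.T).1 := by
  have h1 := measurable_roundStep (C := E d₁) (lossC := fun c => proxLoss l loss c)
    h.measurable_sgrad_proxLoss 0 m b
  exact measurable_iter_restart (step := fun c => roundStep 0 m b (proxLoss l loss c)) h1 b.T

theorem measurable_output (h : NCPL l μ σ σG D loss) (m : ℕ) (a b : Params) (x₀ : E d₁)
    (y₀ : E d₂) (z₀ : E d₁) : Measurable (output l m a b loss x₀ y₀ z₀) := by
  -- The random index takes finitely many values, so each one is treated separately.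
  refine measurable_from_prod_countable_right fun t => ?_
  have h1 := measurable_iter_snd
    (measurable_roundStep_of (fun i => h.measurable_sgrad i) (2 * l) m a) (x₀, y₀, z₀) t
  have h2 : Measurable fun ω : (ℕ → RoundDraw Ξ) × (ℕ → RoundDraw Ξ) =>
      (iter (roundStep (2 * l) m a loss) (x₀, y₀, z₀) ω.1 t, ω.2) :=
    (h1.comp measurable_fst).prodMk measurable_snd
  have h3 := (h.measurable_second_stage m b).comp h2
  have e : (fun ω : (ℕ → RoundDraw Ξ) × (ℕ → RoundDraw Ξ) =>
      output l m a b loss x₀ y₀ z₀ (t, ω)) = _ :=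
    funext fun ω => output_eq l m a b loss x₀ y₀ z₀ (t, ω) rfl
  rw [e]
  exact h3

/-- The guarantee of the two-stage method in terms of the effective step sizes. -/
theorem expected_gradient_le (h : NCPL l μ σ σG D loss) (hl : 0 < l) (hμ : 0 < μ) (hμl : μ ≤ l)
    (hκ : κ = l / μ) (hε : 0 < ε) (hm : 1 ≤ m) (hmM : m ≤ M) {ν₁ A₁ ν₂ A₂ Δ : ℝ}
    (ha : StepParams l σ σG ν₁ A₁ a) (hβ : a.β = A₁ / 4 * μ / 64) (hA₁ : 0 < A₁)
    (hAl₁ : A₁ * l ≤ 1 / 100) (hνμ₁ : 30000 * l * ν₁ ≤ μ)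
    (hν₁ : ν₁ ≤ l * A₁ * roundVar σ σG M m a.K) (hT₁ : 0 < a.T)
    (hb : StepParams (3 * l) σ σG ν₂ A₂ b) (hA₂ : 0 < A₂)
    (hAl₂ : A₂ * l ≤ 1 / 100) (hνμ₂ : 30000 * l * ν₂ ≤ μ)
    (hν₂ : ν₂ ≤ l * A₂ * roundVar σ σG M m b.K)
    (hV₁ : 2000000000 * (l * κ * A₁ * roundVar σ σG M m a.K) ≤ ε ^ 2)
    (hΔ₁ : 40000000 * (κ * Δ) ≤ ε ^ 2 * (A₁ * a.T))
    (hT₂ : κ ^ 4 * (1 - A₂ * μ / 4) ^ b.T ≤ 1)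
    (hV₂ : 300000 * (l * κ ^ 4 * A₂ * roundVar σ σG M m b.K) ≤ ε ^ 2) (x₀ : E d₁) (y₀ : E d₂)
    (z₀ : E d₁) (hgap : gap (2 * l) (obj D loss) x₀ y₀ z₀ ≤ Δ) :
    Integrable (fun ω => ‖gradient (primal (obj D loss)) (output l m a b loss x₀ y₀ z₀ ω)‖)
      (twoStageLaw m a.T D) ∧
    ∫ ω, ‖gradient (primal (obj D loss)) (output l m a b loss x₀ y₀ z₀ ω)‖
      ∂(twoStageLaw m a.T D) ≤ ε := by
  have := isProbabilityMeasure_subsetLaw hmM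
  have hP : IsProbabilityMeasure (drawLaw m D) := by rw [drawLaw_eq]; infer_instance
  have hf := h.smoothPL (hm.trans hmM) hl hμ
  have hN := roundVar_nonneg σ σG M m a.K
  have hκ0 : 0 < κ := by rw [hκ]; positivity
  have hmeas : Measurable fun ω : TwoStageDraw Ξ a.T =>
      ‖gradient (primal (obj D loss)) (output l m a b loss x₀ y₀ z₀ ω)‖ :=
    (hf.continuous_gradient_primal.measurable.comp
      (h.measurable_output m a b x₀ y₀ z₀)).norm
  set step := roundStep (2 * l) m a loss
  set s₀ : E d₁ × E d₂ × E d₁ := (x₀, y₀, z₀)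
  have hΔ : lyapunov l (obj D loss) s₀.1 s₀.2.1 s₀.2.2 - ⨅ x, primal (obj D loss) x ≤ Δ := by
    have h1 : gap (2 * l) (obj D loss) x₀ y₀ z₀ = lyapunov l (obj D loss) x₀ y₀ z₀
        - ⨅ x, primal (obj D loss) x := by rw [gap, hf.potential_eq]; rfl
    rw [← h1]; exact hgap
  have hΔ0 : 0 ≤ Δ := (sub_nonneg.2 (hf.iInf_primal_le_lyapunov s₀.1 s₀.2.1 s₀.2.2)).trans hΔ
  have hsum := sum_residual_le hf hμl h.fedOracle ha hβ hA₁ hAl₁ hνμ₁ hν₁ hm hmM s₀ hΔ a.T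
  set N := roundVar σ σG M m a.K
  set ρ : E d₁ × E d₂ × E d₁ → ENNReal := fun s =>
    ENNReal.ofReal (A₁ / 1024 * residual l μ (obj D loss) s.1 s.2.1 s.2.2) with hρ
  have hρm : Measurable ρ := (hf.continuous_residual.measurable.const_mul _).ennreal_ofReal
  -- 4096000 = 4000 · 1024 undoes the factor A₁/1024 in `ρ`.
  set c := 4096000 * κ / (ε * A₁) with hc
  have hc0 : 0 ≤ c := by positivity
  have hinner : ∀ (t : Fin a.T) (ω₁ : ℕ → RoundDraw Ξ),
      ∫⁻ ω₂, ENNReal.ofReal ‖gradient (primal (obj D loss))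
        (output l m a b loss x₀ y₀ z₀ (t, ω₁, ω₂))‖ ∂(drawLaw m D)
      ≤ ENNReal.ofReal (3 / 4 * ε) + ENNReal.ofReal c * ρ (iter step s₀ ω₁ t) := by
    intro t ω₁
    obtain ⟨q, hq⟩ : ∃ q, iter step s₀ ω₁ t = q := ⟨_, rfl⟩
    have e : ∀ ω₂, output l m a b loss x₀ y₀ z₀ (t, ω₁, ω₂)
        = (iter (roundStep 0 m b (proxLoss l loss q.1)) (q.1, q.2.1, q.1) ω₂ b.T).1 := fun ω₂ =>
      output_eq l m a b loss x₀ y₀ z₀ (t, ω₁, ω₂) hq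
    simp only [e, hq]
    have hR : 0 ≤ residual l μ (obj D loss) q.1 q.2.1 q.2.2 := by unfold residual; positivity
    refine (h.second_stage_le hl hμ hμl hκ hε hb hA₂ hAl₂ hνμ₂ hν₂ hm hmM hT₂ hV₂ q.1 q.2.1
      q.2.2).trans ?_
    rw [hρ, ← ENNReal.ofReal_mul hc0, ← ENNReal.ofReal_add (by positivity) (by positivity)]
    refine ENNReal.ofReal_le_ofReal (le_of_eq ?_)
    rw [hc]
    field_simp
    ring
  have hbound : ∫⁻ ω, ENNReal.ofReal ‖gradient (primal (obj D loss))
      (output l m a b loss x₀ y₀ z₀ ω)‖ ∂(twoStageLaw m a.T D) ≤ ENNReal.ofReal ε := by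
    have hT0 : (0 : ℝ) < a.T := by exact_mod_cast hT₁
    have ht : ∀ t : Fin a.T, ∫⁻ ω, ENNReal.ofReal ‖gradient (primal (obj D loss))
        (output l m a b loss x₀ y₀ z₀ (t, ω))‖ ∂((drawLaw m D).prod (drawLaw m D))
        ≤ ENNReal.ofReal (3 / 4 * ε)
          + ENNReal.ofReal c * ∫⁻ ω, ρ (iter step s₀ ω t) ∂(drawLaw m D) := by
      intro t
      have hs := measurable_roundStep_of (fun i => h.measurable_sgrad i) (2 * l) m a
      have hmt : Measurable fun ω : (ℕ → RoundDraw Ξ) × (ℕ → RoundDraw Ξ) =>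
          ENNReal.ofReal ‖gradient (primal (obj D loss))
            (output l m a b loss x₀ y₀ z₀ (t, ω))‖ :=
        (hmeas.comp measurable_prodMk_left).ennreal_ofReal
      rw [lintegral_prod _ hmt.aemeasurable]
      refine (lintegral_mono fun ω₁ => hinner t ω₁).trans_eq ?_
      rw [lintegral_add_left measurable_const, lintegral_const_mul' _ _ ENNReal.ofReal_ne_top,
        lintegral_const, measure_univ, mul_one]
    rw [twoStageLaw, lintegral_prod _ hmeas.ennreal_ofReal.aemeasurable, lintegral_uniformOn_univ]
    have hTT : (a.T : ENNReal)⁻¹ = ENNReal.ofReal (a.T : ℝ)⁻¹ := by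
      rw [ENNReal.ofReal_inv_of_pos hT0, ENNReal.ofReal_natCast]
    calc _ ≤ (a.T : ENNReal)⁻¹ * ∑ t : Fin a.T, (ENNReal.ofReal (3 / 4 * ε)
          + ENNReal.ofReal c * ∫⁻ ω, ρ (iter step s₀ ω t) ∂(drawLaw m D)) := by
          gcongr with t
          exact ht t
      _ = (a.T : ENNReal)⁻¹ * (a.T * ENNReal.ofReal (3 / 4 * ε) + ENNReal.ofReal c
          * ∑ t ∈ Finset.range a.T, ∫⁻ ω, ρ (iter step s₀ ω t) ∂(drawLaw m D)) := by
          rw [Finset.sum_add_distrib, Finset.sum_const, Finset.card_univ, Fintype.card_fin,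
            nsmul_eq_mul, ← Finset.mul_sum,
            Fin.sum_univ_eq_sum_range (fun t => ∫⁻ ω, ρ (iter step s₀ ω t) ∂(drawLaw m D)) a.T]
      _ ≤ (a.T : ENNReal)⁻¹ * (a.T * ENNReal.ofReal (3 / 4 * ε) + ENNReal.ofReal c
          * ENNReal.ofReal (Δ + a.T * (34 * l * A₁ ^ 2 * N))) := by gcongr
      _ ≤ _ := by
          rw [hTT, ← ENNReal.ofReal_natCast, ← ENNReal.ofReal_mul hT0.le,
            ← ENNReal.ofReal_mul hc0, ← ENNReal.ofReal_add (by positivity) (by positivity),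
            ← ENNReal.ofReal_mul (by positivity)]
          refine ENNReal.ofReal_le_ofReal ?_
          -- Besides the 3ε/4 of the second stage, ε/8 goes to the initial gap and ε/8 to the
          -- variance of the first stage; `hΔ₁` and `hV₁` are sized for this.
          have k1 : c * Δ ≤ a.T * ε / 8 := by
            rw [hc, div_mul_eq_mul_div, div_le_iff₀ (by positivity)]
            have : 0 ≤ κ * Δ := by positivity
            linarith
          have k2 : c * (34 * l * A₁ ^ 2 * N) ≤ ε / 8 := by
            rw [hc, div_mul_eq_mul_div, div_le_iff₀ (by positivity)]
            have k3 := mul_le_mul_of_nonneg_right hV₁ hA₁.le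
            have : 0 ≤ l * κ * A₁ * N * A₁ := by positivity
            linarith
          have k4 := mul_le_mul_of_nonneg_left k2 hT0.le
          rw [inv_mul_le_iff₀ hT0]
          linarith
  have hint : Integrable (fun ω => ‖gradient (primal (obj D loss))
      (output l m a b loss x₀ y₀ z₀ ω)‖) (twoStageLaw m a.T D) := by
    refine ⟨hmeas.aestronglyMeasurable, ?_⟩
    rw [hasFiniteIntegral_iff_ofReal (Filter.Eventually.of_forall fun ω => norm_nonneg _)]
    exact hbound.trans_lt ENNReal.ofReal_lt_top
  refine ⟨hint, ?_⟩
  rw [integral_eq_lintegral_of_nonneg_ae (Filter.Eventually.of_forall fun ω => norm_nonneg _)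
    hmeas.aestronglyMeasurable]
  exact ENNReal.toReal_le_of_le_ofReal hε.le hbound

end NCPL

end TwoStage

/-! ### Choice of the step sizes. -/

section Parameters

/-- Both conditions only ask δ² to be small; the inverse of a sum meets them together. No lower
bound on δ is needed, since the global step compensates. -/
theorem exists_local_step {L ν : ℝ} (hL : 0 < L) (hν : 0 < ν) (σ σG : ℝ) (K : ℕ) :
    ∃ δ : ℝ, 0 < δ ∧ 8 * δ ^ 2 * (2 * L ^ 2) ≤ 1 ∧
      2 * L ^ 2 * 3 ^ K * δ ^ 2 * (2 * σ ^ 2 + 8 * σG ^ 2 + 8) ≤ ν := by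
  set B := 2 * L ^ 2 * 3 ^ K * (2 * σ ^ 2 + 8 * σG ^ 2 + 8) with hB
  have hB0 : 0 < B := by positivity
  have hQ : 0 < 16 * L ^ 2 + B / ν := by positivity
  refine ⟨√((16 * L ^ 2 + B / ν)⁻¹), by positivity, ?_, ?_⟩ <;> rw [Real.sq_sqrt (by positivity)]
  · have h1 : 16 * L ^ 2 ≤ 16 * L ^ 2 + B / ν := by linarith [div_pos hB0 hν]
    calc _ = 16 * L ^ 2 * (16 * L ^ 2 + B / ν)⁻¹ := by ring
      _ ≤ (16 * L ^ 2 + B / ν) * (16 * L ^ 2 + B / ν)⁻¹ :=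
        mul_le_mul_of_nonneg_right h1 (by positivity)
      _ = 1 := mul_inv_cancel₀ hQ.ne'
  · have h1 : B / ν ≤ 16 * L ^ 2 + B / ν := by linarith [sq_nonneg L]
    calc _ = ν * (B / ν * (16 * L ^ 2 + B / ν)⁻¹) := by rw [hB]; field_simp
      _ ≤ ν * ((16 * L ^ 2 + B / ν) * (16 * L ^ 2 + B / ν)⁻¹) :=
        mul_le_mul_of_nonneg_left (mul_le_mul_of_nonneg_right h1 (by positivity)) hν.le
      _ = ν := by rw [mul_inv_cancel₀ hQ.ne', mul_one]

theorem exists_params {L ν A β : ℝ} (hL : 0 < L) (hν : 0 < ν) (hA : 0 < A)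
    (hβ : β ∈ Set.Ioo (0 : ℝ) 1) (σ σG : ℝ) {K T : ℕ} (hK : 0 < K) (hT : 0 < T) :
    ∃ a : Params, a.Valid ∧ StepParams L σ σG ν A a ∧ a.K = K ∧ a.T = T ∧ a.β = β := by
  obtain ⟨δ, hδ, h1, h2⟩ := exists_local_step hL hν σ σG K
  have hK0 : (0 : ℝ) < K := by exact_mod_cast hK
  -- The global steps undo δ and the number of local steps, which fixes the effective steps A and
  -- A/4.
  refine ⟨⟨δ, δ, A / (δ * K), A / 4 / (δ * K), β, K, T⟩,
    ⟨hδ, hδ, div_pos hA (by positivity), div_pos (by positivity) (by positivity), hβ, hK, hT⟩,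
    ⟨hK, rfl, ?_, ?_, h1, h2⟩, rfl, rfl, rfl⟩
  · change δ * (A / (δ * K)) * K = A
    field_simp
  · change δ * (A / 4 / (δ * K)) * K = A / 4
    field_simp

theorem roundVar_pos {σ : ℝ} (hσ : 0 < σ) (σG : ℝ) (M : ℕ) {m K : ℕ} (hm : 0 < m) (hK : 0 < K) :
    0 < roundVar σ σG M m K := by
  have : (0 : ℝ) < m := by exact_mod_cast hm
  have : (0 : ℝ) < K := by exact_mod_cast hK
  exact add_pos_of_pos_of_nonneg (by positivity) (sampVar_nonneg M m σG)

/-- Parameters of the two stages with prescribed effective step sizes and numbers of updates. -/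
theorem exists_two_stage_params {l μ σ σG κ ε Δ A₁ A₂ : ℝ} {M m K₁ T₁ K₂ T₂ : ℕ} (hl : 0 < l)
    (hμ : 0 < μ) (hμl : μ ≤ l) (hκ : κ = l / μ) (hε : 0 < ε) (hσ : 0 < σ) (hm : 1 ≤ m)
    (hmM : m ≤ M) (hA₁ : 0 < A₁) (hAl₁ : A₁ * l ≤ 1 / 100) (hA₂ : 0 < A₂)
    (hAl₂ : A₂ * l ≤ 1 / 100) (hK₁ : 0 < K₁) (hT₁ : 0 < T₁) (hK₂ : 0 < K₂) (hT₂ : 0 < T₂)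
    (hV₁ : 2000000000 * (l * κ * A₁ * roundVar σ σG M m K₁) ≤ ε ^ 2)
    (hΔ₁ : 40000000 * (κ * Δ) ≤ ε ^ 2 * (A₁ * T₁))
    (hc₂ : κ ^ 4 * (1 - A₂ * μ / 4) ^ T₂ ≤ 1)
    (hV₂ : 300000 * (l * κ ^ 4 * A₂ * roundVar σ σG M m K₂) ≤ ε ^ 2) :
    ∃ a b : Params, a.Valid ∧ b.Valid ∧ a.K = K₁ ∧ a.T = T₁ ∧ b.K = K₂ ∧ b.T = T₂ ∧
      ∀ (d₁ d₂ : ℕ) (Ξ : Fin M → Type u) [∀ i, MeasurableSpace (Ξ i)]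
        (D : ∀ i, Measure (Ξ i)) [∀ i, IsProbabilityMeasure (D i)]
        (loss : ∀ i, E d₁ → E d₂ → Ξ i → ℝ) (x₀ : E d₁) (y₀ : E d₂) (z₀ : E d₁),
        NCPL l μ σ σG D loss →
        gap (2 * l) (obj D loss) x₀ y₀ z₀ ≤ Δ →
        Differentiable ℝ (primal (obj D loss)) ∧
        Integrable (fun ω => ‖gradient (primal (obj D loss))
          (output l m a b loss x₀ y₀ z₀ ω)‖) (twoStageLaw m a.T D) ∧
        ∫ ω, ‖gradient (primal (obj D loss))
          (output l m a b loss x₀ y₀ z₀ ω)‖ ∂(twoStageLaw m a.T D) ≤ ε := by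
  have hA₁μ : A₁ * μ ≤ 1 / 100 := (mul_le_mul_of_nonneg_left hμl hA₁.le).trans hAl₁
  have hN₁ := roundVar_pos hσ σG M hm hK₁
  have hN₂ := roundVar_pos hσ σG M hm hK₂
  have hA₁μ0 : 0 < A₁ * μ := by positivity
  -- The drift is made small against both the descent and the noise. The minimum is positive because
  -- σ > 0 makes the round variance positive.
  obtain ⟨a, va, sa, aK, aT, aβ⟩ := exists_params (ν := min (μ / (30000 * l))
    (l * A₁ * roundVar σ σG M m K₁)) (β := A₁ / 4 * μ / 64) hl
    (lt_min (by positivity) (by positivity)) hA₁ ⟨by positivity, by linarith⟩ σ σG hK₁ hT₁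
  -- With p = 0 the center does not influence x and y, so β = 1/2 is arbitrary. The constant 3l is
  -- that of the regularized losses.
  obtain ⟨b, vb, sb, bK, bT, -⟩ := exists_params (ν := min (μ / (30000 * l))
    (l * A₂ * roundVar σ σG M m K₂)) (β := 1 / 2) (by positivity : 0 < 3 * l)
    (lt_min (by positivity) (by positivity)) hA₂ ⟨by norm_num, by norm_num⟩ σ σG hK₂ hT₂
  refine ⟨a, b, va, vb, aK, aT, bK, bT, fun d₁ d₂ Ξ _ D _ loss x₀ y₀ z₀ h hgap => ?_⟩
  subst aK aT bK bT
  have hmin : ∀ r : ℝ, 30000 * l * min (μ / (30000 * l)) r ≤ μ := fun r =>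
    (mul_le_mul_of_nonneg_left (min_le_left _ _) (by positivity)).trans_eq
      (mul_div_cancel₀ _ (by positivity))
  exact ⟨(h.smoothPL (hm.trans hmM) hl hμ).primal_differentiable,
    h.expected_gradient_le hl hμ hμl hκ hε hm hmM sa aβ hA₁ hAl₁ (hmin _) (min_le_right _ _) hT₁
      sb hA₂ hAl₂ (hmin _) (min_le_right _ _) hV₁ hΔ₁ hc₂ hV₂ x₀ y₀ z₀ hgap⟩

theorem pow_mul_one_sub_pow_le_one {κ x : ℝ} {T : ℕ} (hκ : 0 < κ) (hx : x ≤ 1)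
    (hT : 4 * Real.log κ ≤ T * x) : κ ^ 4 * (1 - x) ^ T ≤ 1 := by
  have h1 : (1 - x) ^ T ≤ Real.exp (-(T * x)) := by
    rw [← mul_neg, Real.exp_nat_mul]
    exact pow_le_pow_left₀ (by linarith) (Real.one_sub_le_exp_neg x) T
  have h2 : κ ^ 4 = Real.exp (4 * Real.log κ) := by
    rw [show (4 : ℝ) = ((4 : ℕ) : ℝ) by norm_num, Real.exp_nat_mul, Real.exp_log hκ]
  calc κ ^ 4 * (1 - x) ^ T ≤ Real.exp (4 * Real.log κ) * Real.exp (-(T * x)) := by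
        rw [← h2]; exact mul_le_mul_of_nonneg_left h1 (by positivity)
    _ = Real.exp (4 * Real.log κ - T * x) := by rw [← Real.exp_add, sub_eq_add_neg]
    _ ≤ 1 := Real.exp_le_one_iff.2 (by linarith)

/-- The added 1 keeps the count positive when r = 0, as happens with log κ at κ = 1. -/
theorem ceil_succ_bounds {r : ℝ} (hr : 0 ≤ r) :
    0 < ⌈r⌉₊ + 1 ∧ r ≤ ((⌈r⌉₊ + 1 : ℕ) : ℝ) ∧ ((⌈r⌉₊ + 1 : ℕ) : ℝ) ≤ r + 2 := by
  have h1 := Nat.le_ceil r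
  have h2 := Nat.ceil_lt_add_one hr
  refine ⟨Nat.succ_pos _, ?_, ?_⟩ <;> push_cast <;> linarith

/-- Rounding T₂ up leaves a cost κ⁴/(mε²) without the logarithm, which may vanish. For κ ≤ 2 the
condition mε² ≤ κ bounds ε and the ε⁻⁴ term absorbs it; for κ ≥ 2, log κ ≥ 1/2. -/
theorem kappa_pow_four_le {κ ε m : ℝ} (hκ : 1 ≤ κ) (hε : 0 < ε) (hm : 1 ≤ m)
    (hmε : m * ε ^ 2 ≤ κ) :
    κ ^ 4 / (m * ε ^ 2) ≤ 8 * (κ ^ 2 / (m * ε ^ 4))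
      + 2 * (κ ^ 5 / (m * ε ^ 2) * Real.log κ) := by
  have hlog := Real.log_nonneg hκ
  have hm0 : 0 < m := by linarith
  rcases le_total κ 2 with h | h
  · have h1 : ε ^ 2 ≤ 2 := by nlinarith [sq_nonneg ε]
    have h2 : κ ^ 2 * ε ^ 2 ≤ 8 := by nlinarith [sq_nonneg ε, sq_nonneg κ]
    have h3 : κ ^ 4 / (m * ε ^ 2) = κ ^ 2 / (m * ε ^ 4) * (κ ^ 2 * ε ^ 2) := by field_simp
    have h4 := mul_le_mul_of_nonneg_left h2 (by positivity : 0 ≤ κ ^ 2 / (m * ε ^ 4))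
    have h5 : 0 ≤ κ ^ 5 / (m * ε ^ 2) * Real.log κ := by positivity
    linarith
  · have h1 : 1 / 2 ≤ Real.log κ :=
      (by linarith [Real.log_two_gt_d9] : 1 / 2 ≤ Real.log 2).trans
        (Real.log_le_log (by norm_num) h)
    have h2 : κ ^ 4 / (m * ε ^ 2) * 1 ≤ κ ^ 4 / (m * ε ^ 2) * (κ * (2 * Real.log κ)) :=
      mul_le_mul_of_nonneg_left (by nlinarith) (by positivity)
    have h3 : κ ^ 4 / (m * ε ^ 2) * (κ * (2 * Real.log κ))
        = 2 * (κ ^ 5 / (m * ε ^ 2) * Real.log κ) := by ring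
    have h4 : 0 ≤ κ ^ 2 / (m * ε ^ 4) := by positivity
    linarith

end Parameters

/-! ### Rounds and samples of the two stages. -/

section Costs

variable {d₁ d₂ M : ℕ} {Ξ : Fin M → Type u}

theorem commCost_eq (l : ℝ) (m : ℕ) (a b : Params) (loss : ∀ i, E d₁ → E d₂ → Ξ i → ℝ)
    (x₀ : E d₁) (y₀ : E d₂) (z₀ : E d₁) (ω : TwoStageDraw Ξ a.T) :
    commCost l m a b loss x₀ y₀ z₀ ω = a.T + b.T :=
  congrArg₂ (· + ·) (run_rounds _ _ _ _ _ _ _ _ _) (run_rounds _ _ _ _ _ _ _ _ _)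

theorem sampleCost_le (l : ℝ) (m : ℕ) (a b : Params) (loss : ∀ i, E d₁ → E d₂ → Ξ i → ℝ)
    (x₀ : E d₁) (y₀ : E d₂) (z₀ : E d₁) (ω : TwoStageDraw Ξ a.T) (i : Fin M) :
    sampleCost l m a b loss x₀ y₀ z₀ ω i ≤ a.T * a.K + b.T * b.K :=
  Nat.add_le_add (run_samples_le _ _ _ _ _ _ _ _ _ _) (run_samples_le _ _ _ _ _ _ _ _ _ _)

end Costs

/-! ### Schedules for the two regimes. -/

section Regimes

variable {l μ σ σG κ ε Δ : ℝ} {M m : ℕ}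

/-- Numbers of updates in the absence of sampling error. -/
theorem exists_schedule_of_sampVar_eq_zero (hl : 0 < l) (hμ : 0 < μ) (hμl : μ ≤ l)
    (hκ : κ = l / μ) (hε : 0 < ε) (hΔ : 0 < Δ) (hm : 1 ≤ m)
    (hmε : m * ε ^ 2 ≤ κ) (hs : sampVar M m σG = 0) :
    ∃ (A : ℝ) (K₁ T₁ K₂ T₂ : ℕ), 0 < A ∧ A * l ≤ 1 / 100 ∧ 0 < K₁ ∧ 0 < T₁ ∧ 0 < K₂ ∧ 0 < T₂ ∧
      2000000000 * (l * κ * A * roundVar σ σG M m K₁) ≤ ε ^ 2 ∧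
      40000000 * (κ * Δ) ≤ ε ^ 2 * (A * T₁) ∧
      κ ^ 4 * (1 - A * μ / 4) ^ T₂ ≤ 1 ∧
      300000 * (l * κ ^ 4 * A * roundVar σ σG M m K₂) ≤ ε ^ 2 ∧
      ((T₁ * K₁ + T₂ * K₂ : ℕ) : ℝ) ≤ ((4000000000 * Δ * l + 2) * (20000000 * σ ^ 2 + 2)
        + 1604 * (3000 * σ ^ 2 + 2) + 4000000000 * Δ * l + 1604)
          * (κ ^ 2 / (m * ε ^ 4) + κ ^ 5 / (m * ε ^ 2) * Real.log κ) ∧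
      ((T₁ + T₂ : ℕ) : ℝ) ≤ ((4000000000 * Δ * l + 2) * (20000000 * σ ^ 2 + 2)
        + 1604 * (3000 * σ ^ 2 + 2) + 4000000000 * Δ * l + 1604)
          * (κ / ε ^ 2 + κ * Real.log κ) := by
  have hm0 : (1 : ℝ) ≤ m := by exact_mod_cast hm
  have hmpos : (0 : ℝ) < m := by linarith
  have hκ1 : 1 ≤ κ := by rw [hκ, one_le_div hμ]; exact hμl
  have hκ0 : 0 < κ := by linarith
  have hlog := Real.log_nonneg hκ1
  have hlκ : l = κ * μ := by rw [hκ]; field_simp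
  -- The condition mε² ≤ κ enters here: reference quantities of size at least 1 absorb additive
  -- rounding constants.
  have q1 : 1 ≤ κ / (m * ε ^ 2) := (one_le_div (by positivity)).2 hmε
  have q2 : 1 ≤ κ / ε ^ 2 := by
    rw [one_le_div (by positivity)]
    nlinarith [sq_nonneg ε]
  have q4 : 1 ≤ κ ^ 4 / (m * ε ^ 2) := by
    refine q1.trans ?_
    gcongr
    exact le_self_pow₀ hκ1 (by norm_num)
  obtain ⟨p1, a1, b1⟩ := ceil_succ_bounds
    (by positivity : 0 ≤ 20000000 * σ ^ 2 * (κ / (m * ε ^ 2)))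
  obtain ⟨p2, a2, b2⟩ := ceil_succ_bounds
    (by positivity : 0 ≤ 4000000000 * Δ * l * (κ / ε ^ 2))
  obtain ⟨p3, a3, b3⟩ := ceil_succ_bounds
    (by positivity : 0 ≤ 3000 * σ ^ 2 * (κ ^ 4 / (m * ε ^ 2)))
  obtain ⟨p4, a4, b4⟩ := ceil_succ_bounds
    (by positivity : 0 ≤ 1600 * (κ * Real.log κ))
  set K₁ := ⌈20000000 * σ ^ 2 * (κ / (m * ε ^ 2))⌉₊ + 1
  set T₁ := ⌈4000000000 * Δ * l * (κ / ε ^ 2)⌉₊ + 1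
  set K₂ := ⌈3000 * σ ^ 2 * (κ ^ 4 / (m * ε ^ 2))⌉₊ + 1
  set T₂ := ⌈1600 * (κ * Real.log κ)⌉₊ + 1
  have hK₁ : (0 : ℝ) < K₁ := by exact_mod_cast p1
  have hK₂ : (0 : ℝ) < K₂ := by exact_mod_cast p3
  have hAl : 1 / (100 * l) * l = 1 / 100 := by field_simp
  have hvar : ∀ K : ℕ, roundVar σ σG M m K = σ ^ 2 / (m * K) := fun K => by
    rw [roundVar, hs, add_zero]
  -- The largest admissible effective step; all variance reduction is left to the local steps, so
  -- the number of rounds is free of σ and m.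
  refine ⟨1 / (100 * l), K₁, T₁, K₂, T₂, by positivity, hAl.le, p1, p2, p3, p4, ?_, ?_, ?_, ?_,
    ?_, ?_⟩
  · have e : 2000000000 * (l * κ * (1 / (100 * l)) * roundVar σ σG M m K₁)
        = 20000000 * σ ^ 2 * (κ / (m * ε ^ 2)) * (ε ^ 2 / K₁) := by
      rw [hvar]; field_simp; ring
    rw [e]
    calc _ ≤ (K₁ : ℝ) * (ε ^ 2 / K₁) := mul_le_mul_of_nonneg_right a1 (by positivity)
      _ = _ := by field_simp
  · have e : 40000000 * (κ * Δ) = 4000000000 * Δ * l * (κ / ε ^ 2) * (ε ^ 2 * (1 / (100 * l))) := by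
      field_simp; ring
    rw [e]
    calc _ ≤ (T₁ : ℝ) * (ε ^ 2 * (1 / (100 * l))) := mul_le_mul_of_nonneg_right a2 (by positivity)
      _ = _ := by ring
  · have e : 1 / (100 * l) * μ / 4 = 1 / (400 * κ) := by rw [hlκ]; field_simp; ring
    rw [e]
    refine pow_mul_one_sub_pow_le_one hκ0 ((div_le_one (by positivity)).2 (by linarith)) ?_
    have := mul_le_mul_of_nonneg_right a4 (by positivity : 0 ≤ 1 / (400 * κ))
    refine le_trans (le_of_eq ?_) this
    field_simp; ring
  · have e : 300000 * (l * κ ^ 4 * (1 / (100 * l)) * roundVar σ σG M m K₂)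
        = 3000 * σ ^ 2 * (κ ^ 4 / (m * ε ^ 2)) * (ε ^ 2 / K₂) := by
      rw [hvar]; field_simp; ring
    rw [e]
    calc _ ≤ (K₂ : ℝ) * (ε ^ 2 / K₂) := mul_le_mul_of_nonneg_right a3 (by positivity)
      _ = _ := by field_simp
  -- Needed for the product of `K₂` with the rounding constant 2 of `T₂`.
  · have h4 := kappa_pow_four_le hκ1 hε hm0 hmε
    have c1 : (T₁ : ℝ) ≤ (4000000000 * Δ * l + 2) * (κ / ε ^ 2) := by linarith
    have c2 : (K₁ : ℝ) ≤ (20000000 * σ ^ 2 + 2) * (κ / (m * ε ^ 2)) := by linarith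
    have c3 : (K₂ : ℝ) ≤ (3000 * σ ^ 2 + 2) * (κ ^ 4 / (m * ε ^ 2)) := by linarith
    have d1 : (T₁ : ℝ) * K₁ ≤ (4000000000 * Δ * l + 2) * (20000000 * σ ^ 2 + 2)
        * (κ ^ 2 / (m * ε ^ 4)) := by
      refine (mul_le_mul c1 c2 (by positivity) (by positivity)).trans_eq ?_
      field_simp
    have d2 : (T₂ : ℝ) * K₂ ≤ (3000 * σ ^ 2 + 2) * (1600 * (κ ^ 5 / (m * ε ^ 2) * Real.log κ)
        + 2 * (κ ^ 4 / (m * ε ^ 2))) := by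
      refine (mul_le_mul b4 c3 (by positivity) (by positivity)).trans_eq ?_
      ring
    have d3 := mul_le_mul_of_nonneg_left h4 (by positivity : 0 ≤ 2 * (3000 * σ ^ 2 + 2))
    set P := κ ^ 2 / (m * ε ^ 4)
    set Q := κ ^ 5 / (m * ε ^ 2) * Real.log κ
    have hP : 0 ≤ P := by positivity
    have hQ : 0 ≤ Q := by positivity
    have r1 : 0 ≤ (4000000000 * Δ * l + 2) * (20000000 * σ ^ 2 + 2) * Q := by positivity
    have r2 : 0 ≤ (3000 * σ ^ 2 + 2) * P := by positivity
    have r3 : 0 ≤ (4000000000 * Δ * l + 1604) * (P + Q) := by positivity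
    push_cast
    linarith
  · set S := κ / ε ^ 2
    set R := κ * Real.log κ
    have hR : 0 ≤ R := by positivity
    have r1 : 0 ≤ ((4000000000 * Δ * l + 2) * (20000000 * σ ^ 2 + 2) + 1604 * (3000 * σ ^ 2 + 2))
      * (S + R) := by positivity
    have r2 : 0 ≤ 4000000000 * Δ * l * R := by positivity
    push_cast
    linarith

/-- Numbers of updates with one local step per round. -/
theorem exists_schedule_single_step (hl : 0 < l) (hμ : 0 < μ) (hμl : μ ≤ l)
    (hκ : κ = l / μ) (hε : 0 < ε) (hΔ : 0 < Δ) (hσ : 0 < σ) (hm : 1 ≤ m)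
    (hmε : m * ε ^ 2 ≤ κ) (hs : sampVar M m σG ≤ σG ^ 2 / m) :
    ∃ (A₁ A₂ : ℝ) (T₁ T₂ : ℕ), 0 < A₁ ∧ A₁ * l ≤ 1 / 100 ∧ 0 < A₂ ∧ A₂ * l ≤ 1 / 100 ∧
      0 < T₁ ∧ 0 < T₂ ∧
      2000000000 * (l * κ * A₁ * roundVar σ σG M m 1) ≤ ε ^ 2 ∧
      40000000 * (κ * Δ) ≤ ε ^ 2 * (A₁ * T₁) ∧
      κ ^ 4 * (1 - A₂ * μ / 4) ^ T₂ ≤ 1 ∧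
      300000 * (l * κ ^ 4 * A₂ * roundVar σ σG M m 1) ≤ ε ^ 2 ∧
      ((T₁ + T₂ : ℕ) : ℝ) ≤ (4000000000 * l * Δ
        + 80000000000000000 * l * Δ * (σ ^ 2 + σG ^ 2) + 1604 + 4800000 * (σ ^ 2 + σG ^ 2))
          * (κ ^ 2 / (m * ε ^ 4) + κ ^ 5 / (m * ε ^ 2) * Real.log κ) := by
  have hm0 : (1 : ℝ) ≤ m := by exact_mod_cast hm
  have hmpos : (0 : ℝ) < m := by linarith
  have hκ1 : 1 ≤ κ := by rw [hκ, one_le_div hμ]; exact hμl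
  have hκ0 : 0 < κ := by linarith
  have hlog := Real.log_nonneg hκ1
  have hlκ : l = κ * μ := by rw [hκ]; field_simp
  have q1 : 1 ≤ κ / (m * ε ^ 2) := (one_le_div (by positivity)).2 hmε
  have q2 : 1 ≤ κ / ε ^ 2 := by
    rw [one_le_div (by positivity)]
    nlinarith [sq_nonneg ε]
  have q4 : 1 ≤ κ ^ 4 / (m * ε ^ 2) := by
    refine q1.trans ?_
    gcongr
    exact le_self_pow₀ hκ1 (by norm_num)
  set S := σ ^ 2 + σG ^ 2 with hS
  have hS0 : 0 < S := by positivity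
  have hN : roundVar σ σG M m 1 ≤ S / m := by
    rw [roundVar, Nat.cast_one, mul_one, hS, add_div]
    linarith
  have hN0 := roundVar_nonneg σ σG M m 1
  set N := roundVar σ σG M m 1
  -- `B₁` and `B₂` are the inverse step sizes: the first summand ensures stability, the second
  -- pushes the variance below its target with a single local step.
  set B₁ := 100 * l + 2000000000 * (l * κ * (S / m) / ε ^ 2) with hB₁
  set B₂ := 100 * l + 300000 * (l * κ ^ 4 * (S / m) / ε ^ 2) with hB₂
  have hB₁0 : 0 < B₁ := by positivity
  have hB₂0 : 0 < B₂ := by positivity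
  have hB₁l : 100 * l ≤ B₁ := le_add_of_nonneg_right (by positivity)
  have hB₂l : 100 * l ≤ B₂ := le_add_of_nonneg_right (by positivity)
  obtain ⟨p1, a1, b1⟩ := ceil_succ_bounds
    (by positivity : 0 ≤ 40000000 * (κ * Δ) * B₁ / ε ^ 2)
  obtain ⟨p2, a2, b2⟩ := ceil_succ_bounds
    (by positivity : 0 ≤ 16 * Real.log κ * B₂ / μ)
  set T₁ := ⌈40000000 * (κ * Δ) * B₁ / ε ^ 2⌉₊ + 1
  set T₂ := ⌈16 * Real.log κ * B₂ / μ⌉₊ + 1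
  have hstep : ∀ B : ℝ, 0 < B → 100 * l ≤ B → 1 / B * l ≤ 1 / 100 := fun B hB h => by
    rw [div_mul_eq_mul_div, one_mul, div_le_div_iff₀ hB (by norm_num)]
    linarith
  refine ⟨1 / B₁, 1 / B₂, T₁, T₂, by positivity, hstep B₁ hB₁0 hB₁l, by positivity,
    hstep B₂ hB₂0 hB₂l, p1, p2, ?_, ?_, ?_, ?_, ?_⟩
  · have h1 : 2000000000 * (l * κ * N) ≤ ε ^ 2 * B₁ := by
      have h2 : ε ^ 2 * B₁ = ε ^ 2 * (100 * l) + 2000000000 * (l * κ * (S / m)) := by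
        rw [hB₁]; field_simp
      have h3 := mul_le_mul_of_nonneg_left hN (by positivity : 0 ≤ l * κ)
      have h4 : 0 ≤ ε ^ 2 * (100 * l) := by positivity
      linarith
    calc _ = 2000000000 * (l * κ * N) / B₁ := by ring
      _ ≤ _ := (div_le_iff₀ hB₁0).2 h1
  · have := mul_le_mul_of_nonneg_right a1 (by positivity : 0 ≤ ε ^ 2 * (1 / B₁))
    refine le_trans (le_of_eq ?_) (this.trans_eq (by ring))
    field_simp
  · have hx : 1 / B₂ * μ / 4 ≤ 1 := by
      have h1 := hstep B₂ hB₂0 hB₂l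
      have h2 := mul_le_mul_of_nonneg_left hμl (by positivity : 0 ≤ 1 / B₂)
      linarith
    refine pow_mul_one_sub_pow_le_one hκ0 hx ?_
    have := mul_le_mul_of_nonneg_right a2 (by positivity : 0 ≤ 1 / B₂ * μ / 4)
    refine le_trans (le_of_eq ?_) this
    field_simp; ring
  · have h1 : 300000 * (l * κ ^ 4 * N) ≤ ε ^ 2 * B₂ := by
      have h2 : ε ^ 2 * B₂ = ε ^ 2 * (100 * l) + 300000 * (l * κ ^ 4 * (S / m)) := by
        rw [hB₂]; field_simp
      have h3 := mul_le_mul_of_nonneg_left hN (by positivity : 0 ≤ l * κ ^ 4)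
      have h4 : 0 ≤ ε ^ 2 * (100 * l) := by positivity
      linarith
    calc _ = 300000 * (l * κ ^ 4 * N) / B₂ := by ring
      _ ≤ _ := (div_le_iff₀ hB₂0).2 h1
  · have e1 : 40000000 * (κ * Δ) * B₁ / ε ^ 2 = 4000000000 * l * Δ * (κ / ε ^ 2)
        + 80000000000000000 * l * Δ * S * (κ ^ 2 / (m * ε ^ 4)) := by
      rw [hB₁]; field_simp; ring
    have e2 : 16 * Real.log κ * B₂ / μ = 1600 * (κ * Real.log κ)
        + 4800000 * S * (κ ^ 5 / (m * ε ^ 2) * Real.log κ) := by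
      rw [hB₂, hlκ]; field_simp; ring
    rw [e1] at b1
    rw [e2] at b2
    -- The contributions of the summand 100l are dominated by those of the variance.
    have f1 : κ / ε ^ 2 ≤ κ ^ 2 / (m * ε ^ 4) := by
      calc κ / ε ^ 2 = κ / ε ^ 2 * 1 := (mul_one _).symm
        _ ≤ κ / ε ^ 2 * (κ / (m * ε ^ 2)) := mul_le_mul_of_nonneg_left q1 (by positivity)
        _ = _ := by field_simp
    have f2 : κ * Real.log κ ≤ κ ^ 5 / (m * ε ^ 2) * Real.log κ := by
      calc κ * Real.log κ = κ * Real.log κ * 1 := (mul_one _).symm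
        _ ≤ κ * Real.log κ * (κ ^ 4 / (m * ε ^ 2)) := mul_le_mul_of_nonneg_left q4 (by positivity)
        _ = _ := by ring
    set P := κ ^ 2 / (m * ε ^ 4)
    set Q := κ ^ 5 / (m * ε ^ 2) * Real.log κ
    have hQ : 0 ≤ Q := by positivity
    have hP : 0 ≤ P := by positivity
    have g1 := mul_le_mul_of_nonneg_left f1 (by positivity : 0 ≤ 4000000000 * l * Δ)
    have r1 : 0 ≤ (4000000000 * l * Δ + 80000000000000000 * l * Δ * S) * Q := by positivity
    have r2 : 0 ≤ 4800000 * S * P := by positivity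
    push_cast at b1 b2 ⊢
    linarith

end Regimes

theorem sampVar_of_full {M m : ℕ} {sG : ℝ} (h : m = M ∨ sG = 0) : sampVar M m sG = 0 :=
  if_pos h

theorem sampVar_le (M m : ℕ) (sG : ℝ) : sampVar M m sG ≤ sG ^ 2 / m := by
  unfold sampVar
  split_ifs
  · positivity
  · exact le_rfl

end FedMinimax
end

/-! ### The complexity of the two-stage method. -/

open FedMinimax in
theorem corollary1 (l σ Δ : ℝ) (hl : 0 < l) (hσ : 0 < σ) (hΔ : 0 < Δ) :
    ∃ C₁ : ℝ, 0 < C₁ ∧ ∀ σG : ℝ, 0 ≤ σG → ∃ C₂ : ℝ, 0 < C₂ ∧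
      ∀ (μ κ ε : ℝ) (M m : ℕ), 0 < μ → μ ≤ l → κ = l / μ → 1 ≤ m → m ≤ M →
        0 < ε → m * ε ^ 2 ≤ κ →
        ∃ a b : Params, a.Valid ∧ b.Valid ∧
          ∀ (d₁ d₂ : ℕ) (Ξ : Fin M → Type u) [∀ i, MeasurableSpace (Ξ i)]
            (D : ∀ i, Measure (Ξ i)) [∀ i, IsProbabilityMeasure (D i)]
            (loss : ∀ i, E d₁ → E d₂ → Ξ i → ℝ) (x₀ : E d₁) (y₀ : E d₂) (z₀ : E d₁),
            NCPL l μ σ σG D loss →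
            gap (2 * l) (obj D loss) x₀ y₀ z₀ ≤ Δ →
            Differentiable ℝ (primal (obj D loss)) ∧
            Integrable (fun ω => ‖gradient (primal (obj D loss))
              (output l m a b loss x₀ y₀ z₀ ω)‖) (twoStageLaw m a.T D) ∧
            ∫ ω, ‖gradient (primal (obj D loss))
              (output l m a b loss x₀ y₀ z₀ ω)‖ ∂(twoStageLaw m a.T D) ≤ ε ∧
            ((m = M ∨ σG = 0) → ∀ ω,
              (∀ i, (sampleCost l m a b loss x₀ y₀ z₀ ω i : ℝ)
                ≤ C₁ * (κ ^ 2 / (m * ε ^ 4) + κ ^ 5 / (m * ε ^ 2) * Real.log κ)) ∧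
              (commCost l m a b loss x₀ y₀ z₀ ω : ℝ)
                ≤ C₁ * (κ / ε ^ 2 + κ * Real.log κ)) ∧
            ((m < M ∧ 0 < σG) → ∀ ω,
              (∀ i, (sampleCost l m a b loss x₀ y₀ z₀ ω i : ℝ)
                ≤ C₂ * (κ ^ 2 / (m * ε ^ 4) + κ ^ 5 / (m * ε ^ 2) * Real.log κ)) ∧
              (commCost l m a b loss x₀ y₀ z₀ ω : ℝ)
                ≤ C₂ * (κ ^ 2 / (m * ε ^ 4) + κ ^ 5 / (m * ε ^ 2) * Real.log κ)) := by
  -- Heterogeneity affects the first regime only through the local step size, which costs nothing;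
  -- so this constant can precede `σG`.
  refine ⟨(4000000000 * Δ * l + 2) * (20000000 * σ ^ 2 + 2) + 1604 * (3000 * σ ^ 2 + 2)
    + 4000000000 * Δ * l + 1604, by positivity, fun σG hσG => ?_⟩
  refine ⟨4000000000 * l * Δ + 80000000000000000 * l * Δ * (σ ^ 2 + σG ^ 2) + 1604
    + 4800000 * (σ ^ 2 + σG ^ 2), by positivity, ?_⟩
  intro μ κ ε M m hμ hμl hκ hm hmM hε hmε
  -- Local steps help only if there is no participation error; otherwise one local step per round is
  -- used and the two costs obey the same bound.
  by_cases hc : m = M ∨ σG = 0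
  · obtain ⟨A, K₁, T₁, K₂, T₂, hA, hAl, hK₁, hT₁, hK₂, hT₂, hV₁, hΔ₁, hc₂, hV₂, hsamp, hcomm⟩ :=
      exists_schedule_of_sampVar_eq_zero (σ := σ) hl hμ hμl hκ hε hΔ hm hmε (sampVar_of_full hc)
    obtain ⟨a, b, va, vb, aK, aT, bK, bT, h⟩ := exists_two_stage_params hl hμ hμl hκ hε hσ hm hmM
      hA hAl hA hAl hK₁ hT₁ hK₂ hT₂ hV₁ hΔ₁ hc₂ hV₂
    refine ⟨a, b, va, vb, fun d₁ d₂ Ξ _ D _ loss x₀ y₀ z₀ hp hgap => ?_⟩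
    obtain ⟨h1, h2, h3⟩ := h d₁ d₂ Ξ D loss x₀ y₀ z₀ hp hgap
    refine ⟨h1, h2, h3, fun _ ω => ⟨fun i => ?_, ?_⟩, fun hc' => ?_⟩
    · refine le_trans ?_ hsamp
      rw [← aK, ← aT, ← bK, ← bT]
      exact_mod_cast sampleCost_le l m a b loss x₀ y₀ z₀ ω i
    · rw [commCost_eq, aT, bT]
      exact hcomm
    · rcases hc with hc | hc
      · exact absurd hc hc'.1.ne
      · exact absurd hc hc'.2.ne'
  · obtain ⟨A₁, A₂, T₁, T₂, hA₁, hAl₁, hA₂, hAl₂, hT₁, hT₂, hV₁, hΔ₁, hc₂, hV₂, hcost⟩ :=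
      exists_schedule_single_step hl hμ hμl hκ hε hΔ hσ hm hmε (sampVar_le M m σG)
    obtain ⟨a, b, va, vb, aK, aT, bK, bT, h⟩ := exists_two_stage_params hl hμ hμl hκ hε hσ hm hmM
      hA₁ hAl₁ hA₂ hAl₂ one_pos hT₁ one_pos hT₂ hV₁ hΔ₁ hc₂ hV₂
    refine ⟨a, b, va, vb, fun d₁ d₂ Ξ _ D _ loss x₀ y₀ z₀ hp hgap => ?_⟩
    obtain ⟨h1, h2, h3⟩ := h d₁ d₂ Ξ D loss x₀ y₀ z₀ hp hgap
    refine ⟨h1, h2, h3, fun hc' => absurd hc' hc, fun _ ω => ⟨fun i => ?_, ?_⟩⟩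
    · refine le_trans ?_ hcost
      have := sampleCost_le l m a b loss x₀ y₀ z₀ ω i
      rw [aK, bK, mul_one, mul_one, aT, bT] at this
      exact_mod_cast this
    · rw [commCost_eq, aT, bT]
      exact hcost
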